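/- **Setting.** Time stamps and clock values are non-negative reals. A finite timed word over a finite alphabet $\Sigma$ is $\rho=(\sigma_1,\tau_1)\cdots(\sigma_n,\tau_n)$ with $0\le\tau_1\le\dots\le\tau_n$; put $\tau_0=0$, $\tau(\rho)=\tau_n$ ($\tau(\varepsilon)=0$), and $\tau(L)=\sup_{\rho\in L}\tau(\rho)$ for a language $L$. A timed Büchi automaton (TBA) has finitely many locations, initial locations, a finite alphabet, finitely many clocks, finitely many transitions $(q,q',a,\lambda,g)$ with source $q$, target $q'$, letter $a$, reset set $\lambda$ and guard $g$ (a conjunction of constraints $c\sim n$, $n\in\mathbb N_0$, ${\sim}\in\{<,\le,=,\ge,>\}$), and accepting locations. A run over $\rho$ waits $\tau_i-\tau_{i-1}$ time units before its $i$-th transition. For a TBA $M$, a language $L$ of finite timed words and $t\ge\tau(L)$, the reach-set $\mathcal T_M(L,t)$ is the set of states $(q,v+(t-\tau(\rho)))$ such that $\rho\in L$ and some run of $M$ over $\rho$ from an initial location with all clocks $0$ ends in $(q,v)$; if $t<\tau(L)$, then $\mathcal T_M(L,t)=\emptyset$. $B\otimes A$ is the standard product of TBA over the same alphabet, with locations $Q_B\times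 Q_A\times\{0,1\}$ and the disjoint union of the clocks. A rational $A$-observation is a finite sequence $o=(\phi_1,I_1,m_1)\cdots(\phi_n,I_n,m_n)$ of propositional formulas $\phi_j$ over letters, locations and clock constraints of $A$, bounded intervals $I_j\subseteq\mathbb R_{\ge0}$ with rational endpoints, and multiplicities $m_j\in\{\le e,\ =e,\ \ge e : e\in\mathbb N_0\}$. A run $(q_0,v_0)\cdots(q_{n'},v_{n'})$ of $A$ over $\rho=(\sigma_1,\tau_1)\cdots(\sigma_{n'},\tau_{n'})$ from an initial location with $v_0=0$ witnesses that $\rho$ is consistent with $o$ if there is a monotone $h:\{1,\dots,n'\}\to\{1,\dots,n\}$ such that for all $j'$ the letter $\sigma_{j'}$ and the state $(q_{j'},v_{j'})$ satisfy $\phi_{h(j')}$ and $\tau_{j'}\in I_{h(j')}$, and for all $j$ the number $|h^{-1}(j)|$ satisfies $m_j$. Let $\mathrm{Cons}_A(o)$ be the set of words that are consistent with $o$. A zone is a finite conjunction of constraints $x\sim r$, $x-x'\sim r$ with clocks $x,x'$ and $r\in\mathbb Q_{\ge0}$; a symbolic state is a pair (location, zone). For a set $X$ of states of $M$ with an extra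 clock $time$ that is never reset, and for a formula $\phi$ about the $A$-component of the states of $M$, let $\mathrm{Succ}_{\phi,I}(X)$ be the set of states $(q',v')$ that are reached from states of $X$ by letting time elapse and then taking one transition of $M$, on some letter $\sigma$, such that $v'(time)\in I$ and $\sigma$ and the $A$-component of $(q',v')$ satisfy $\phi$. Let $S_M(o)$ be the set of states of $M$ with clock $time$ in which runs of $M$ over words $\rho$ (from initial locations with all clocks $0$) can end whose $A$-component witnesses that $\rho$ is consistent with $o$; the value of $time$ is $\tau(\rho)$. Below, $M=(B\otimes A)\otimes A$, with the last factor as $A$-component, or $M=A$. **Lemma.** Fix TBA $A$, $B$ over the same alphabet. There is an online algorithm whose memory consists of two finite sets of symbolic states (one for $(B\otimes A)\otimes A$ and one for $A$, both with the extra clock $time$) with the following properties. 1. For every rational $A$-observation $o=(\phi_1,I_1,m_1)\cdots(\phi_n,I_n,m_n)$ and every $t\in\mathbb Q_{\ge0}$ with $t\ge\sup I_n$ (no condition on $t$ if $n=0$), the algorithm, having read $o$ element by element, on query $t$ halts and returns a finite set of symbolic states of $B\otimes A$ that represents exactly $$\mathcal T_{B\otimes A}\big(\mathrm{Cons}_A(o),t\big).$$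 2. (Online.) The initial memory represents $S_M(\varepsilon)$ for both $M$. From any memory that represents $S_M(o)$ for both $M$, and from one further element $(\phi,I,m)$, a partial recursive function (the same for all $o$) computes a memory that represents $S_M(o\,(\phi,I,m))$ for both $M$; and from any such memory and any rational $t\ge\sup I_n$, a partial recursive function computes a finite set of symbolic states that represents $\mathcal T_{B\otimes A}(\mathrm{Cons}_A(o),t)$. 3. (Multiplicities.) For both $M$, every $o$, and every $\phi$, $I$, $e\in\mathbb N_0$: - $S_M(o\,(\phi,I,{=}e))=\mathrm{Succ}_{\phi,I}^{\,e}(S_M(o))$; - $S_M(o\,(\phi,I,{\le}e))$ results from $S_M(o)$ by applying $X\mapsto S_M(o)\cup\mathrm{Succ}_{\phi,I}(X)$ exactly $e$ times; - $S_M(o\,(\phi,I,{\ge}e))$ is the least fixed point of $X\mapsto \mathrm{Succ}_{\phi,I}^{\,e}(S_M(o))\cup\mathrm{Succ}_{\phi,I}(X)$, and it is reached from $\emptyset$ after finitely many iterations. -/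

import Mathlib

open scoped NNReal

namespace TimedMonitoring

/-! ### Finite timed words and timed Büchi automata -/

/-- The five comparison symbols `<, ≤, =, ≥, >`. -/
inductive Cmp where
  | lt | le | eq | ge | gt

namespace Cmp

def Holds : Cmp → ℝ → ℝ → Prop
  | lt, x, y => x < y
  | le, x, y => x ≤ y
  | eq, x, y => x = y
  | ge, x, y => x ≥ y
  | gt, x, y => x > y

/-- The five comparison symbols, numbered. -/
def equivFin : Cmp ≃ Fin 5 where
  toFun
    | lt => 0
    | le => 1
    | eq => 2
    | ge => 3
    | gt => 4
  invFun
    | 0 => lt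
    | 1 => le
    | 2 => eq
    | 3 => ge
    | 4 => gt
  left_inv c := by cases c <;> rfl
  right_inv i := by fin_cases i <;> rfl

instance : Primcodable Cmp := Primcodable.ofEquiv (Fin 5) equivFin

end Cmp

/-- A clock valuation. -/
abbrev Val (C : Type*) := C → ℝ≥0

/-- A clock constraint: a finite conjunction of atomic constraints `c ∼ n` with `n` a natural
number (zero included). -/
abbrev Guard (C : Type*) := List (C × Cmp × ℕ)

def Guard.Sat {C : Type*} (g : Guard C) (v : Val C) : Prop :=
  ∀ a ∈ g, a.2.1.Holds (v a.1) (a.2.2 : ℝ)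

def Guard.map {C D : Type*} (f : C → D) (g : Guard C) : Guard D :=
  List.map (fun a => (f a.1, a.2)) g

/-- A finite timed word: letters together with non-decreasing non-negative real time stamps. -/
structure FinTimedWord (S : Type*) where
  len : ℕ
  letter : Fin len → S
  time : Fin len → ℝ≥0
  mono : Monotone time

namespace FinTimedWord

variable {S : Type*}

/-- The time stamp before position `i`; it is `0` before the first position. -/
def prevTime (ρ : FinTimedWord S) (i : Fin ρ.len) : ℝ≥0 :=
  if (i : ℕ) = 0 then 0 else ρ.time ⟨i - 1, lt_of_le_of_lt (Nat.sub_le _ _) i.2⟩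

/-- The total duration: the last time stamp, or `0` for the empty word. -/
def duration (ρ : FinTimedWord S) : ℝ≥0 :=
  if h : ρ.len = 0 then 0 else ρ.time ⟨ρ.len - 1, Nat.sub_lt (Nat.pos_of_ne_zero h) one_pos⟩

end FinTimedWord

/-- The supremum of the durations of the words of a language; it may be infinite. -/
noncomputable def langDuration {S : Type*} (W : Set (FinTimedWord S)) : ENNReal :=
  ⨆ ρ ∈ W, (ρ.duration : ENNReal)

/-- A transition `(source, target, letter, clocks to reset, guard)`. -/
structure Transition (Q S C : Type*) where
  src : Q
  dst : Q
  letter : S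
  resets : Set C
  guard : Guard C

/-- A timed Büchi automaton with locations `Q`, alphabet `S` and clocks `C`
(finiteness of these three types is assumed where it is used). -/
structure TBA (Q S C : Type*) where
  init : Set Q
  trans : Set (Transition Q S C)
  trans_finite : trans.Finite
  accept : Set Q

open scoped Classical in
/-- Set the clocks in `R` to zero. -/
noncomputable def resetVal {C : Type*} (R : Set C) (v : Val C) : Val C :=
  fun c => if c ∈ R then 0 else v c

namespace TBA

variable {Q S C : Type*}

/-- One move: wait for `d` time units, then take a transition on the letter `a`. -/
def Move (M : TBA Q S C) (x : Q × Val C) (d : ℝ≥0) (a : S) (y : Q × Val C) : Prop :=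
  ∃ e ∈ M.trans, e.src = x.1 ∧ e.dst = y.1 ∧ e.letter = a ∧
    e.guard.Sat (fun c => x.2 c + d) ∧ y.2 = resetVal e.resets (fun c => x.2 c + d)

/-- `r` is a finite run that processes `ρ`, starting in an initial location with all clocks `0`. -/
def IsRun (M : TBA Q S C) (ρ : FinTimedWord S) (r : Fin (ρ.len + 1) → Q × Val C) : Prop :=
  (r 0).1 ∈ M.init ∧ (r 0).2 = 0 ∧
    ∀ i : Fin ρ.len, M.Move (r i.castSucc) (ρ.time i - ρ.prevTime i) (ρ.letter i) (r i.succ)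

/-- The reach-set over `(ρ, t)`; it is used for `t ≥ ρ.duration`. -/
def reachWord (M : TBA Q S C) (ρ : FinTimedWord S) (t : ℝ≥0) : Set (Q × Val C) :=
  {x | ∃ r, M.IsRun ρ r ∧
    x = ((r (Fin.last _)).1, fun c => (r (Fin.last _)).2 c + (t - ρ.duration))}

/-- The reach-set over `(W, t)` for a language `W`. It is the union of the reach-sets of the words
of `W` if `t` is at least the duration of `W`, and empty by convention otherwise. -/
def reach (M : TBA Q S C) (W : Set (FinTimedWord S)) (t : ℝ≥0) : Set (Q × Val C) :=
  {x | langDuration W ≤ (t : ENNReal) ∧ ∃ ρ ∈ W, x ∈ M.reachWord ρ t}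

open scoped Classical in
/-- The next value of the control bit of the product: bit `0` (`false`) waits for an accepting
location of the first automaton, bit `1` (`true`) for one of the second automaton. -/
noncomputable def nextBit {Q' C' : Type*} (M : TBA Q S C) (N : TBA Q' S C')
    (x : Q × Q' × Bool) : Bool :=
  if x.2.2 then decide (x.2.1 ∉ N.accept) else decide (x.1 ∈ M.accept)

/-- The product transition from `x` that combines the transitions `p.1` and `p.2`. -/
noncomputable def prodTransition {Q' C' : Type*} (M : TBA Q S C) (N : TBA Q' S C')
    (p : Transition Q S C × Transition Q' S C') (k : Bool) :
    Transition (Q × Q' × Bool) S (C ⊕ C') where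
  src := (p.1.src, p.2.src, k)
  dst := (p.1.dst, p.2.dst, M.nextBit N (p.1.src, p.2.src, k))
  letter := p.1.letter
  resets := Sum.inl '' p.1.resets ∪ Sum.inr '' p.2.resets
  guard := p.1.guard.map Sum.inl ++ p.2.guard.map Sum.inr

/-- The standard product of timed Büchi automata over the same alphabet, for the intersection of
the languages: locations `Q × Q' × {0, 1}`, disjoint union of the clocks, synchronisation on
letters. -/
noncomputable def prod {Q' C' : Type*} (M : TBA Q S C) (N : TBA Q' S C') :
    TBA (Q × Q' × Bool) S (C ⊕ C') where
  init := {x | x.1 ∈ M.init ∧ x.2.1 ∈ N.init ∧ x.2.2 = false}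
  trans := {e | ∃ p : Transition Q S C × Transition Q' S C', ∃ k : Bool, p.1 ∈ M.trans ∧
    p.2 ∈ N.trans ∧ p.1.letter = p.2.letter ∧ e = M.prodTransition N p k}
  trans_finite := by
    refine (((M.trans_finite.prod N.trans_finite).prod (Set.finite_univ (α := Bool))).image
      (fun z => M.prodTransition N z.1 z.2)).subset ?_
    rintro e ⟨p, k, h1, h2, -, rfl⟩
    exact ⟨(p, k), ⟨⟨h1, h2⟩, trivial⟩, rfl⟩
  accept := {x | x.1 ∈ M.accept ∧ x.2.2 = false}

end TBA

/-! ### Rational observations -/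

/-- A finite representation of a non-negative rational number: `(p, d)` stands for `p / (d + 1)`.
Every non-negative rational number has such representations. -/
abbrev RatCode := ℕ × ℕ

noncomputable def RatCode.val (x : RatCode) : ℝ≥0 := (x.1 : ℝ≥0) / ((x.2 : ℝ≥0) + 1)

/-- A bounded interval of non-negative reals with rational endpoints; the two flags say whether
an endpoint belongs to it. -/
structure RatInterval where
  lo : RatCode
  loClosed : Bool
  hi : RatCode
  hiClosed : Bool

namespace RatInterval

def toSet (I : RatInterval) : Set ℝ≥0 :=
  {x | (I.lo.val < x ∨ (I.loClosed = true ∧ x = I.lo.val)) ∧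
    (x < I.hi.val ∨ (I.hiClosed = true ∧ x = I.hi.val))}

def code (I : RatInterval) : (RatCode × Bool) × (RatCode × Bool) :=
  ((I.lo, I.loClosed), (I.hi, I.hiClosed))

end RatInterval

/-- Propositional formulas over letters, locations and clock constraints. -/
inductive PForm (Q S C : Type*) where
  | letter : S → PForm Q S C
  | loc : Q → PForm Q S C
  | constr : Guard C → PForm Q S C
  | neg : PForm Q S C → PForm Q S C
  | and : PForm Q S C → PForm Q S C → PForm Q S C
  | or : PForm Q S C → PForm Q S C → PForm Q S C

/-- The symbols in which formulas are written: letters, locations, clock constraints, and the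
three connectives (`0` negation, `1` conjunction, `2` disjunction). -/
abbrev Token (Q S C : Type*) := S ⊕ Q ⊕ Guard C ⊕ Fin 3

namespace PForm

variable {Q S C : Type*}

def Sat (a : S) (x : Q × Val C) : PForm Q S C → Prop
  | letter b => b = a
  | loc q => q = x.1
  | constr g => g.Sat x.2
  | neg φ => ¬ Sat a x φ
  | and φ ψ => Sat a x φ ∧ Sat a x ψ
  | or φ ψ => Sat a x φ ∨ Sat a x ψ

/-- The formula as a string of symbols, in prefix notation. -/
def code : PForm Q S C → List (Token Q S C)
  | letter b => [Sum.inl b]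
  | loc q => [Sum.inr (Sum.inl q)]
  | constr g => [Sum.inr (Sum.inr (Sum.inl g))]
  | neg φ => Sum.inr (Sum.inr (Sum.inr 0)) :: φ.code
  | and φ ψ => Sum.inr (Sum.inr (Sum.inr 1)) :: (φ.code ++ ψ.code)
  | or φ ψ => Sum.inr (Sum.inr (Sum.inr 2)) :: (φ.code ++ ψ.code)

end PForm

/-- Multiplicities `≤ e`, `= e`, `≥ e` with `e` a natural number (zero included). -/
inductive Mult where
  | le : ℕ → Mult
  | eq : ℕ → Mult
  | ge : ℕ → Mult

namespace Mult

def Holds : Mult → ℕ → Prop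
  | le e, n => n ≤ e
  | eq e, n => n = e
  | ge e, n => n ≥ e

def code : Mult → Fin 3 × ℕ
  | le e => (0, e)
  | eq e => (1, e)
  | ge e => (2, e)

end Mult

/-- One element `(φ, I, m)` of a rational observation. -/
structure ObsElem (Q S C : Type*) where
  form : PForm Q S C
  ivl : RatInterval
  mult : Mult

/-- A rational observation of an automaton with locations `Q`, alphabet `S` and clocks `C`. -/
abbrev Obs (Q S C : Type*) := List (ObsElem Q S C)

/-- The finite data by which an observation element is handed to an algorithm. -/
abbrev ObsCode (Q S C : Type*) :=
  List (Token Q S C) × ((RatCode × Bool) × (RatCode × Bool)) × (Fin 3 × ℕ)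

def ObsElem.code {Q S C : Type*} (e : ObsElem Q S C) : ObsCode Q S C :=
  (e.form.code, e.ivl.code, e.mult.code)

/-- The supremum of the last interval (`0` for the empty observation). -/
noncomputable def lastSup {Q S C : Type*} (o : Obs Q S C) : ℝ≥0 :=
  match o.getLast? with
  | none => 0
  | some e => sSup e.ivl.toSet

namespace TBA

variable {Q S C : Type*}

/-- The run `r` of `A` witnesses that `ρ` is consistent with `o`. -/
def Witnesses (A : TBA Q S C) (ρ : FinTimedWord S) (r : Fin (ρ.len + 1) → Q × Val C)
    (o : Obs Q S C) : Prop :=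
  A.IsRun ρ r ∧ ∃ h : Fin ρ.len → Fin o.length,
    Monotone h ∧
    (∀ j, (o.get (h j)).form.Sat (ρ.letter j) (r j.succ)) ∧
    (∀ j, ρ.time j ∈ (o.get (h j)).ivl.toSet) ∧
    (∀ i, (o.get i).mult.Holds (Finset.univ.filter (fun j => h j = i)).card)

/-- The language of the words consistent with `o`. -/
def consistentWords (A : TBA Q S C) (o : Obs Q S C) : Set (FinTimedWord S) :=
  {ρ | ∃ r, A.Witnesses ρ r o}

end TBA

/-! ### Zones and symbolic states -/

/-- An atomic zone constraint `x ∼ t` or `x - x' ∼ t` with `t` a non-negative rational. -/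
abbrev ZoneAtom (K : Type*) := (K ⊕ K × K) × Cmp × RatCode

def ZoneAtom.Sat {K : Type*} (v : Val K) : ZoneAtom K → Prop
  | (Sum.inl x, c, t) => c.Holds (v x) (t.val : ℝ)
  | (Sum.inr (x, y), c, t) => c.Holds ((v x : ℝ) - (v y : ℝ)) (t.val : ℝ)

/-- A zone: a finite conjunction of atomic zone constraints. -/
abbrev Zone (K : Type*) := List (ZoneAtom K)

def Zone.toSet {K : Type*} (Z : Zone K) : Set (Val K) := {v | ∀ a ∈ Z, ZoneAtom.Sat v a}

/-- A finite set of symbolic states `(location, zone)`. -/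
abbrev SymStates (L K : Type*) := List (L × Zone K)

/-- The set of states that a finite set of symbolic states represents. -/
def SymStates.toSet {L K : Type*} (M : SymStates L K) : Set (L × Val K) :=
  {x | ∃ s ∈ M, s.1 = x.1 ∧ x.2 ∈ s.2.toSet}

/-! ### Zone operations and successors, on the represented sets -/

/-- `Z ↗`: let time elapse. -/
def elapse {K : Type*} (Z : Set (Val K)) : Set (Val K) :=
  {v | ∃ v' ∈ Z, ∃ d : ℝ≥0, v = fun c => v' c + d}

/-- `Z[R]`: reset the clocks in `R`. -/
def resetZone {K : Type*} (R : Set K) (Z : Set (Val K)) : Set (Val K) := resetVal R '' Z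

section Succ

variable {Q S C : Type*}

/-- The automaton with an additional clock `none` that is never reset and so records the time
since system start. -/
def TBA.withTime (M : TBA Q S C) : TBA Q S (Option C) where
  init := M.init
  trans := (fun e => ⟨e.src, e.dst, e.letter, some '' e.resets, e.guard.map some⟩) '' M.trans
  trans_finite := M.trans_finite.image _
  accept := M.accept

/-- The states in location `q'` that are reached from the states in `Z` at location `q` by taking
a transition on the letter `a` at some point in the future. -/
def post (M : TBA Q S C) (q : Q) (Z : Set (Val C)) (a : S) (q' : Q) : Set (Val C) :=
  ⋃ e ∈ {e ∈ M.trans | e.src = q ∧ e.dst = q' ∧ e.letter = a},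
    resetZone e.resets (elapse Z ∩ {v | e.guard.Sat v})

/-- The successors in location `q'` of the set of states `X`, with the extra clock, for the
letter `a`, with the absolute time of the transition in the interval `I`. -/
def succ (M : TBA Q S C) (X : Set (Q × Val (Option C))) (a : S) (q' : Q) (I : Set ℝ≥0) :
    Set (Q × Val (Option C)) :=
  {y | y.1 = q' ∧ ∃ q, y.2 ∈ post M.withTime q {v | (q, v) ∈ X} a q' ∩ {v | v none ∈ I}}

/-- The successors of `X` for one event that satisfies the formula `φ` at a time in `I`. The maps
`loc` and `clk` single out the component of the automaton `M` that `φ` speaks about. -/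
def obsSucc {Q' C' : Type*} (M : TBA Q S C) (loc : Q → Q') (clk : C' → C)
    (φ : PForm Q' S C') (I : RatInterval) (X : Set (Q × Val (Option C))) :
    Set (Q × Val (Option C)) :=
  ⋃ (a : S) (q' : Q), succ M X a q' I.toSet ∩
    {y | φ.Sat a (loc y.1, fun c => y.2 (some (clk c)))}

/-- The states, with the extra clock, in which runs of `M` over words `ρ` can end whose
`A`-component (singled out by `loc` and `clk`) witnesses that `ρ` is consistent with `o`. -/
def trackSet {Q' C' : Type*} (A : TBA Q' S C') (M : TBA Q S C) (loc : Q → Q') (clk : C' → C)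
    (o : Obs Q' S C') : Set (Q × Val (Option C)) :=
  {x | ∃ (ρ : FinTimedWord S) (r : Fin (ρ.len + 1) → Q × Val C), M.IsRun ρ r ∧
    A.Witnesses ρ (fun i => (loc (r i).1, fun c => (r i).2 (clk c))) o ∧
    x = ((r (Fin.last _)).1, fun c => c.elim ρ.duration (r (Fin.last _)).2)}

/-- The sets `T o` evolve under one more observation element `(φ, I, m)` by iterated successor
operations `F φ I`: exactly `e` iterations for `= e`; the fixed-point operator
`X ↦ T o ∪ F φ I X` unravelled `e` times for `≤ e`; and for `≥ e` the least fixed point of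
`X ↦ Y ∪ F φ I X`, where `Y` is the `e`-fold successor of `T o`, which is reached from the empty
set after finitely many iterations. -/
def EvolvesBySucc {Q' C' X : Type*} (T : Obs Q' S C' → Set X)
    (F : PForm Q' S C' → RatInterval → Set X → Set X) : Prop :=
  ∀ (o : Obs Q' S C') (φ : PForm Q' S C') (I : RatInterval) (e : ℕ),
    T (o ++ [⟨φ, I, .eq e⟩]) = (F φ I)^[e] (T o) ∧
    T (o ++ [⟨φ, I, .le e⟩]) = (fun Y => T o ∪ F φ I Y)^[e] (T o) ∧
    IsLeast {Y | Y = (F φ I)^[e] (T o) ∪ F φ I Y} (T (o ++ [⟨φ, I, .ge e⟩])) ∧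
    ∃ k : ℕ, (fun Y => (F φ I)^[e] (T o) ∪ F φ I Y)^[k] ∅ = T (o ++ [⟨φ, I, .ge e⟩])

end Succ

/-! ### Online algorithms -/

/-- An online algorithm: a memory that is initialised, updated on every input, and queried, where
the update and the query are partial recursive functions. -/
structure OnlineAlgorithm (Mem In Query Out : Type*) [Primcodable Mem] [Primcodable In]
    [Primcodable Query] [Primcodable Out] where
  init : Mem
  step : Mem → In →. Mem
  out : Mem → Query →. Out
  step_partrec : Partrec₂ step
  out_partrec : Partrec₂ out

/-- The memory after reading a sequence of inputs. -/
def OnlineAlgorithm.run {Mem In Query Out : Type*} [Primcodable Mem] [Primcodable In]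
    [Primcodable Query] [Primcodable Out] (P : OnlineAlgorithm Mem In Query Out)
    (l : List In) : Part Mem :=
  l.foldlM P.step P.init

section Algorithm

variable {QA QB S CA CB : Type*}

/-- The memory of a zone-based online algorithm: symbolic states of `(B ⊗ A) ⊗ A` and of `A`,
both with the extra clock that records the time. -/
abbrev Memory (QA QB CA CB : Type*) :=
  SymStates ((QB × QA × Bool) × QA × Bool) (Option ((CB ⊕ CA) ⊕ CA)) × SymStates QA (Option CA)

/-- The reachable states of `(B ⊗ A) ⊗ A`, with the extra clock, where the last component runs
through the runs of `A` that witness consistency with the observation. (A word may have several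
runs in `A`; the reach-set of `B ⊗ A` takes all of them into account, and not only the
witnessing ones.) -/
def productTrack (A : TBA QA S CA) (B : TBA QB S CB) (o : Obs QA S CA) :
    Set (((QB × QA × Bool) × QA × Bool) × Val (Option ((CB ⊕ CA) ⊕ CA))) :=
  trackSet A ((B.prod A).prod A) (fun q => q.2.1) Sum.inr o

/-- The reachable states of `A`, with the extra clock, under runs that witness consistency with
the observation. -/
def selfTrack (A : TBA QA S CA) (o : Obs QA S CA) : Set (QA × Val (Option CA)) :=
  trackSet A A id id o

/-- The memory captures the observation `o`. -/
def Captures (A : TBA QA S CA) (B : TBA QB S CB) (M : Memory QA QB CA CB) (o : Obs QA S CA) :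
    Prop :=
  M.1.toSet = productTrack A B o ∧ M.2.toSet = selfTrack A o

end Algorithm

end TimedMonitoring

open TimedMonitoring

/-! The object to follow is the tracked set of an observation: the timed end states of its
witnessing runs. Since the assignment `h` is monotone, the events assigned to the last element of an
observation are the last events of the word. Hence a run with `n + 1` events in the last element is
a run with `n` such events followed by one move that obeys the formula and the interval
(`trackSet_concat_eq_succ`), and `n = 0` gives back the tracked set of the shorter observation
(`trackSet_concat_eq_zero`). A multiplicity only selects the admissible counts (`trackSet_concat`).
Successors are images under a relation and so commute with unions; therefore the counts `≤ e` are
collected by `e` iterations (`iterate_union_eq`), and the counts `≥ e` make up a least fixed point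
(`isLeast_fixedPoint`).

Successors are computed on zones. Scaling by a common denominator `D` makes all constants integers,
written as a difference of two naturals. Elapse, reset and projection then reduce to Fourier–Motzkin
elimination (`forall_elimVar_sat_iff`), which on difference constraints only adds constants, so `D`
never changes. Formulas become disjunctive normal forms (`satDnf_formDnf`).

The fixed point is reached without any extrapolation of zones, because intervals are bounded. After
a move with time stamp in `I` no clock exceeds the time, so all scaled values are at most some
integer `B`. Two such states with the same location that satisfy the same constraints with constants
up to `B` lie in the same zones over `D` (`mem_toSet_of_zoneSignature_eq`). An increasing chain of
sets represented over `D` can thus grow at most as often as there are such signatures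
(`exists_stationary`). This number is computable from `D` and `I`, and the update simply iterates
that often; it never compares sets.

For the reach-set, an arbitrary run of `B ⊗ A` and a witnessing run of `A` over the same word are
paired into one run of `(B ⊗ A) ⊗ A` (`TBA.reach_eq`). A query lets time elapse until the extra
clock shows `t`, and projects to `B ⊗ A`. The convention for `t` below the duration of the language
is decided on the memory for `A` alone, since words without a run of `B ⊗ A` count for the duration
too. -/

namespace TimedMonitoring

/-! ### Difference constraints with integer constants and elimination of variables -/

/-- The difference constraint `x + p ≤ y + q`, or `x + p < y + q` if the flag is set. -/
abbrev DiffAtom (V : Type*) := (V × ℕ) × (V × ℕ) × Bool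

namespace DiffAtom

variable {V W : Type*}

def Sat (u : V → ℝ) (a : DiffAtom V) : Prop :=
  if a.2.2 then u a.1.1 + a.1.2 < u a.2.1.1 + a.2.1.2 else u a.1.1 + a.1.2 ≤ u a.2.1.1 + a.2.1.2

/-- The constraint that holds exactly if the given one does not. -/
def compl (a : DiffAtom V) : DiffAtom V := (a.2.1, a.1, !a.2.2)

def map (f : V → W) (a : DiffAtom V) : DiffAtom W := ((f a.1.1, a.1.2), (f a.2.1.1, a.2.1.2), a.2.2)

/-- The constraint that follows from a lower bound `l` and an upper bound `r` of a variable. -/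
def trans (l r : DiffAtom V) : DiffAtom V :=
  ((l.1.1, l.1.2 + r.1.2), (r.2.1.1, l.2.1.2 + r.2.1.2), l.2.2 || r.2.2)

theorem sat_compl (u : V → ℝ) (a : DiffAtom V) : a.compl.Sat u ↔ ¬ a.Sat u := by
  obtain ⟨⟨x, p⟩, ⟨y, q⟩, s⟩ := a
  cases s <;> simp [Sat, compl]

/-- A common shift `r` of all variables cancels in differences. With `r` the scaled delay, this is
what expresses elapse of time. -/
theorem sat_map {u : W → ℝ} {u' : V → ℝ} {f : V → W} (r : ℝ) (h : ∀ x, u (f x) = u' x + r)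
    (a : DiffAtom V) : (a.map f).Sat u ↔ a.Sat u' := by
  obtain ⟨⟨x, p⟩, ⟨y, q⟩, s⟩ := a
  cases s <;> simp only [Sat, map, h] <;> constructor <;> intro h <;> simp at h ⊢ <;> linarith

theorem sat_congr {u u' : V → ℝ} {a : DiffAtom V} (h₁ : u a.1.1 = u' a.1.1)
    (h₂ : u a.2.1.1 = u' a.2.1.1) : a.Sat u ↔ a.Sat u' := by
  simp only [Sat, h₁, h₂]

end DiffAtom

section Elimination

variable {V : Type*} [DecidableEq V]

/-- Fourier–Motzkin elimination of the variable `z`; constraints between `z` and itself are turned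
into constraints between `o` and itself. -/
def elimVar (o z : V) (Z : List (DiffAtom V)) : List (DiffAtom V) :=
  Z.filter (fun a => a.1.1 ≠ z ∧ a.2.1.1 ≠ z) ++
  ((Z.filter (fun a => a.1.1 = z ∧ a.2.1.1 = z)).map (DiffAtom.map fun _ => o) ++
  (Z.filter (fun a => a.1.1 ≠ z ∧ a.2.1.1 = z)).flatMap (fun l =>
    (Z.filter (fun a => a.1.1 = z ∧ a.2.1.1 ≠ z)).map (fun r => l.trans r)))

def elimVars (o : V) (zs : List V) (Z : List (DiffAtom V)) : List (DiffAtom V) :=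
  zs.foldr (elimVar o) Z

theorem exists_between_list (c : ℝ) (U : List (ℝ × Bool)) (h : ∀ b ∈ U, c < b.1) :
    ∃ r, c < r ∧ ∀ b ∈ U, r < b.1 := by
  induction U with
  | nil => exact ⟨c + 1, by simp, by simp⟩
  | cons b U ih =>
    obtain ⟨r, hr, hU⟩ := ih fun b hb => h b (by simp [hb])
    obtain ⟨r', h1, h2⟩ := exists_between (lt_min hr (h b (by simp)))
    refine ⟨r', h1, fun b' hb' => ?_⟩
    rcases List.mem_cons.1 hb' with rfl | hb'
    · exact h2.trans_le (min_le_right _ _)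
    · exact (h2.trans_le (min_le_left _ _)).trans (hU _ hb')

/-- Finitely many pairwise compatible lower and upper bounds have a common solution. -/
theorem exists_of_pairwise_bounds (L U : List (ℝ × Bool))
    (h : ∀ a ∈ L, ∀ b ∈ U, if a.2 || b.2 then a.1 < b.1 else a.1 ≤ b.1) :
    ∃ r, (∀ a ∈ L, if a.2 then a.1 < r else a.1 ≤ r) ∧
      ∀ b ∈ U, if b.2 then r < b.1 else r ≤ b.1 := by
  induction L with
  | nil =>
    have : ∃ c : ℝ, ∀ b ∈ U, c < b.1 := by
      clear h
      induction U with
      | nil => exact ⟨0, by simp⟩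
      | cons b U ih =>
        obtain ⟨c, hc⟩ := ih
        refine ⟨min c (b.1 - 1), fun b' hb' => ?_⟩
        rcases List.mem_cons.1 hb' with rfl | hb'
        · exact (min_le_right _ _).trans_lt (by linarith)
        · exact (min_le_left _ _).trans_lt (hc _ hb')
    obtain ⟨c, hc⟩ := this
    refine ⟨c, by simp, fun b hb => ?_⟩
    have := hc b hb
    split_ifs
    · exact this
    · exact this.le
  | cons a L ih =>
    obtain ⟨r, hL, hU⟩ := ih fun a ha b hb => h a (by simp [ha]) b hb
    have ha := h a (by simp)
    have key : ∀ r', r < r' → (∀ a ∈ L, if a.2 then a.1 < r' else a.1 ≤ r') := by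
      intro r' hr' a' ha'
      have := hL a' ha'
      split_ifs at this ⊢ <;> linarith
    -- If the old solution `r` violates the new bound, it is moved up: to `c` itself if the bound is
    -- weak, which `ha` permits, and otherwise to a point strictly between `c` and all upper bounds.
    obtain ⟨c, s⟩ := a
    cases s with
    | false =>
      rcases le_or_gt c r with hc | hc
      · exact ⟨r, by simpa [hc] using hL, hU⟩
      · exact ⟨c, by simpa using key c hc, by simpa using ha⟩
    | true =>
      rcases lt_or_ge c r with hc | hc
      · exact ⟨r, by simpa [hc] using hL, hU⟩
      · obtain ⟨r', h1, h2⟩ := exists_between_list c U (by simpa using ha)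
        refine ⟨r', ?_, fun b hb => ?_⟩
        · simpa [h1] using key r' (hc.trans_lt h1)
        · have := h2 b hb
          split_ifs
          · exact this
          · exact this.le

/-- A constraint with `z` only on the right is a lower bound of `z`, one with `z` only on the left
an upper bound, and pairwise compatibility of these bounds suffices. Where `z` stands on both sides
its value cancels, so any variable `o` may take its place. -/
theorem forall_elimVar_sat_iff (o z : V) (Z : List (DiffAtom V)) (u : V → ℝ) :
    (∀ a ∈ elimVar o z Z, a.Sat u) ↔ ∃ r : ℝ, ∀ a ∈ Z, a.Sat (Function.update u z r) := by
  have hlow : ∀ (a : DiffAtom V) (r : ℝ), a.1.1 ≠ z → a.2.1.1 = z →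
      (a.Sat (Function.update u z r) ↔
        if a.2.2 then u a.1.1 + a.1.2 - a.2.1.2 < r else u a.1.1 + a.1.2 - a.2.1.2 ≤ r) := by
    intro a r h1 h2
    simp only [DiffAtom.Sat, h2, Function.update_self, Function.update_of_ne h1]
    split_ifs <;> constructor <;> intro h <;> linarith
  have hupp : ∀ (a : DiffAtom V) (r : ℝ), a.1.1 = z → a.2.1.1 ≠ z →
      (a.Sat (Function.update u z r) ↔
        if a.2.2 then r < u a.2.1.1 + a.2.1.2 - a.1.2 else r ≤ u a.2.1.1 + a.2.1.2 - a.1.2) := by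
    intro a r h1 h2
    simp only [DiffAtom.Sat, h1, Function.update_self, Function.update_of_ne h2]
    split_ifs <;> constructor <;> intro h <;> linarith
  have hself : ∀ (a : DiffAtom V) (r : ℝ), a.1.1 = z → a.2.1.1 = z →
      (a.Sat (Function.update u z r) ↔ (a.map fun _ => o).Sat u) := by
    intro a r h1 h2
    simp only [DiffAtom.Sat, DiffAtom.map, h1, h2, add_lt_add_iff_left, add_le_add_iff_left]
  have hoff : ∀ (a : DiffAtom V) (r : ℝ), a.1.1 ≠ z → a.2.1.1 ≠ z →
      (a.Sat (Function.update u z r) ↔ a.Sat u) := by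
    intro a r h1 h2
    exact DiffAtom.sat_congr (Function.update_of_ne h1 _ _) (Function.update_of_ne h2 _ _)
  constructor
  · intro h
    obtain ⟨r, hL, hU⟩ := exists_of_pairwise_bounds
      ((Z.filter (fun a => a.1.1 ≠ z ∧ a.2.1.1 = z)).map
        fun a => (u a.1.1 + a.1.2 - a.2.1.2, a.2.2))
      ((Z.filter (fun a => a.1.1 = z ∧ a.2.1.1 ≠ z)).map
        fun a => (u a.2.1.1 + a.2.1.2 - a.1.2, a.2.2)) (by
        intro a ha b hb
        obtain ⟨l, hl, rfl⟩ := List.mem_map.1 ha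
        obtain ⟨r, hr, rfl⟩ := List.mem_map.1 hb
        have := h (l.trans r) (by
          simp only [elimVar, List.mem_append, List.mem_flatMap, List.mem_map]
          exact Or.inr (Or.inr ⟨l, hl, r, hr, rfl⟩))
        simp only [DiffAtom.Sat, DiffAtom.trans, Nat.cast_add] at this
        dsimp only
        split_ifs at this ⊢ <;> linarith)
    refine ⟨r, fun a ha => ?_⟩
    by_cases h1 : a.1.1 = z <;> by_cases h2 : a.2.1.1 = z
    · exact (hself a r h1 h2).2 (h _ (by
        simp only [elimVar, List.mem_append, List.mem_map]
        exact Or.inr (Or.inl ⟨a, by simp [ha, h1, h2], rfl⟩)))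
    · exact (hupp a r h1 h2).2
        (hU (_, _) (List.mem_map.2 ⟨a, by simp [ha, h1, h2], rfl⟩))
    · exact (hlow a r h1 h2).2
        (hL (_, _) (List.mem_map.2 ⟨a, by simp [ha, h1, h2], rfl⟩))
    · exact (hoff a r h1 h2).2 (h _ (by
        simp only [elimVar, List.mem_append]
        exact Or.inl (by simp [ha, h1, h2])))
  · rintro ⟨r, h⟩ a ha
    simp only [elimVar, List.mem_append, List.mem_flatMap, List.mem_map, List.mem_filter,
      decide_eq_true_eq] at ha
    rcases ha with ⟨ha, h1, h2⟩ | ⟨a, ⟨ha, h1, h2⟩, rfl⟩ | ⟨l, ⟨hl, hl1, hl2⟩, b, ⟨hb, hb1, hb2⟩, rfl⟩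
    · exact (hoff a r h1 h2).1 (h a ha)
    · exact (hself a r h1 h2).1 (h a ha)
    · have h1 := (hlow l r hl1 hl2).1 (h l hl)
      have h2 := (hupp b r hb1 hb2).1 (h b hb)
      simp only [DiffAtom.Sat, DiffAtom.trans, Nat.cast_add, Bool.or_eq_true]
      split_ifs at h1 h2 ⊢ <;> first | linarith | simp_all

theorem forall_elimVars_sat_iff (o : V) (zs : List V) (Z : List (DiffAtom V)) (u : V → ℝ) :
    (∀ a ∈ elimVars o zs Z, a.Sat u) ↔
      ∃ w : V → ℝ, (∀ x, x ∉ zs → w x = u x) ∧ ∀ a ∈ Z, a.Sat w := by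
  induction zs generalizing u with
  | nil =>
    simp only [elimVars, List.foldr_nil, List.not_mem_nil, not_false_eq_true, forall_const]
    constructor
    · exact fun h => ⟨u, fun _ => rfl, h⟩
    · rintro ⟨w, hw, h⟩
      rwa [← funext hw]
  | cons z zs ih =>
    have hstep : (∀ a ∈ elimVars o (z :: zs) Z, a.Sat u) ↔ _ := forall_elimVar_sat_iff o z _ u
    rw [hstep]
    constructor
    · rintro ⟨r, hr⟩
      obtain ⟨w, hw, h⟩ := (ih _).1 hr
      refine ⟨w, fun x hx => ?_, h⟩
      simp only [List.mem_cons, not_or] at hx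
      rw [hw x hx.2, Function.update_of_ne hx.1]
    · rintro ⟨w, hw, h⟩
      refine ⟨w z, (ih _).2 ⟨w, fun x hx => ?_, h⟩⟩
      by_cases hxz : x = z
      · subst hxz; simp
      · rw [Function.update_of_ne hxz, hw x (by simp [hx, hxz])]

end Elimination

/-! ### Comparisons with natural constants -/

section Comparisons

variable {V : Type*}

/-- The constraints that express `x - y ∼ n`. -/
def cmpAtoms (x y : V) (c : Cmp) (n : ℕ) : List (DiffAtom V) :=
  match c with
  | .lt => [((x, 0), (y, n), true)]
  | .le => [((x, 0), (y, n), false)]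
  | .eq => [((x, 0), (y, n), false), ((y, n), (x, 0), false)]
  | .ge => [((y, n), (x, 0), false)]
  | .gt => [((y, n), (x, 0), true)]

theorem forall_cmpAtoms_sat_iff (x y : V) (c : Cmp) (n : ℕ) (u : V → ℝ) :
    (∀ a ∈ cmpAtoms x y c n, a.Sat u) ↔ c.Holds (u x - u y) n := by
  cases c <;> simp [cmpAtoms, DiffAtom.Sat, Cmp.Holds]
  case lt => constructor <;> intro h <;> linarith
  case le => constructor <;> intro h <;> linarith
  case eq =>
    constructor
    · rintro ⟨h1, h2⟩; linarith
    · intro h; constructor <;> linarith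
  case ge => constructor <;> intro h <;> linarith
  case gt => constructor <;> intro h <;> linarith

theorem Cmp.holds_mul_iff {D : ℝ} (hD : 0 < D) (c : Cmp) (x y : ℝ) :
    c.Holds (D * x) (D * y) ↔ c.Holds x y := by
  cases c <;> simp [Cmp.Holds, hD, hD.ne']

end Comparisons

/-! ### Zones as sets of integer difference constraints -/

/-- The variables in which zones over the clocks `K` are manipulated: `none` stands for zero,
`some none` is auxiliary, and the others are the clocks. -/
abbrev ZVar (K : Type*) := Option (Option K)

/-- The clock `c` as a variable. -/
abbrev cvar {K : Type*} (c : K) : ZVar K := some (some c)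

/-- The values of the variables under a clock valuation, scaled by `D`; variables that do not stand
for a clock are zero. -/
noncomputable def scaledVal {V K : Type*} (f : V → Option K) (D : ℕ) (v : Val K) (x : V) : ℝ :=
  (f x).elim 0 fun c => D * v c

section Scaling

variable {K : Type*}

@[simp] theorem scaledVal_cvar (D : ℕ) (v : Val K) (c : K) :
    scaledVal Option.join D v (cvar c) = D * v c := rfl

@[simp] theorem scaledVal_none (D : ℕ) (v : Val K) :
    scaledVal Option.join D v none = 0 := rfl

@[simp] theorem scaledVal_some_none (D : ℕ) (v : Val K) :
    scaledVal Option.join D v (some none) = 0 := rfl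

/-- The number `D * t` as a natural number. -/
def RatCode.scale (D : ℕ) (t : RatCode) : ℕ := t.1 * (D / (t.2 + 1))

/-- The natural-number division in `scale` is exact only because the denominator divides `D`; this
is why divisibility is assumed of all constants below. -/
theorem RatCode.scale_eq {D : ℕ} {t : RatCode} (h : t.2 + 1 ∣ D) :
    (t.scale D : ℝ) = D * (t.val : ℝ) := by
  obtain ⟨k, rfl⟩ := h
  have : (t.2 : ℝ) + 1 ≠ 0 := by positivity
  simp only [scale, val, Nat.mul_div_cancel_left _ (Nat.succ_pos _)]
  push_cast
  field_simp

/-- A list of integer difference constraints holds for a clock valuation. -/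
def SatZone (D : ℕ) (Z : List (DiffAtom (ZVar K))) (v : Val K) : Prop :=
  ∀ a ∈ Z, a.Sat (scaledVal Option.join D v)

theorem satZone_append {D : ℕ} {Z Z' : List (DiffAtom (ZVar K))} {v : Val K} :
    SatZone D (Z ++ Z') v ↔ SatZone D Z v ∧ SatZone D Z' v := by
  simp only [SatZone, List.mem_append, or_imp, forall_and]

/-! ### Translation of zones, guards and intervals -/

def zoneVars : K ⊕ K × K → ZVar K × ZVar K :=
  Sum.elim (fun x => (cvar x, none)) (fun p => (cvar p.1, cvar p.2))

def ZoneAtom.toDiff (D : ℕ) (a : ZoneAtom K) : List (DiffAtom (ZVar K)) :=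
  cmpAtoms (zoneVars a.1).1 (zoneVars a.1).2 a.2.1 (a.2.2.scale D)

def Zone.toDiff (D : ℕ) (Z : Zone K) : List (DiffAtom (ZVar K)) := Z.flatMap (ZoneAtom.toDiff D)

theorem ZoneAtom.satZone_toDiff {D : ℕ} (hD : 0 < D) (a : ZoneAtom K) (ha : a.2.2.2 + 1 ∣ D)
    (v : Val K) : SatZone D (a.toDiff D) v ↔ a.Sat v := by
  obtain ⟨x | ⟨x, y⟩, c, t⟩ := a
  · simp only [SatZone, toDiff, forall_cmpAtoms_sat_iff, zoneVars, Sum.elim_inl, scaledVal_cvar,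
      scaledVal_none, sub_zero, RatCode.scale_eq ha, Sat,
      Cmp.holds_mul_iff (D := (D : ℝ)) (by exact_mod_cast hD)]
  · simp only [SatZone, toDiff, forall_cmpAtoms_sat_iff, zoneVars, Sum.elim_inr, scaledVal_cvar,
      ← mul_sub, RatCode.scale_eq ha, Sat,
      Cmp.holds_mul_iff (D := (D : ℝ)) (by exact_mod_cast hD)]

theorem Zone.satZone_toDiff {D : ℕ} (hD : 0 < D) (Z : Zone K) (hZ : ∀ a ∈ Z, a.2.2.2 + 1 ∣ D)
    (v : Val K) : SatZone D (Z.toDiff D) v ↔ v ∈ Z.toSet := by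
  simp only [SatZone, toDiff, List.mem_flatMap, forall_exists_index, and_imp, toSet,
    Set.mem_ofPred_eq]
  constructor
  · exact fun h a ha => (ZoneAtom.satZone_toDiff hD a (hZ a ha) v).1 fun b hb => h b a ha hb
  · exact fun h b a ha hb => (ZoneAtom.satZone_toDiff hD a (hZ a ha) v).2 (h a ha) b hb

def Guard.toDiff {C : Type*} (f : C → K) (D : ℕ) (g : Guard C) : List (DiffAtom (ZVar K)) :=
  List.flatMap (fun a => cmpAtoms (cvar (f a.1)) none a.2.1 (D * a.2.2)) g

theorem Guard.satZone_toDiff {C : Type*} (f : C → K) {D : ℕ} (hD : 0 < D) (g : Guard C)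
    (v : Val K) : SatZone D (g.toDiff f D) v ↔ g.Sat fun c => v (f c) := by
  have key : ∀ a : C × Cmp × ℕ,
      (∀ b ∈ cmpAtoms (cvar (f a.1)) none a.2.1 (D * a.2.2), b.Sat (scaledVal Option.join D v)) ↔
        a.2.1.Holds (v (f a.1)) (a.2.2 : ℝ) := by
    intro a
    rw [forall_cmpAtoms_sat_iff, scaledVal_cvar, scaledVal_none, sub_zero, Nat.cast_mul,
      Cmp.holds_mul_iff (by exact_mod_cast hD)]
  simp only [SatZone, toDiff, List.mem_flatMap, forall_exists_index, and_imp, Sat]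
  constructor
  · exact fun h a ha => (key a).1 fun b hb => h b a ha hb
  · exact fun h b a ha hb => (key a).2 (h a ha) b hb

/-- The constraints that put the clock `τ` into an interval. -/
def ivlDiff (τ : K) (D : ℕ) (I : (RatCode × Bool) × (RatCode × Bool)) : List (DiffAtom (ZVar K)) :=
  [((none, I.1.1.scale D), (cvar τ, 0), !I.1.2), ((cvar τ, 0), (none, I.2.1.scale D), !I.2.2)]

theorem satZone_ivlDiff (τ : K) {D : ℕ} (hD : 0 < D) (I : RatInterval) (hlo : I.lo.2 + 1 ∣ D)
    (hhi : I.hi.2 + 1 ∣ D) (v : Val K) : SatZone D (ivlDiff τ D I.code) v ↔ v τ ∈ I.toSet := by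
  have hD' : (0 : ℝ) < D := by exact_mod_cast hD
  obtain ⟨lo, lc, hi, hc⟩ := I
  simp only [SatZone, ivlDiff, RatInterval.code, RatInterval.toSet, List.forall_mem_cons,
    List.not_mem_nil, false_imp_iff, implies_true, and_true, DiffAtom.Sat, scaledVal_cvar,
    scaledVal_none, zero_add, Nat.cast_zero, add_zero, Set.mem_ofPred_eq]
  rw [RatCode.scale_eq hlo, RatCode.scale_eq hhi]
  simp only [mul_lt_mul_iff_right₀ hD', mul_le_mul_iff_right₀ hD', NNReal.coe_lt_coe,
    NNReal.coe_le_coe]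
  cases lc <;> cases hc <;> simp [le_iff_lt_or_eq, eq_comm]

/-! ### Elapse of time, and resets -/

variable [DecidableEq K]

theorem exists_nnreal_mul_eq {D r : ℝ} (hD : 0 < D) (hr : 0 ≤ r) : ∃ d : ℝ≥0, D * d = r := by
  refine ⟨Real.toNNReal (r / D), ?_⟩
  rw [Real.coe_toNNReal _ (div_nonneg hr hD.le)]
  field_simp

def nonnegAtom (x : ZVar K) : DiffAtom (ZVar K) := ((none, 0), (x, 0), false)

/-- The auxiliary variable `some none` is the delay `d`. In terms of the later clock values, every
earlier clock value, and also zero, is shifted by `d`; hence `fun x => some x.join` fixes the clocks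
and replaces zero by `d`. The added atoms `0 ≤ d` and `d ≤ c` make the delay and the earlier values
non-negative, and then `d` is eliminated. -/
noncomputable def elapseDiff [Fintype K] (Z : List (DiffAtom (ZVar K))) : List (DiffAtom (ZVar K)) :=
  elimVar none (some none) (Z.map (DiffAtom.map fun x => some x.join) ++
    nonnegAtom (some none) ::
      Finset.univ.toList.map (fun c : K => ((some none, 0), (cvar c, 0), false)))

theorem satZone_elapseDiff [Fintype K] {D : ℕ} (hD : 0 < D) (Z : List (DiffAtom (ZVar K))) (w : Val K) :
    SatZone D (elapseDiff Z) w ↔ ∃ v, SatZone D Z v ∧ ∃ d : ℝ≥0, w = fun c => v c + d := by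
  have hD' : (0 : ℝ) < D := by exact_mod_cast hD
  have hsat : ∀ (v : Val K) (d : ℝ≥0) (a : DiffAtom (ZVar K)), (w = fun c => v c + d) →
      ((a.map fun x => some x.join).Sat
        (Function.update (scaledVal Option.join D w) (some none) (D * d)) ↔
        a.Sat (scaledVal Option.join D v)) := by
    rintro v d a rfl
    refine DiffAtom.sat_map (D * d : ℝ) (fun x => ?_) a
    rcases x with _ | _ | c
    · simp
    · simp
    · have : (cvar c : ZVar K) ≠ some none := by simp [cvar]
      simp only [Option.join_some]
      rw [Function.update_of_ne this, scaledVal_cvar, scaledVal_cvar]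
      push_cast
      ring
  have hcl : ∀ (c : K) (r : ℝ), Function.update (scaledVal Option.join D w) (some none) r (cvar c)
      = D * w c := fun c r => by
    rw [Function.update_of_ne (by simp [cvar]), scaledVal_cvar]
  unfold SatZone elapseDiff
  rw [forall_elimVar_sat_iff]
  simp only [List.mem_append, List.mem_map, List.mem_cons, Finset.mem_toList, Finset.mem_univ,
    true_and, or_imp, forall_and, forall_exists_index, and_imp, forall_apply_eq_imp_iff₂,
    forall_apply_eq_imp_iff, forall_eq]
  constructor
  · rintro ⟨r, hZ, h0, hc⟩
    simp only [nonnegAtom, DiffAtom.Sat, Function.update_self, hcl, Nat.cast_zero, add_zero,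
      Bool.false_eq_true, if_false] at h0 hc
    rw [Function.update_of_ne (by simp), scaledVal_none] at h0
    obtain ⟨d, rfl⟩ := exists_nnreal_mul_eq hD' h0
    -- Subtraction in `ℝ≥0` is truncated; the atoms `d ≤ c` make it exact here.
    have hw : w = fun c => (w c - d) + d := by
      funext c
      refine (tsub_add_cancel_of_le ?_).symm
      rw [← NNReal.coe_le_coe]
      exact le_of_mul_le_mul_left (hc c) hD'
    refine ⟨fun c => w c - d, fun a ha => ?_, d, hw⟩
    rw [← hsat _ _ a hw]
    exact hZ a ha
  · rintro ⟨v, hZ, d, hw⟩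
    refine ⟨D * d, fun a ha => (hsat v d a hw).2 (hZ a ha), ?_, fun c => ?_⟩
    · simp only [nonnegAtom, DiffAtom.Sat, Function.update_self]
      rw [Function.update_of_ne (by simp), scaledVal_none]
      simp only [Bool.false_eq_true, if_false, Nat.cast_zero, add_zero]
      positivity
    · simp only [DiffAtom.Sat, Function.update_self, hcl, Nat.cast_zero, add_zero,
        Bool.false_eq_true, if_false]
      rw [hw]
      push_cast
      exact mul_le_mul_of_nonneg_left (by simp) hD'.le

/-- The projection of a zone along the clocks in `R`, which become unconstrained. -/
def forgetDiff (R : List K) (Z : List (DiffAtom (ZVar K))) :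
    List (DiffAtom (ZVar K)) :=
  elimVars none (R.map cvar) (Z ++ R.map fun c => nonnegAtom (cvar c))

/-- The assignment `u` need not come from a valuation of `K`, so that the lemma covers resets, the
non-emptiness test (`u = 0`) and the projection to fewer clocks. The added non-negativity atoms
guarantee that the eliminated variables take values that clocks can have. -/
theorem forall_forgetDiff_sat_iff {D : ℕ} (hD : 0 < D) (R : List K)
    (Z : List (DiffAtom (ZVar K))) (u : ZVar K → ℝ) (hu : u none = 0) (hu' : u (some none) = 0)
    (hpos : ∀ c, c ∉ R → 0 ≤ u (cvar c)) :
    (∀ a ∈ forgetDiff R Z, a.Sat u) ↔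
      ∃ v : Val K, SatZone D Z v ∧ ∀ c, c ∉ R → u (cvar c) = D * v c := by
  have hD' : (0 : ℝ) < D := by exact_mod_cast hD
  unfold forgetDiff
  rw [forall_elimVars_sat_iff]
  simp only [List.mem_append, or_imp, forall_and, List.mem_map, forall_exists_index, and_imp,
    forall_apply_eq_imp_iff₂]
  constructor
  · rintro ⟨w, hw, hZ, hn⟩
    have hw0 : w none = 0 := by rw [hw none (by simp), hu]
    have hw1 : w (some none) = 0 := by rw [hw _ (by simp), hu']
    have hw2 : ∀ c, c ∉ R → w (cvar c) = u (cvar c) := fun c hc =>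
      hw _ (by rintro ⟨x, hx, hxc⟩; simp only [Option.some.injEq] at hxc; exact hc (hxc ▸ hx))
    have hnn : ∀ c, 0 ≤ w (cvar c) := by
      intro c
      by_cases hc : c ∈ R
      · have := hn c hc
        simpa [nonnegAtom, DiffAtom.Sat, hw0] using this
      · rw [hw2 c hc]
        exact hpos c hc
    choose v hv using fun c => exists_nnreal_mul_eq hD' (hnn c)
    have hwv : w = scaledVal Option.join D v := by
      funext x
      rcases x with _ | _ | c
      · rw [hw0, scaledVal_none]
      · rw [hw1, scaledVal_some_none]
      · exact (hv c).symm
    refine ⟨v, ?_, fun c hc => ?_⟩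
    · intro a ha
      rw [← hwv]
      exact hZ a ha
    · rw [← hw2 c hc, hv c]
  · rintro ⟨v, hZ, hv⟩
    refine ⟨scaledVal Option.join D v, fun x hx => ?_, hZ, fun c _ => ?_⟩
    · rcases x with _ | _ | c
      · simp [hu]
      · simp [hu']
      · rw [scaledVal_cvar, hv c fun hc => hx ⟨c, hc, rfl⟩]
    · simp only [nonnegAtom, DiffAtom.Sat, scaledVal_none, scaledVal_cvar, Nat.cast_zero, add_zero,
        Bool.false_eq_true, if_false]
      positivity

/-- An upper bound by zero is enough, because valuations are non-negative. -/
def resetDiff (R : List K) (Z : List (DiffAtom (ZVar K))) :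
    List (DiffAtom (ZVar K)) :=
  forgetDiff R Z ++ R.map fun c => ((cvar c, 0), (none, 0), false)

theorem satZone_resetDiff {D : ℕ} (hD : 0 < D) (R : List K) (Z : List (DiffAtom (ZVar K)))
    (w : Val K) :
    SatZone D (resetDiff R Z) w ↔ ∃ v, SatZone D Z v ∧ w = resetVal {c | c ∈ R} v := by
  have hD' : (0 : ℝ) < D := by exact_mod_cast hD
  unfold resetDiff
  rw [satZone_append]
  unfold SatZone
  rw [forall_forgetDiff_sat_iff hD R Z _ rfl rfl
    (fun c _ => by rw [scaledVal_cvar]; positivity)]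
  have h0 : (∀ a ∈ R.map (fun c => (((cvar c, 0), (none, 0), false) : DiffAtom (ZVar K))),
      DiffAtom.Sat (scaledVal Option.join D w) a) ↔ ∀ c ∈ R, w c = 0 := by
    simp only [List.mem_map, forall_exists_index, and_imp, forall_apply_eq_imp_iff₂, DiffAtom.Sat,
      scaledVal_cvar, scaledVal_none, Nat.cast_zero, add_zero, Bool.false_eq_true, if_false]
    refine forall₂_congr fun c _ => ?_
    rw [← NNReal.coe_eq_zero]
    constructor
    · intro h
      exact le_antisymm (nonpos_of_mul_nonpos_right h hD') (w c).2
    · intro h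
      rw [h, mul_zero]
  rw [h0]
  constructor
  · rintro ⟨⟨v, hv, hvw⟩, hR⟩
    refine ⟨v, hv, funext fun c => ?_⟩
    by_cases hc : c ∈ R
    · simp [resetVal, hc, hR c hc]
    · have := hvw c hc
      rw [scaledVal_cvar] at this
      simpa [resetVal, hc] using NNReal.coe_injective (mul_left_cancel₀ hD'.ne' this)
  · rintro ⟨v, hv, rfl⟩
    refine ⟨⟨v, hv, fun c hc => ?_⟩, fun c hc => ?_⟩
    · simp [resetVal, hc]
    · simp [resetVal, hc]

end Scaling

/-! ### Evaluation of formulas to disjunctive normal forms -/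

/-- A disjunction of conjunctions of difference constraints. -/
abbrev Dnf (V : Type*) := List (List (DiffAtom V))

section Formulas

variable {K : Type*}

def SatDnf (D : ℕ) (F : Dnf (ZVar K)) (v : Val K) : Prop := ∃ Z ∈ F, SatZone D Z v

def Dnf.inf {V : Type*} (F G : Dnf V) : Dnf V :=
  List.flatMap (fun Z => List.map (fun Z' => Z ++ Z') G) F

theorem satDnf_append {D : ℕ} {F G : Dnf (ZVar K)} {v : Val K} :
    SatDnf D (F ++ G) v ↔ SatDnf D F v ∨ SatDnf D G v := by
  simp only [SatDnf, List.mem_append, or_and_right, exists_or]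

theorem satDnf_inf {D : ℕ} {F G : Dnf (ZVar K)} {v : Val K} :
    SatDnf D (F.inf G) v ↔ SatDnf D F v ∧ SatDnf D G v := by
  simp only [SatDnf, Dnf.inf, List.mem_flatMap, List.mem_map]
  constructor
  · rintro ⟨_, ⟨Z, hZ, Z', hZ', rfl⟩, h⟩
    rw [satZone_append] at h
    exact ⟨⟨Z, hZ, h.1⟩, Z', hZ', h.2⟩
  · rintro ⟨⟨Z, hZ, h⟩, Z', hZ', h'⟩
    exact ⟨_, ⟨Z, hZ, Z', hZ', rfl⟩, satZone_append.2 ⟨h, h'⟩⟩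

/-- The negation of a conjunction. -/
def complZone {V : Type*} (Z : List (DiffAtom V)) : Dnf V := Z.map fun a => [a.compl]

theorem satDnf_complZone {D : ℕ} {Z : List (DiffAtom (ZVar K))} {v : Val K} :
    SatDnf D (complZone Z) v ↔ ¬ SatZone D Z v := by
  simp only [SatDnf, complZone, SatZone, List.mem_map, exists_exists_and_eq_and,
    List.mem_singleton, forall_eq, DiffAtom.sat_compl, not_forall, exists_prop]

/-- A truth value, with its negation. -/
def boolDnf (V : Type*) (b : Bool) : Dnf V × Dnf V := if b then ([[]], []) else ([], [[]])

/-- The effect of a connective on a stack of normal forms of formulas and of their negations. -/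
def connStep {V : Type*} (i : Fin 3) (st : List (Dnf V × Dnf V)) : List (Dnf V × Dnf V) :=
  if i = 0 then (st.headI.2, st.headI.1) :: st.tail
  else if i = 1 then
    (st.headI.1.inf st.tail.headI.1, st.headI.2 ++ st.tail.headI.2) :: st.tail.tail
  else (st.headI.1 ++ st.tail.headI.1, st.headI.2.inf st.tail.headI.2) :: st.tail.tail

variable {Q S C : Type*} [DecidableEq Q] [DecidableEq S]

/-- The evaluation, from right to left, of a formula in prefix notation at a given letter and
location. -/
def tokenStep (a : S) (q : Q) (f : C → K) (D : ℕ) (tok : Token Q S C)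
    (st : List (Dnf (ZVar K) × Dnf (ZVar K))) : List (Dnf (ZVar K) × Dnf (ZVar K)) :=
  Sum.elim (fun b => boolDnf _ (decide (b = a)) :: st)
    (Sum.elim (fun p => boolDnf _ (decide (p = q)) :: st)
      (Sum.elim (fun g : Guard C => ([g.toDiff f D], complZone (g.toDiff f D)) :: st)
        (fun i => connStep i st))) tok

def formDnf (a : S) (q : Q) (f : C → K) (D : ℕ) (l : List (Token Q S C)) : Dnf (ZVar K) :=
  (l.foldr (tokenStep a q f D) []).headI.1

theorem satDnf_boolDnf {D : ℕ} {b : Bool} {v : Val K} :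
    (SatDnf D (boolDnf _ b).1 v ↔ b = true) ∧ (SatDnf D (boolDnf _ b).2 v ↔ ¬ b = true) := by
  cases b <;> simp [boolDnf, SatDnf, SatZone]

/-- When prefix notation is read from the right, the operands of a connective are on top of the
stack, the left one first, by the time the connective is met. Carrying the normal form of the
negation along turns negation into a swap. The arbitrary `rest` makes the induction work for second
operands. -/
theorem exists_foldr_tokenStep (a : S) (q : Q) (f : C → K) {D : ℕ} (hD : 0 < D)
    (φ : PForm Q S C) (rest : List (Token Q S C)) :
    ∃ F : Dnf (ZVar K) × Dnf (ZVar K),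
      (φ.code ++ rest).foldr (tokenStep a q f D) [] =
        F :: rest.foldr (tokenStep a q f D) [] ∧
      ∀ v : Val K, (SatDnf D F.1 v ↔ φ.Sat a (q, fun c => v (f c))) ∧
        (SatDnf D F.2 v ↔ ¬ φ.Sat a (q, fun c => v (f c))) := by
  induction φ generalizing rest with
  | letter b =>
    exact ⟨_, rfl, fun v => by simpa [PForm.Sat] using satDnf_boolDnf (b := decide (b = a))⟩
  | loc p =>
    exact ⟨_, rfl, fun v => by simpa [PForm.Sat] using satDnf_boolDnf (b := decide (p = q))⟩
  | constr g =>
    refine ⟨_, rfl, fun v => ?_⟩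
    simp only [PForm.Sat]
    rw [satDnf_complZone, Guard.satZone_toDiff f hD]
    simp [SatDnf, Guard.satZone_toDiff f hD]
  | neg φ ih =>
    obtain ⟨F, hF, h⟩ := ih rest
    refine ⟨(F.2, F.1), ?_, fun v => ?_⟩
    · simp only [PForm.code, List.cons_append, List.foldr_cons, hF]
      rfl
    · simp only [PForm.Sat, (h v).1, (h v).2, not_not, and_self]
  | and φ ψ ih₁ ih₂ =>
    obtain ⟨G, hG, h'⟩ := ih₂ rest
    obtain ⟨F, hF, h⟩ := ih₁ (ψ.code ++ rest)
    refine ⟨(F.1.inf G.1, F.2 ++ G.2), ?_, fun v => ?_⟩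
    · simp only [PForm.code, List.cons_append, List.append_assoc, List.foldr_cons, hF, hG]
      rfl
    · simp only [PForm.Sat, satDnf_inf, satDnf_append, (h v).1, (h v).2, (h' v).1, (h' v).2]
      tauto
  | or φ ψ ih₁ ih₂ =>
    obtain ⟨G, hG, h'⟩ := ih₂ rest
    obtain ⟨F, hF, h⟩ := ih₁ (ψ.code ++ rest)
    refine ⟨(F.1 ++ G.1, F.2.inf G.2), ?_, fun v => ?_⟩
    · simp only [PForm.code, List.cons_append, List.append_assoc, List.foldr_cons, hF, hG]
      rfl
    · simp only [PForm.Sat, satDnf_inf, satDnf_append, (h v).1, (h v).2, (h' v).1, (h' v).2]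
      tauto

theorem satDnf_formDnf (a : S) (q : Q) (f : C → K) {D : ℕ} (hD : 0 < D) (φ : PForm Q S C)
    (v : Val K) : SatDnf D (formDnf a q f D φ.code) v ↔ φ.Sat a (q, fun c => v (f c)) := by
  obtain ⟨F, hF, h⟩ := exists_foldr_tokenStep a q f hD φ []
  rw [List.append_nil] at hF
  rw [formDnf, hF]
  exact (h v).1

end Formulas

/-! ### The successor operation on symbolic states -/

section Successors

/-- Symbolic states with integer difference constraints. -/
abbrev DiffStates (L K : Type*) := List (L × List (DiffAtom (ZVar K)))

/-- The represented set of states, where the constants are multiples of `1 / D`. -/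
def DiffStates.toSet {L K : Type*} (D : ℕ) (X : DiffStates L K) : Set (L × Val K) :=
  {x | ∃ s ∈ X, s.1 = x.1 ∧ SatZone D s.2 x.2}

theorem DiffStates.toSet_append {L K : Type*} (D : ℕ) (X Y : DiffStates L K) :
    DiffStates.toSet D (X ++ Y) = DiffStates.toSet D X ∪ DiffStates.toSet D Y := by
  ext x
  simp only [DiffStates.toSet, List.mem_append, or_and_right, exists_or, Set.mem_ofPred_eq,
    Set.mem_union]

def SymStates.toDiff {L K : Type*} (D : ℕ) (X : SymStates L K) : DiffStates L K :=
  X.map fun s => (s.1, s.2.toDiff D)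

theorem SymStates.toSet_toDiff {L K : Type*} {D : ℕ} (hD : 0 < D) (X : SymStates L K)
    (hX : ∀ s ∈ X, ∀ a ∈ s.2, a.2.2.2 + 1 ∣ D) :
    DiffStates.toSet D (X.toDiff D) = X.toSet := by
  ext x
  simp only [DiffStates.toSet, SymStates.toSet, toDiff, List.mem_map, Set.mem_ofPred_eq]
  constructor
  · rintro ⟨_, ⟨s, hs, rfl⟩, h1, h2⟩
    exact ⟨s, hs, h1, (Zone.satZone_toDiff hD s.2 (hX s hs) _).1 h2⟩
  · rintro ⟨s, hs, h1, h2⟩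
    exact ⟨_, ⟨s, hs, rfl⟩, h1, (Zone.satZone_toDiff hD s.2 (hX s hs) _).2 h2⟩

/-- The code of an interval. -/
abbrev IvlCode := (RatCode × Bool) × (RatCode × Bool)

variable {Q S K Q' C' : Type*} [Fintype K] [DecidableEq K]

/-- The effect of waiting and then taking the transition `e`. -/
noncomputable def transDiff (e : Transition Q S K) (D : ℕ) (Z : List (DiffAtom (ZVar K))) :
    List (DiffAtom (ZVar K)) :=
  resetDiff e.resets.toFinite.toFinset.toList (elapseDiff Z ++ e.guard.toDiff id D)

theorem satZone_transDiff (e : Transition Q S K) {D : ℕ} (hD : 0 < D)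
    (Z : List (DiffAtom (ZVar K))) (w : Val K) :
    SatZone D (transDiff e D Z) w ↔
      w ∈ resetZone e.resets (elapse {v | SatZone D Z v} ∩ {v | e.guard.Sat v}) := by
  rw [transDiff, satZone_resetDiff hD]
  simp only [satZone_append, satZone_elapseDiff hD, Guard.satZone_toDiff id hD, Finset.mem_toList,
    Set.Finite.mem_toFinset, resetZone, elapse, Set.mem_image, Set.mem_inter_iff,
    Set.mem_ofPred_eq, id, eq_comm (a := w)]
  rfl

variable [DecidableEq Q] [DecidableEq S] [DecidableEq Q']

/-- The successors of symbolic states under the transition `e`. -/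
noncomputable def transSucc (loc : Q → Q') (f : C' → K) (τ : K) (e : Transition Q S K) (D : ℕ)
    (l : List (Token Q' S C')) (I : IvlCode) (X : DiffStates Q K) : DiffStates Q K :=
  X.flatMap fun s => if s.1 = e.src then
    (formDnf e.letter (loc e.dst) f D l).map fun Z =>
      (e.dst, transDiff e D s.2 ++ (ivlDiff τ D I ++ Z)) else []

noncomputable def succDiff (E : List (Transition Q S K)) (loc : Q → Q') (f : C' → K) (τ : K)
    (D : ℕ) (l : List (Token Q' S C')) (I : IvlCode) (X : DiffStates Q K) : DiffStates Q K :=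
  E.flatMap fun e => transSucc loc f τ e D l I X

/-- The transition fixes letter and target, so only the clock constraints of `φ` remain open;
interval and formula are imposed after the reset. The same `D` serves before and after the move,
which the termination argument needs. -/
theorem mem_toSet_transSucc (loc : Q → Q') (f : C' → K) (τ : K) (e : Transition Q S K) {D : ℕ}
    (hD : 0 < D) (φ : PForm Q' S C') (I : RatInterval) (hlo : I.lo.2 + 1 ∣ D)
    (hhi : I.hi.2 + 1 ∣ D) (X : DiffStates Q K) (y : Q × Val K) :
    y ∈ DiffStates.toSet D (transSucc loc f τ e D φ.code I.code X) ↔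
      e.dst = y.1 ∧ y.2 τ ∈ I.toSet ∧ φ.Sat e.letter (loc e.dst, fun c => y.2 (f c)) ∧
      y.2 ∈ resetZone e.resets
        (elapse {v | (e.src, v) ∈ DiffStates.toSet D X} ∩ {v | e.guard.Sat v}) := by
  rw [← satDnf_formDnf e.letter (loc e.dst) f hD φ, ← satZone_ivlDiff τ hD I hlo hhi]
  simp only [DiffStates.toSet, transSucc, List.mem_flatMap, Set.mem_ofPred_eq]
  constructor
  · rintro ⟨_, ⟨s, hs, h⟩, h1, h2⟩
    split_ifs at h with hse
    · obtain ⟨Z, hZ, rfl⟩ := List.mem_map.1 h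
      simp only [satZone_append] at h2
      refine ⟨h1, h2.2.1, ⟨Z, hZ, h2.2.2⟩, ?_⟩
      obtain ⟨w, ⟨⟨v, hv, d, rfl⟩, hg⟩, hw⟩ := (satZone_transDiff e hD _ _).1 h2.1
      exact ⟨_, ⟨⟨v, ⟨s, hs, hse, hv⟩, d, rfl⟩, hg⟩, hw⟩
    · simp at h
  · rintro ⟨h1, hI, ⟨Z, hZ, hφ⟩, w, ⟨⟨v, ⟨s, hs, hse, hv⟩, d, rfl⟩, hg⟩, hw⟩
    refine ⟨(e.dst, transDiff e D s.2 ++ (ivlDiff τ D I.code ++ Z)), ⟨s, hs, ?_⟩, h1, ?_⟩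
    · rw [if_pos hse]
      exact List.mem_map.2 ⟨Z, hZ, rfl⟩
    · rw [satZone_append, satZone_append]
      exact ⟨(satZone_transDiff e hD _ _).2 ⟨_, ⟨⟨v, hv, d, rfl⟩, hg⟩, hw⟩, hI, hφ⟩

theorem toSet_succDiff {C : Type*} [Fintype C] [DecidableEq C] (M : TBA Q S C) (loc : Q → Q')
    (clk : C' → C) {D : ℕ} (hD : 0 < D) (φ : PForm Q' S C') (I : RatInterval)
    (hlo : I.lo.2 + 1 ∣ D) (hhi : I.hi.2 + 1 ∣ D) (X : DiffStates Q (Option C)) :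
    DiffStates.toSet D (succDiff M.withTime.trans_finite.toFinset.toList loc
      (fun c => some (clk c)) none D φ.code I.code X) =
      obsSucc M loc clk φ I (DiffStates.toSet D X) := by
  ext y
  have : y ∈ DiffStates.toSet D (succDiff M.withTime.trans_finite.toFinset.toList loc
      (fun c => some (clk c)) none D φ.code I.code X) ↔
      ∃ e ∈ M.withTime.trans, y ∈ DiffStates.toSet D
        (transSucc loc (fun c => some (clk c)) none e D φ.code I.code X) := by
    simp only [DiffStates.toSet, succDiff, List.mem_flatMap, Finset.mem_toList,
      Set.Finite.mem_toFinset, Set.mem_ofPred_eq]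
    constructor
    · rintro ⟨s, ⟨e, he, hs⟩, h⟩
      exact ⟨e, he, s, hs, h⟩
    · rintro ⟨e, he, s, hs, h⟩
      exact ⟨s, ⟨e, he, hs⟩, h⟩
  rw [this]
  simp only [mem_toSet_transSucc _ _ _ _ hD φ I hlo hhi, obsSucc, succ, post, Set.mem_iUnion,
    Set.mem_inter_iff, Set.mem_ofPred_eq]
  constructor
  · rintro ⟨e, he, h1, hI, hφ, hr⟩
    exact ⟨e.letter, y.1, ⟨rfl, e.src, ⟨e, ⟨he, rfl, h1, rfl⟩, hr⟩, hI⟩, h1 ▸ hφ⟩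
  · rintro ⟨a, q', ⟨rfl, q, ⟨e, ⟨he, rfl, h1, rfl⟩, hr⟩, hI⟩, hφ⟩
    exact ⟨e, he, h1, hI, h1 ▸ hφ, hr⟩

end Successors

/-! ### Extension of timed words and runs by one event -/

namespace FinTimedWord

variable {S : Type*}

theorem time_le_duration (ρ : FinTimedWord S) (i : Fin ρ.len) : ρ.time i ≤ ρ.duration := by
  have h : ρ.len ≠ 0 := by have := i.2; omega
  rw [duration, dif_neg h]
  exact ρ.mono (Fin.le_def.2 (by have := i.2; simp; omega))

/-- The word with one more event. -/
def snoc (ρ : FinTimedWord S) (a : S) (t : ℝ≥0) (h : ρ.duration ≤ t) : FinTimedWord S where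
  len := ρ.len + 1
  letter := Fin.snoc (α := fun _ => S) ρ.letter a
  time := Fin.snoc (α := fun _ => ℝ≥0) ρ.time t
  mono := by
    intro i j hij
    induction j using Fin.lastCases with
    | last =>
      induction i using Fin.lastCases with
      | last => simp
      | cast i => simpa using (ρ.time_le_duration i).trans h
    | cast j =>
      induction i using Fin.lastCases with
      | last => exact absurd hij (by simp [Fin.le_def])
      | cast i => simpa using ρ.mono (by simpa using hij)

variable (ρ : FinTimedWord S) (a : S) (t : ℝ≥0) (h : ρ.duration ≤ t)

theorem letter_snoc_last : (ρ.snoc a t h).letter (Fin.last ρ.len) = a :=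
  Fin.snoc_last (α := fun _ => S) _ _

theorem letter_snoc_castSucc (i : Fin ρ.len) :
    (ρ.snoc a t h).letter i.castSucc = ρ.letter i := Fin.snoc_castSucc (α := fun _ => S) _ _ _

theorem time_snoc_last : (ρ.snoc a t h).time (Fin.last ρ.len) = t :=
  Fin.snoc_last (α := fun _ => ℝ≥0) _ _

theorem time_snoc_castSucc (i : Fin ρ.len) :
    (ρ.snoc a t h).time i.castSucc = ρ.time i := Fin.snoc_castSucc (α := fun _ => ℝ≥0) _ _ _

theorem duration_snoc : (ρ.snoc a t h).duration = t := by
  rw [duration, dif_neg (by simp [snoc])]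
  exact ρ.time_snoc_last a t h

theorem prevTime_snoc_last : (ρ.snoc a t h).prevTime (Fin.last ρ.len) = ρ.duration := by
  unfold prevTime duration
  by_cases h0 : ρ.len = 0
  · rw [if_pos (by simpa using h0), dif_pos h0]
  · rw [if_neg (by simpa using h0), dif_neg h0]
    exact ρ.time_snoc_castSucc a t h ⟨ρ.len - 1, by omega⟩

theorem prevTime_snoc_castSucc (i : Fin ρ.len) :
    (ρ.snoc a t h).prevTime i.castSucc = ρ.prevTime i := by
  unfold prevTime
  by_cases h0 : (i : ℕ) = 0
  · rw [if_pos (by simpa using h0), if_pos h0]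
  · rw [if_neg (by simpa using h0), if_neg h0]
    exact ρ.time_snoc_castSucc a t h ⟨i - 1, by omega⟩

theorem exists_eq_snoc {ρ : FinTimedWord S} (h0 : ρ.len ≠ 0) :
    ∃ (ρ' : FinTimedWord S) (a : S) (t : ℝ≥0) (h : ρ'.duration ≤ t), ρ = ρ'.snoc a t h := by
  obtain ⟨n, l, τ, hm⟩ := ρ
  obtain _ | n := n
  · exact absurd rfl h0
  have hmono : Monotone fun i : Fin n => τ i.castSucc := fun i j hij => hm (by simpa using hij)
  refine ⟨⟨n, fun i => l i.castSucc, fun i => τ i.castSucc, hmono⟩, l (Fin.last n),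
    τ (Fin.last n), ?_, ?_⟩
  · rw [duration]
    split_ifs
    · exact zero_le
    · exact hm (Fin.le_last _)
  · have hl := Fin.snoc_init_self (α := fun _ => S) l
    have hτ := Fin.snoc_init_self (α := fun _ => ℝ≥0) τ
    congr 1
    · exact hl.symm
    · exact hτ.symm

end FinTimedWord

namespace TBA

variable {Q S C : Type*} (M : TBA Q S C)

theorem isRun_snoc {ρ : FinTimedWord S} {a : S} {t : ℝ≥0} {h : ρ.duration ≤ t}
    {r : Fin (ρ.len + 1 + 1) → Q × Val C} :
    M.IsRun (ρ.snoc a t h) r ↔ M.IsRun ρ (fun i => r i.castSucc) ∧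
      M.Move (r (Fin.last ρ.len).castSucc) (t - ρ.duration) a (r (Fin.last _)) := by
  have : (∀ i : Fin (ρ.len + 1), M.Move (r i.castSucc)
      ((ρ.snoc a t h).time i - (ρ.snoc a t h).prevTime i) ((ρ.snoc a t h).letter i) (r i.succ)) ↔
      (∀ i : Fin ρ.len, M.Move (r i.castSucc.castSucc) (ρ.time i - ρ.prevTime i) (ρ.letter i)
        (r i.succ.castSucc)) ∧
      M.Move (r (Fin.last ρ.len).castSucc) (t - ρ.duration) a (r (Fin.last _)) := by
    rw [Fin.forall_fin_succ']
    simp only [ρ.letter_snoc_last, ρ.letter_snoc_castSucc, ρ.time_snoc_last, ρ.time_snoc_castSucc,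
      ρ.prevTime_snoc_last, ρ.prevTime_snoc_castSucc, Fin.succ_last, Fin.succ_castSucc]
  constructor
  · rintro ⟨h1, h2, h3⟩
    exact ⟨⟨h1, h2, (this.1 h3).1⟩, (this.1 h3).2⟩
  · rintro ⟨⟨h1, h2, h3⟩, h4⟩
    exact ⟨h1, h2, this.2 ⟨h3, h4⟩⟩

/-- An assignment of the events of a run to the elements of an observation, with element numbers
as natural numbers. -/
def Matches {ρ : FinTimedWord S} (r : Fin (ρ.len + 1) → Q × Val C) (o : Obs Q S C)
    (h : Fin ρ.len → ℕ) : Prop :=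
  Monotone h ∧
    (∀ j, ∃ e, o[h j]? = some e ∧ e.form.Sat (ρ.letter j) (r j.succ) ∧
      ρ.time j ∈ e.ivl.toSet) ∧
    ∀ (i : ℕ) (e : ObsElem Q S C), o[i]? = some e →
      e.mult.Holds (Finset.univ.filter (fun j => h j = i)).card

/-- Element numbers in `ℕ` let the same `h` serve for `o` and for its extension by one element,
without casts between `Fin` types. -/
theorem witnesses_iff_exists_matches {ρ : FinTimedWord S} {r : Fin (ρ.len + 1) → Q × Val C}
    {o : Obs Q S C} : M.Witnesses ρ r o ↔ M.IsRun ρ r ∧ ∃ h, Matches r o h := by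
  refine and_congr_right fun _ => ⟨?_, ?_⟩
  · rintro ⟨h, hm, hφ, hI, hc⟩
    refine ⟨fun j => h j, fun i j hij => hm hij, fun j => ⟨o.get (h j), by simp, hφ j, hI j⟩, ?_⟩
    intro i e he
    obtain ⟨hi, rfl⟩ := List.getElem?_eq_some_iff.1 he
    convert hc ⟨i, hi⟩ using 4
    · rfl
    · exact (Fin.ext_iff (a := h _) (b := ⟨i, hi⟩)).symm
  · rintro ⟨h, hm, hφ, hc⟩
    have hlt : ∀ j, h j < o.length := fun j => by
      obtain ⟨e, he, -⟩ := hφ j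
      exact (List.getElem?_eq_some_iff.1 he).1
    have hget : ∀ j e, o[h j]? = some e → o.get ⟨h j, hlt j⟩ = e := fun j e he =>
      (List.getElem?_eq_some_iff.1 he).2
    refine ⟨fun j => ⟨h j, hlt j⟩, fun i j hij => hm hij, fun j => ?_, fun j => ?_, fun i => ?_⟩
    · obtain ⟨e, he, h1, h2⟩ := hφ j
      rwa [hget j e he]
    · obtain ⟨e, he, h1, h2⟩ := hφ j
      rwa [hget j e he]
    · convert hc i _ (List.getElem?_eq_getElem i.2) using 4
      · rfl
      · exact Fin.ext_iff

end TBA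

theorem card_filter_castSucc {n : ℕ} (h : Fin (n + 1) → ℕ) (i : ℕ) :
    (Finset.univ.filter (fun j => h j = i)).card =
      (Finset.univ.filter (fun j : Fin n => h j.castSucc = i)).card +
        if h (Fin.last n) = i then 1 else 0 := by
  simp only [Finset.card_filter, Fin.sum_univ_castSucc]

/-! ### The tracked states under one more observation element -/

section Track

variable {Q S C Q' C' : Type*} {A : TBA Q' S C'} {M : TBA Q S C} {loc : Q → Q'} {clk : C' → C}

/-- The component of a state. -/
abbrev component (loc : Q → Q') (clk : C' → C) (x : Q × Val C) : Q' × Val C' :=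
  (loc x.1, fun c => x.2 (clk c))

/-- Runs of `M` project to runs of `A`. -/
structure Projects (A : TBA Q' S C') (M : TBA Q S C) (loc : Q → Q') (clk : C' → C) : Prop where
  init : ∀ q ∈ M.init, loc q ∈ A.init
  move : ∀ x d a y, M.Move x d a y → A.Move (component loc clk x) d a (component loc clk y)

theorem Projects.isRun (hP : Projects A M loc clk) {ρ : FinTimedWord S}
    {r : Fin (ρ.len + 1) → Q × Val C} (hr : M.IsRun ρ r) :
    A.IsRun ρ fun i => component loc clk (r i) := by
  refine ⟨hP.init _ hr.1, ?_, fun i => hP.move _ _ _ _ (hr.2.2 i)⟩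
  funext c
  change (r 0).2 (clk c) = 0
  rw [hr.2.1]; rfl

/-- The state at the end of a run, with the extra clock. -/
abbrev timedState (x : Q × Val C) (t : ℝ≥0) : Q × Val (Option C) := (x.1, fun c => c.elim t x.2)

/-- The component is a run of `A` automatically, so only the matching with `o` remains to be
required. -/
theorem mem_trackSet_iff (hP : Projects A M loc clk) {o : Obs Q' S C'} {x : Q × Val (Option C)} :
    x ∈ trackSet A M loc clk o ↔ ∃ (ρ : FinTimedWord S) (r : Fin (ρ.len + 1) → Q × Val C)
      (h : Fin ρ.len → ℕ), M.IsRun ρ r ∧ TBA.Matches (fun i => component loc clk (r i)) o h ∧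
      x = timedState (r (Fin.last _)) ρ.duration := by
  simp only [trackSet, TBA.witnesses_iff_exists_matches, Set.mem_ofPred_eq]
  constructor
  · rintro ⟨ρ, r, hr, ⟨-, h, hh⟩, hx⟩
    exact ⟨ρ, r, h, hr, hh, hx⟩
  · rintro ⟨ρ, r, h, hr, hh, hx⟩
    exact ⟨ρ, r, hr, ⟨hP.isRun hr, h, hh⟩, hx⟩

theorem trackSet_nil (hP : Projects A M loc clk) :
    trackSet A M loc clk [] = {x | x.1 ∈ M.init ∧ x.2 = 0} := by
  ext x
  rw [mem_trackSet_iff hP]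
  constructor
  · rintro ⟨ρ, r, h, hr, ⟨-, hh, -⟩, rfl⟩
    have h0 : ρ.len = 0 := by
      by_contra h0
      obtain ⟨e, he, -⟩ := hh ⟨0, Nat.pos_of_ne_zero h0⟩
      simp at he
    have hlast : Fin.last ρ.len = 0 := Fin.ext (by simpa using h0)
    refine ⟨hlast ▸ hr.1, funext fun c => ?_⟩
    cases c with
    | none => simp [FinTimedWord.duration, h0]
    | some c =>
      change (r (Fin.last _)).2 c = 0
      rw [hlast, hr.2.1]; rfl
  · rintro ⟨h1, h2⟩
    refine ⟨⟨0, Fin.elim0, Fin.elim0, fun i => i.elim0⟩, fun _ => (x.1, 0), Fin.elim0,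
      ⟨h1, rfl, fun i => i.elim0⟩, ⟨fun i => i.elim0, fun i => i.elim0, by simp⟩, ?_⟩
    refine Prod.ext rfl (funext fun c => ?_)
    rw [h2]
    cases c <;> simp [FinTimedWord.duration]

/-- This exhibits the successor operation as the image under a one-move relation; monotonicity and
compatibility with unions come from this form. The extra clock just adds up delays, as it is never
reset. -/
theorem mem_obsSucc_iff {φ : PForm Q' S C'} {I : RatInterval} {X : Set (Q × Val (Option C))}
    {y : Q × Val (Option C)} :
    y ∈ obsSucc M loc clk φ I X ↔ ∃ x ∈ X, ∃ d a,
      M.Move (x.1, fun c => x.2 (some c)) d a (y.1, fun c => y.2 (some c)) ∧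
      y.2 none = x.2 none + d ∧ y.2 none ∈ I.toSet ∧
      φ.Sat a (component loc clk (y.1, fun c => y.2 (some c))) := by
  have hmem : ∀ (R : Set C) (c : C), some c ∈ some '' R ↔ c ∈ R := fun R c =>
    (Option.some_injective C).mem_set_image
  have hres : ∀ (R : Set C) (v : Val (Option C)) (c : C),
      resetVal (some '' R) v (some c) = resetVal R (fun c => v (some c)) c := by
    intro R v c
    by_cases hc : c ∈ R
    · exact (if_pos ((hmem R c).2 hc)).trans (if_pos hc).symm
    · exact (if_neg (mt (hmem R c).1 hc)).trans (if_neg hc).symm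
  have hreset : ∀ (R : Set C) (v : Val (Option C)) (w : Val (Option C)),
      w = resetVal (some '' R) v ↔
        ((fun c => w (some c)) = resetVal R fun c => v (some c)) ∧ w none = v none := by
    intro R v w
    constructor
    · rintro rfl
      exact ⟨funext fun c => hres R v c, by simp [resetVal]⟩
    · rintro ⟨h1, h2⟩
      funext c
      cases c with
      | none => simp [resetVal, h2]
      | some c => exact (congrFun h1 c).trans (hres R v c).symm
  have hguard : ∀ (g : Guard C) (v : Val (Option C)),
      (Guard.map some g).Sat v ↔ g.Sat fun c => v (some c) := by
    intro g v
    simp only [Guard.Sat, Guard.map, List.mem_map, forall_exists_index, and_imp,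
      forall_apply_eq_imp_iff₂]
  simp only [obsSucc, succ, post, TBA.withTime, resetZone, elapse, Set.mem_iUnion,
    Set.mem_inter_iff, Set.mem_ofPred_eq, Set.mem_image, TBA.Move, component]
  constructor
  · rintro ⟨a, q', ⟨rfl, q, ⟨_, ⟨⟨e, he, rfl⟩, h1, h2, h3⟩, w, ⟨⟨v, hv, d, rfl⟩, hg⟩, hw⟩, hI⟩, hφ⟩
    obtain ⟨hw1, hw2⟩ := (hreset _ _ _).1 hw.symm
    exact ⟨(q, v), hv, d, a, ⟨e, he, h1, h2, h3, (hguard _ _).1 hg, hw1⟩, hw2, hI, hφ⟩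
  · rintro ⟨x, hx, d, a, ⟨e, he, h1, h2, h3, hg, hw⟩, ht, hI, hφ⟩
    exact ⟨a, y.1, ⟨rfl, x.1, ⟨_, ⟨⟨e, he, rfl⟩, h1, h2, h3⟩, _,
      ⟨⟨x.2, hx, d, rfl⟩, (hguard _ _).2 hg⟩, ((hreset _ _ _).2 ⟨hw, ht⟩).symm⟩, hI⟩, hφ⟩

/-- The number `o.length` stands for the new element. The multiplicity `m` is isolated in the last
clause, so that it can be exchanged. -/
theorem matches_concat_iff {ρ : FinTimedWord S} {r : Fin (ρ.len + 1) → Q' × Val C'}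
    {o : Obs Q' S C'} {φ : PForm Q' S C'} {I : RatInterval} {m : Mult} {h : Fin ρ.len → ℕ} :
    TBA.Matches r (o ++ [⟨φ, I, m⟩]) h ↔ Monotone h ∧
      (∀ j, h j ≤ o.length) ∧
      (∀ j e, o[h j]? = some e → e.form.Sat (ρ.letter j) (r j.succ) ∧ ρ.time j ∈ e.ivl.toSet) ∧
      (∀ j, h j = o.length → φ.Sat (ρ.letter j) (r j.succ) ∧ ρ.time j ∈ I.toSet) ∧
      (∀ (i : ℕ) (e : ObsElem Q' S C'), o[i]? = some e → e.mult.Holds (Finset.univ.filter (fun j => h j = i)).card) ∧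
      m.Holds (Finset.univ.filter (fun j => h j = o.length)).card := by
  have hlt : ∀ i e, o[i]? = some e → i < o.length := fun i e he =>
    (List.getElem?_eq_some_iff.1 he).1
  have hleft : ∀ i, i < o.length → (o ++ [⟨φ, I, m⟩])[i]? = o[i]? := fun i hi =>
    List.getElem?_append_left hi
  have hlast : (o ++ [⟨φ, I, m⟩])[o.length]? = some ⟨φ, I, m⟩ := by simp
  have hcases : ∀ i e, (o ++ [⟨φ, I, m⟩])[i]? = some e →
      i < o.length ∨ i = o.length ∧ e = ⟨φ, I, m⟩ := by
    intro i e he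
    have hi := (List.getElem?_eq_some_iff.1 he).1
    simp only [List.length_append, List.length_singleton] at hi
    rcases Nat.lt_succ_iff_lt_or_eq.1 hi with hi | rfl
    · exact Or.inl hi
    · exact Or.inr ⟨rfl, by rw [hlast] at he; simpa using he.symm⟩
  constructor
  · rintro ⟨hm, hj, hc⟩
    refine ⟨hm, fun j => ?_, fun j e he => ?_, fun j h' => ?_, fun i e he => ?_, hc _ _ hlast⟩
    · obtain ⟨e, he, -⟩ := hj j
      rcases hcases _ _ he with h' | h'
      · exact h'.le
      · exact h'.1.le
    · obtain ⟨e', he', hs⟩ := hj j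
      rw [hleft _ (hlt _ _ he), he] at he'
      cases he'
      exact hs
    · obtain ⟨e', he', hs⟩ := hj j
      rw [h', hlast] at he'
      cases he'
      exact hs
    · exact hc i e (by rwa [hleft _ (hlt _ _ he)])
  · rintro ⟨hm, hle, h1, h2, h3, h4⟩
    refine ⟨hm, fun j => ?_, fun i e he => ?_⟩
    · rcases (hle j).lt_or_eq with h' | h'
      · exact ⟨o[h j], by rw [hleft _ h', List.getElem?_eq_getElem h'],
          h1 j _ (List.getElem?_eq_getElem h')⟩
      · exact ⟨_, by rw [h', hlast], h2 j h'⟩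
    · rcases hcases _ _ he with h' | ⟨rfl, rfl⟩
      · exact h3 i e (by rwa [hleft _ h'] at he)
      · exact h4

variable (o : Obs Q' S C') (φ : PForm Q' S C') (I : RatInterval)

/-- Removing a last event that belongs to the new element lowers the count of that element by one
and affects no other count. -/
theorem matches_snoc_concat_iff {ρ : FinTimedWord S} {a : S} {t : ℝ≥0} {ht : ρ.duration ≤ t}
    {r : Fin (ρ.len + 1 + 1) → Q' × Val C'} {n : ℕ} {h : Fin (ρ.len + 1) → ℕ}
    (hl : h (Fin.last ρ.len) = o.length) :
    TBA.Matches (ρ := ρ.snoc a t ht) r (o ++ [⟨φ, I, .eq (n + 1)⟩]) h ↔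
      TBA.Matches (ρ := ρ) (fun i => r i.castSucc) (o ++ [⟨φ, I, .eq n⟩]) (fun j => h j.castSucc) ∧
        φ.Sat a (r (Fin.last _)) ∧ t ∈ I.toSet := by
  refine (matches_concat_iff (ρ := ρ.snoc a t ht) (r := r)).trans
    (Iff.trans ?_ (and_congr_left' matches_concat_iff).symm)
  have h2 : (∀ j : Fin (ρ.len + 1), h j ≤ o.length) ↔ ∀ j : Fin ρ.len, h j.castSucc ≤ o.length := by
    rw [Fin.forall_fin_succ']
    simp [hl]
  -- The last event carries the greatest possible element number, so adding it preserves
  -- monotonicity.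
  have h1 (h' : ∀ j : Fin ρ.len, h j.castSucc ≤ o.length) :
      Monotone h ↔ Monotone fun j : Fin ρ.len => h j.castSucc := by
    refine ⟨fun hm i j hij => hm (Fin.castSucc_le_castSucc_iff.2 hij), fun hm i j hij => ?_⟩
    induction j using Fin.lastCases with
    | last => exact hl ▸ (h2.2 h') i
    | cast j =>
      induction i using Fin.lastCases with
      | last => exact absurd (Fin.castSucc_lt_last j) (not_lt_of_ge hij)
      | cast i => exact hm (Fin.castSucc_le_castSucc_iff.1 hij)
  have h3 : (∀ (j : Fin (ρ.len + 1)) (e : ObsElem Q' S C'), o[h j]? = some e →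
      e.form.Sat ((ρ.snoc a t ht).letter j) (r j.succ) ∧ (ρ.snoc a t ht).time j ∈ e.ivl.toSet) ↔
      ∀ (j : Fin ρ.len) (e : ObsElem Q' S C'), o[h j.castSucc]? = some e →
        e.form.Sat (ρ.letter j) (r j.succ.castSucc) ∧ ρ.time j ∈ e.ivl.toSet := by
    rw [Fin.forall_fin_succ']
    simp only [ρ.letter_snoc_castSucc, ρ.time_snoc_castSucc, Fin.succ_castSucc, hl]
    simp
  have h4 : (∀ j : Fin (ρ.len + 1), h j = o.length →
      φ.Sat ((ρ.snoc a t ht).letter j) (r j.succ) ∧ (ρ.snoc a t ht).time j ∈ I.toSet) ↔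
      (∀ j : Fin ρ.len, h j.castSucc = o.length →
        φ.Sat (ρ.letter j) (r j.succ.castSucc) ∧ ρ.time j ∈ I.toSet) ∧
      φ.Sat a (r (Fin.last _)) ∧ t ∈ I.toSet := by
    rw [Fin.forall_fin_succ']
    simp only [ρ.letter_snoc_castSucc, ρ.time_snoc_castSucc, Fin.succ_castSucc, hl,
      ρ.letter_snoc_last, ρ.time_snoc_last, Fin.succ_last, true_imp_iff]
  have h5 : (∀ (i : ℕ) (e : ObsElem Q' S C'), o[i]? = some e →
      e.mult.Holds (Finset.univ.filter fun j : Fin (ρ.len + 1) => h j = i).card) ↔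
      ∀ (i : ℕ) (e : ObsElem Q' S C'), o[i]? = some e →
        e.mult.Holds (Finset.univ.filter fun j : Fin ρ.len => h j.castSucc = i).card := by
    refine forall₃_congr fun i e he => ?_
    have hi : h (Fin.last ρ.len) ≠ i := by
      rw [hl]; exact (List.getElem?_eq_some_iff.1 he).1.ne'
    rw [card_filter_castSucc, if_neg hi, add_zero]
  have h6 : (Mult.eq (n + 1)).Holds
      (Finset.univ.filter fun j : Fin (ρ.len + 1) => h j = o.length).card ↔
      (Mult.eq n).Holds
        (Finset.univ.filter fun j : Fin ρ.len => h j.castSucc = o.length).card := by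
    rw [card_filter_castSucc, if_pos hl]
    simp [Mult.Holds]
  constructor
  · rintro ⟨g1, g2, g3, g4, g5, g6⟩
    have g2 := h2.1 g2
    exact ⟨⟨(h1 g2).1 g1, g2, h3.1 g3, (h4.1 g4).1, h5.1 g5, h6.1 g6⟩, (h4.1 g4).2⟩
  · rintro ⟨⟨g1, g2, g3, g4, g5, g6⟩, g7⟩
    exact ⟨(h1 g2).2 g1, h2.2 g2, h3.2 g3, h4.2 ⟨g4, g7⟩, h5.2 g5, h6.2 g6⟩

theorem trackSet_concat (hP : Projects A M loc clk) (m : Mult) :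
    trackSet A M loc clk (o ++ [⟨φ, I, m⟩]) =
      {x | ∃ j, m.Holds j ∧ x ∈ trackSet A M loc clk (o ++ [⟨φ, I, .eq j⟩])} := by
  ext x
  simp only [mem_trackSet_iff hP, matches_concat_iff, Set.mem_ofPred_eq]
  constructor
  · rintro ⟨ρ, r, h, hr, ⟨h1, h2, h3, h4, h5, h6⟩, hx⟩
    exact ⟨_, h6, ρ, r, h, hr, ⟨h1, h2, h3, h4, h5, rfl⟩, hx⟩
  · rintro ⟨j, hj, ρ, r, h, hr, ⟨h1, h2, h3, h4, h5, h6⟩, hx⟩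
    exact ⟨ρ, r, h, hr, ⟨h1, h2, h3, h4, h5, by cases h6; exact hj⟩, hx⟩

theorem trackSet_concat_eq_zero (hP : Projects A M loc clk) :
    trackSet A M loc clk (o ++ [⟨φ, I, .eq 0⟩]) = trackSet A M loc clk o := by
  ext x
  simp only [mem_trackSet_iff hP, matches_concat_iff]
  constructor
  · rintro ⟨ρ, r, h, hr, ⟨h1, h2, h3, h4, h5, h6⟩, hx⟩
    refine ⟨ρ, r, h, hr, ⟨h1, fun j => ?_, h5⟩, hx⟩
    have hne : h j ≠ o.length := fun hj => by
      have := Finset.card_eq_zero.1 h6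
      exact absurd (Finset.mem_filter.2 ⟨Finset.mem_univ j, hj⟩) (by rw [this]; simp)
    have hlt := lt_of_le_of_ne (h2 j) hne
    exact ⟨o[h j], List.getElem?_eq_getElem hlt, h3 j _ (List.getElem?_eq_getElem hlt)⟩
  · rintro ⟨ρ, r, h, hr, ⟨h1, h2, h3⟩, hx⟩
    have hlt : ∀ j, h j < o.length := fun j => by
      obtain ⟨e, he, -⟩ := h2 j
      exact (List.getElem?_eq_some_iff.1 he).1
    refine ⟨ρ, r, h, hr, ⟨h1, fun j => (hlt j).le, fun j e he => ?_,
      fun j hj => absurd hj (hlt j).ne, h3, ?_⟩, hx⟩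
    · obtain ⟨e', he', hs⟩ := h2 j
      rw [he] at he'
      cases he'
      exact hs
    · simp only [Mult.Holds, Finset.card_eq_zero, Finset.filter_eq_empty_iff]
      exact fun j _ => (hlt j).ne

theorem trackSet_concat_eq_succ (hP : Projects A M loc clk) (n : ℕ) :
    trackSet A M loc clk (o ++ [⟨φ, I, .eq (n + 1)⟩]) =
      obsSucc M loc clk φ I (trackSet A M loc clk (o ++ [⟨φ, I, .eq n⟩])) := by
  ext x
  simp only [mem_obsSucc_iff, mem_trackSet_iff hP]
  constructor
  · rintro ⟨ρ, r, h, hr, hh, rfl⟩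
    obtain ⟨h1, h2, -, -, -, h6⟩ := matches_concat_iff.1 hh
    -- Some event `j` belongs to the new element. By monotonicity and maximality of `o.length` so
    -- does the last event, which can therefore be split off.
    have hpos : 0 < (Finset.univ.filter (fun j => h j = o.length)).card := by
      rw [show (Finset.univ.filter (fun j => h j = o.length)).card = n + 1 from h6]; omega
    obtain ⟨j, hj⟩ := Finset.card_pos.1 hpos
    have hlen : ρ.len ≠ 0 := by have := j.2; omega
    obtain ⟨ρ, a, t, ht, rfl⟩ := FinTimedWord.exists_eq_snoc hlen
    have hl : h (Fin.last ρ.len) = o.length :=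
      le_antisymm (h2 _) ((Finset.mem_filter.1 hj).2 ▸ h1 (Fin.le_last (n := ρ.len) j))
    obtain ⟨hr', hmove⟩ := (TBA.isRun_snoc M).1 hr
    obtain ⟨hh', hφ, hI⟩ := (matches_snoc_concat_iff o φ I hl).1 hh
    refine ⟨_, ⟨ρ, _, _, hr', hh', rfl⟩, t - ρ.duration, a, hmove, ?_, ?_, hφ⟩
    · change (ρ.snoc a t ht).duration = ρ.duration + (t - ρ.duration)
      rw [FinTimedWord.duration_snoc, add_tsub_cancel_of_le ht]
    · change (ρ.snoc a t ht).duration ∈ _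
      rw [FinTimedWord.duration_snoc]
      exact hI
  · rintro ⟨_, ⟨ρ, r, h, hr, hh, rfl⟩, d, a, hmove, ht, hI, hφ⟩
    change x.2 none = ρ.duration + d at ht
    rw [ht] at hI
    have hd : ρ.duration ≤ ρ.duration + d := le_self_add
    -- Conversely, the move is appended to the run as an event at time `ρ.duration + d`, assigned to
    -- the new element.
    let h' : Fin (ρ.len + 1) → ℕ := Fin.snoc (α := fun _ => ℕ) h o.length
    let r' : Fin (ρ.len + 1 + 1) → Q × Val C :=
      Fin.snoc (α := fun _ => Q × Val C) r (x.1, fun c => x.2 (some c))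
    have hh' : ∀ j : Fin ρ.len, h' j.castSucc = h j := fun j =>
      Fin.snoc_castSucc (α := fun _ => ℕ) _ _ _
    have hhl : h' (Fin.last _) = o.length := Fin.snoc_last (α := fun _ => ℕ) _ _
    have hr' : ∀ j : Fin (ρ.len + 1), r' j.castSucc = r j := fun j =>
      Fin.snoc_castSucc (α := fun _ => Q × Val C) _ _ _
    have hrl : r' (Fin.last _) = (x.1, fun c => x.2 (some c)) :=
      Fin.snoc_last (α := fun _ => Q × Val C) _ _
    refine ⟨ρ.snoc a _ hd, r', h', (TBA.isRun_snoc M).2 ⟨?_, ?_⟩,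
      (matches_snoc_concat_iff o φ I (r := fun i => component loc clk (r' i)) hhl).2
        ⟨?_, ?_, hI⟩, ?_⟩
    · simpa only [hr'] using hr
    · rw [hr', hrl, add_tsub_cancel_left]
      exact hmove
    · simpa only [hr', hh'] using hh
    · rw [hrl]
      exact hφ
    · refine Prod.ext ?_ (funext fun c => ?_)
      · exact (congrArg Prod.fst hrl).symm
      · cases c with
        | none =>
          change x.2 none = (ρ.snoc a _ hd).duration
          rw [ht, FinTimedWord.duration_snoc]
        | some c => exact (congrFun (congrArg Prod.snd hrl) c).symm

end Track

/-! ### Iteration of relational images -/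

section Iteration

variable {X : Type*}

/-- The operation maps a set to its image under a relation. -/
def IsRelImage (F : Set X → Set X) : Prop :=
  ∃ R : X → X → Prop, ∀ Y y, y ∈ F Y ↔ ∃ x ∈ Y, R x y

theorem IsRelImage.mono {F : Set X → Set X} (hF : IsRelImage F) : Monotone F := by
  obtain ⟨R, hR⟩ := hF
  intro Y Z hYZ y hy
  obtain ⟨x, hx, hxy⟩ := (hR _ _).1 hy
  exact (hR _ _).2 ⟨x, hYZ hx, hxy⟩

theorem IsRelImage.mem_of_exists {F : Set X → Set X} (hF : IsRelImage F) {p : ℕ → Prop}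
    {Y : ℕ → Set X} {y : X} : y ∈ F {x | ∃ j, p j ∧ x ∈ Y j} ↔ ∃ j, p j ∧ y ∈ F (Y j) := by
  obtain ⟨R, hR⟩ := hF
  simp only [hR, Set.mem_ofPred_eq]
  constructor
  · rintro ⟨x, ⟨j, hj, hx⟩, hxy⟩
    exact ⟨j, hj, x, hx, hxy⟩
  · rintro ⟨j, hj, x, hx, hxy⟩
    exact ⟨x, ⟨j, hj, hx⟩, hxy⟩

/-- As `F` commutes with unions, each iteration shifts the collected counts by one and puts the
count `0` back. -/
theorem iterate_union_eq {F : Set X → Set X} (hF : IsRelImage F) (T : Set X) (e : ℕ) :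
    (fun Y => T ∪ F Y)^[e] T = {x | ∃ j, j ≤ e ∧ x ∈ F^[j] T} := by
  induction e with
  | zero => ext x; simp
  | succ e ih =>
    rw [Function.iterate_succ_apply', ih]
    ext x
    rw [Set.mem_union, hF.mem_of_exists]
    simp only [← Function.iterate_succ_apply' F, Set.mem_ofPred_eq]
    constructor
    · rintro (h | ⟨j, hj, h⟩)
      · exact ⟨0, Nat.zero_le _, h⟩
      · exact ⟨j + 1, by omega, h⟩
    · rintro ⟨_ | j, hj, h⟩
      · exact Or.inl h
      · exact Or.inr ⟨j, by omega, h⟩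

/-- Applying `F` shifts the counts `≥ e` to the counts `≥ e + 1`, and the missing count `e` is the
constant term. Any other fixed point contains each `F^[j] T` by induction from `j = e`. -/
theorem isLeast_fixedPoint {F : Set X → Set X} (hF : IsRelImage F) (T : Set X) (e : ℕ) :
    IsLeast {Y | Y = F^[e] T ∪ F Y} {x | ∃ j, j ≥ e ∧ x ∈ F^[j] T} := by
  constructor
  · change _ = _
    ext x
    rw [Set.mem_union, hF.mem_of_exists]
    simp only [← Function.iterate_succ_apply' F, Set.mem_ofPred_eq]
    constructor
    · rintro ⟨j, hj, h⟩
      rcases hj.eq_or_lt with rfl | hj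
      · exact Or.inl h
      · obtain ⟨j, rfl⟩ : ∃ i, j = i + 1 := ⟨j - 1, by omega⟩
        exact Or.inr ⟨j, by omega, h⟩
    · rintro (h | ⟨j, hj, h⟩)
      · exact ⟨e, le_rfl, h⟩
      · exact ⟨j + 1, by omega, h⟩
  · intro Y hY x hx
    obtain ⟨j, hj, hx⟩ := hx
    have : F^[j] T ⊆ Y := by
      clear hx
      induction j, hj using Nat.le_induction with
      | base => rw [show Y = _ from hY]; exact Set.subset_union_left
      | succ j _ ih =>
        rw [Function.iterate_succ_apply', show Y = _ from hY]
        exact (hF.mono ih).trans Set.subset_union_right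
    exact this hx

theorem iterate_subset_lfp {G : Set X → Set X} (hG : Monotone G) {U : Set X} (hU : G U = U)
    (k : ℕ) : G^[k] ∅ ⊆ U := by
  induction k with
  | zero => exact Set.empty_subset _
  | succ k ih =>
    rw [Function.iterate_succ_apply', ← hU]
    exact hG ih

theorem monotone_iterate_empty {G : Set X → Set X} (hG : Monotone G) :
    Monotone fun k => G^[k] ∅ := by
  refine monotone_nat_of_le_succ fun k => ?_
  rw [Function.iterate_succ_apply]
  exact hG.iterate k (Set.empty_subset _)

/-- An increasing sequence of sets that are determined by a map into a finite type becomes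
stationary. -/
theorem exists_stationary {τ : Type*} [Finite τ] (sig : X → τ) (W : ℕ → Set X) (hW : Monotone W)
    (hdet : ∀ k x x', sig x = sig x' → x ∈ W k → (∃ k', x' ∈ W k') → x' ∈ W k) :
    ∃ k ≤ Nat.card τ, W (k + 1) = W k := by
  by_contra! hne
  -- Each strict growth of `W` must add a new signature, because a new point with an old signature
  -- would already belong to `W k`. There are only `Nat.card τ` signatures.
  have hlt : ∀ k ≤ Nat.card τ, (sig '' W k).ncard < (sig '' W (k + 1)).ncard := by
    intro k hk
    refine Set.ncard_lt_ncard ((Set.image_mono (hW k.le_succ)).ssubset_of_ne fun heq => ?_)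
      (Set.toFinite _)
    refine hne k hk (Set.Subset.antisymm (fun x hx => ?_) (hW k.le_succ))
    obtain ⟨x', hx', hs⟩ : sig x ∈ sig '' W k := heq ▸ Set.mem_image_of_mem sig hx
    exact hdet k x' x hs hx' ⟨_, hx⟩
  have hge : ∀ k ≤ Nat.card τ + 1, k ≤ (sig '' W k).ncard := by
    intro k hk
    induction k with
    | zero => exact Nat.zero_le _
    | succ k ih => exact (ih (by omega)).trans_lt (hlt k (by omega))
  have h1 := hge _ le_rfl
  have h2 : (sig '' W (Nat.card τ + 1)).ncard ≤ Nat.card τ := by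
    rw [← Set.ncard_univ]
    exact Set.ncard_le_ncard (Set.subset_univ _) (Set.toFinite _)
  omega

/-- Iteration from the empty set reaches the least fixed point, with a bound on the number of
iterations. -/
theorem iterate_eq_fixedPoint {F : Set X → Set X} (hF : IsRelImage F) (T : Set X)
    {τ : Type*} [Finite τ] (sig : X → τ) (e N : ℕ)
    (hN : Nat.card τ + 1 ≤ N)
    (hdet : ∀ k x x', sig x = sig x' → x ∈ F ((fun Y => F^[e] T ∪ F Y)^[k] ∅) →
      (∃ k', x' ∈ F ((fun Y => F^[e] T ∪ F Y)^[k'] ∅)) →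
      x' ∈ F ((fun Y => F^[e] T ∪ F Y)^[k] ∅)) :
    (fun Y => F^[e] T ∪ F Y)^[N] ∅ = {x | ∃ j, j ≥ e ∧ x ∈ F^[j] T} := by
  have hl := isLeast_fixedPoint hF T e
  set U := {x | ∃ j, j ≥ e ∧ x ∈ F^[j] T}
  set G := fun Y => F^[e] T ∪ F Y with hGdef
  have hG : Monotone G := fun Y Z h => Set.union_subset_union_right _ (hF.mono h)
  -- The chain consists of the sets `F (G^[k] ∅)` instead of `G^[k] ∅`: for `e = 0` the constant
  -- part is the old tracked set, whose times need not lie in the current interval. Stationarity at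
  -- `k` makes `G^[k + 1] ∅` a fixed point, hence the extra iteration in `hN`.
  obtain ⟨k, hk, hst⟩ := exists_stationary sig (fun k => F (G^[k] ∅))
    (fun a b h => hF.mono (monotone_iterate_empty hG h)) hdet
  have hfix : G^[k + 1] ∅ = F^[e] T ∪ F (G^[k + 1] ∅) := by
    conv_lhs => rw [Function.iterate_succ_apply']
    rw [hst]
  refine Set.Subset.antisymm (iterate_subset_lfp hG (show U = _ from hl.1).symm N) ?_
  exact (hl.2 hfix).trans (monotone_iterate_empty hG (by omega))

end Iteration

/-! ### Zones in bounded sets -/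

section Signature

variable {Q K : Type*}

/-- The satisfied constraints with small constants. -/
noncomputable def zoneSignature (D B : ℕ) (x : Q × Val K) :
    Q × ((ZVar K × ZVar K) × Bool × Fin (B + 1) → Bool) := by
  classical
  exact (x.1, fun a =>
    decide (DiffAtom.Sat (scaledVal Option.join D x.2) ((a.1.1, (a.2.2 : ℕ)), (a.1.2, 0), a.2.1)))

theorem DiffAtom.sat_iff_of_le {V : Type*} {u : V → ℝ} {x y : V} {p q : ℕ} {s : Bool}
    (h : q ≤ p) : DiffAtom.Sat u ((x, p), (y, q), s) ↔ DiffAtom.Sat u ((x, p - q), (y, 0), s) := by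
  cases s <;> simp only [Sat, Nat.cast_sub h] <;> constructor <;> intro h <;> simp at h ⊢ <;>
    linarith

/-- For scaled values between `0` and `B`, a constraint with net constant `k > B` on the left is
false. The smaller constants on the left are recorded in the signature, and a net constant on the
right is handled by passing to the complement. -/
theorem sat_iff_of_zoneSignature_eq {D B : ℕ} {x x' : Q × Val K}
    (h : zoneSignature D B x = zoneSignature D B x') (hx : ∀ c, D * (x.2 c : ℝ) ≤ B)
    (hx' : ∀ c, D * (x'.2 c : ℝ) ≤ B) (a : DiffAtom (ZVar K)) :
    a.Sat (scaledVal Option.join D x.2) ↔ a.Sat (scaledVal Option.join D x'.2) := by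
  have hsmall : ∀ (y : Q × Val K) (_ : ∀ c, D * (y.2 c : ℝ) ≤ B) (z w : ZVar K) (k : ℕ) (s : Bool),
      B < k → ¬ DiffAtom.Sat (scaledVal Option.join D y.2) ((z, k), (w, 0), s) := by
    intro y hy z w k s hk
    have h0 : ∀ z : ZVar K, 0 ≤ scaledVal Option.join D y.2 z ∧
        scaledVal Option.join D y.2 z ≤ B := by
      intro z
      rcases z with _ | _ | c
      · simp
      · simp
      · exact ⟨by rw [scaledVal_cvar]; positivity, hy c⟩
    have hk' : (B : ℝ) < k := by exact_mod_cast hk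
    have := (h0 z).1
    have := (h0 w).2
    cases s <;> simp only [DiffAtom.Sat] <;> simp <;> linarith
  have key : ∀ (z w : ZVar K) (k : ℕ) (s : Bool),
      DiffAtom.Sat (scaledVal Option.join D x.2) ((z, k), (w, 0), s) ↔
        DiffAtom.Sat (scaledVal Option.join D x'.2) ((z, k), (w, 0), s) := by
    intro z w k s
    rcases lt_or_ge B k with hk | hk
    · exact iff_of_false (hsmall x hx z w k s hk) (hsmall x' hx' z w k s hk)
    · have := congrFun (congrArg Prod.snd h) ((z, w), s, ⟨k, Nat.lt_succ_of_le hk⟩)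
      simpa only [zoneSignature, decide_eq_decide] using this
  obtain ⟨⟨z, p⟩, ⟨w, q⟩, s⟩ := a
  rcases le_total q p with hqp | hqp
  · rw [DiffAtom.sat_iff_of_le hqp, DiffAtom.sat_iff_of_le hqp, key]
  · rw [← not_iff_not, ← DiffAtom.sat_compl, ← DiffAtom.sat_compl]
    simp only [DiffAtom.compl]
    rw [DiffAtom.sat_iff_of_le hqp, DiffAtom.sat_iff_of_le hqp, key]

theorem mem_toSet_of_zoneSignature_eq {D B : ℕ} {x x' : Q × Val K}
    (h : zoneSignature D B x = zoneSignature D B x') (hx : ∀ c, D * (x.2 c : ℝ) ≤ B)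
    (hx' : ∀ c, D * (x'.2 c : ℝ) ≤ B) (X : DiffStates Q K)
    (hX : x ∈ DiffStates.toSet D X) : x' ∈ DiffStates.toSet D X := by
  obtain ⟨s, hs, h1, h2⟩ := hX
  have hfst : (zoneSignature D B x).1 = (zoneSignature D B x').1 := by rw [h]
  exact ⟨s, hs, h1.trans hfst,
    fun a ha => (sat_iff_of_zoneSignature_eq h hx hx' a).1 (h2 a ha)⟩

/-- A number of iterations that suffices. -/
noncomputable def iterBound (Q K : Type*) (B : ℕ) : ℕ :=
  Nat.card Q * 2 ^ (Nat.card (ZVar K × ZVar K) * (2 * (B + 1))) + 1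

/-- The bound counts the maps from bounded constraints to truth values, for each location. Only `B`
varies with the input, so `iterBound` is primitive recursive in it. -/
theorem card_signature_le [Finite Q] [Finite K] (B : ℕ) :
    Nat.card (Q × ((ZVar K × ZVar K) × Bool × Fin (B + 1) → Bool)) + 1 ≤ iterBound Q K B := by
  rw [iterBound, Nat.card_prod, Nat.card_fun, Nat.card_prod, Nat.card_prod]
  simp

end Signature

/-! ### Tracked states evolve by successor operations -/

section Evolution

variable {Q S C Q' C' : Type*} {A : TBA Q' S C'} {M : TBA Q S C} {loc : Q → Q'} {clk : C' → C}

theorem isRelImage_obsSucc (φ : PForm Q' S C') (I : RatInterval) :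
    IsRelImage (obsSucc M loc clk φ I) := ⟨_, fun _ _ => mem_obsSucc_iff⟩

theorem trackSet_concat_eq (hP : Projects A M loc clk) (o : Obs Q' S C') (φ : PForm Q' S C')
    (I : RatInterval) (e : ℕ) :
    trackSet A M loc clk (o ++ [⟨φ, I, .eq e⟩]) =
      (obsSucc M loc clk φ I)^[e] (trackSet A M loc clk o) := by
  induction e with
  | zero => exact trackSet_concat_eq_zero o φ I hP
  | succ e ih => rw [trackSet_concat_eq_succ o φ I hP, ih, Function.iterate_succ_apply']

theorem trackSet_concat_le (hP : Projects A M loc clk) (o : Obs Q' S C') (φ : PForm Q' S C')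
    (I : RatInterval) (e : ℕ) :
    trackSet A M loc clk (o ++ [⟨φ, I, .le e⟩]) =
      (fun Y => trackSet A M loc clk o ∪ obsSucc M loc clk φ I Y)^[e] (trackSet A M loc clk o) := by
  rw [trackSet_concat o φ I hP, iterate_union_eq (isRelImage_obsSucc φ I)]
  simp only [trackSet_concat_eq hP]
  rfl

theorem trackSet_concat_ge (hP : Projects A M loc clk) (o : Obs Q' S C') (φ : PForm Q' S C')
    (I : RatInterval) (e : ℕ) :
    trackSet A M loc clk (o ++ [⟨φ, I, .ge e⟩]) =
      {x | ∃ j, j ≥ e ∧ x ∈ (obsSucc M loc clk φ I)^[j] (trackSet A M loc clk o)} := by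
  rw [trackSet_concat o φ I hP]
  simp only [trackSet_concat_eq hP]
  rfl

/-- The states in which no clock exceeds the time since system start. -/
def clocksLeTime (Q C : Type*) : Set (Q × Val (Option C)) := {x | ∀ c, x.2 c ≤ x.2 none}

theorem obsSucc_subset_clocksLeTime {φ : PForm Q' S C'} {I : RatInterval}
    {X : Set (Q × Val (Option C))} (hX : X ⊆ clocksLeTime Q C) :
    obsSucc M loc clk φ I X ⊆ clocksLeTime Q C := by
  intro y hy
  obtain ⟨x, hx, d, a, ⟨e, he, h1, h2, h3, hg, hw⟩, ht, -⟩ := mem_obsSucc_iff.1 hy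
  intro c
  cases c with
  | none => exact le_rfl
  | some c =>
    rw [ht, show y.2 (some c) = _ from congrFun hw c]
    unfold resetVal
    split_ifs
    · exact zero_le
    · exact add_le_add_left (hX hx (some c)) d

/-- All clocks start together with the extra clock, and a reset only lowers them. A bound on the
time thus bounds every clock. -/
theorem trackSet_subset_clocksLeTime (hP : Projects A M loc clk) (o : Obs Q' S C') :
    trackSet A M loc clk o ⊆ clocksLeTime Q C := by
  induction o using List.reverseRecOn with
  | nil =>
    rw [trackSet_nil hP]
    rintro x ⟨-, hx⟩ c
    rw [hx]
    rfl
  | append_singleton o e ih =>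
    obtain ⟨φ, I, m⟩ := e
    rw [trackSet_concat o φ I hP]
    rintro x ⟨j, -, hx⟩
    rw [trackSet_concat_eq hP] at hx
    revert x
    change (obsSucc M loc clk φ I)^[j] (trackSet A M loc clk o) ⊆ clocksLeTime Q C
    induction j with
    | zero => exact ih
    | succ j ihj =>
      rw [Function.iterate_succ_apply']
      exact obsSucc_subset_clocksLeTime ihj

/-- A bound of the scaled values of all clocks when the time is in the interval. -/
theorem mul_le_of_mem_clocksLeTime {x : Q × Val (Option C)} (hx : x ∈ clocksLeTime Q C)
    {I : RatInterval} (hI : x.2 none ∈ I.toSet) (D : ℕ) (c : Option C) :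
    D * (x.2 c : ℝ) ≤ (D * I.hi.1 : ℕ) := by
  have h1 : x.2 none ≤ I.hi.val := hI.2.elim (fun h => h.le) fun h => h.2.le
  -- The numerator is an integer bound of the endpoint that can be read off the code.
  have h2 : I.hi.val ≤ I.hi.1 := by
    unfold RatCode.val
    exact div_le_self zero_le (by simp)
  have h3 : (x.2 c : ℝ) ≤ I.hi.1 := by exact_mod_cast (hx c).trans (h1.trans h2)
  push_cast
  exact mul_le_mul_of_nonneg_left h3 (Nat.cast_nonneg D)

end Evolution

/-! ### Primitive recursiveness of the zone operations -/

section Computability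

variable {α β γ σ : Type*} [Primcodable α] [Primcodable β] [Primcodable γ] [Primcodable σ]

/-- A finite case distinction on `b`, assembled along a list of all values. It disposes of
variables, comparison symbols and connectives without computing with them. -/
theorem primrec₂_of_finite [Finite β] {f : α → β → σ} (h : ∀ b, Primrec fun a => f a b) :
    Primrec₂ f := by
  classical
  rcases isEmpty_or_nonempty β with _ | ⟨⟨b₀⟩⟩
  · have : Finite (α × β) := inferInstance
    exact Primrec.dom_finite _
  have key : ∀ l : List β, ∃ g : α → β → σ, Primrec₂ g ∧ ∀ a, ∀ b ∈ l, g a b = f a b := by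
    intro l
    induction l with
    | nil => exact ⟨fun a _ => f a b₀, (h b₀).comp Primrec.fst, by simp⟩
    | cons b l ih =>
      obtain ⟨g, hg, hgf⟩ := ih
      refine ⟨fun a c => if c = b then f a b else g a c,
        Primrec.ite (Primrec.eq.comp Primrec.snd (Primrec.const b)) ((h b).comp Primrec.fst) hg,
        fun a c hc => ?_⟩
      by_cases hcb : c = b
      · simp [hcb]
      · exact (if_neg hcb).trans (hgf a c ((List.mem_cons.1 hc).resolve_left hcb))
  have := Fintype.ofFinite β
  obtain ⟨g, hg, hgf⟩ := key Finset.univ.toList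
  exact hg.of_eq fun a b => hgf a b (by simp)

theorem primrec_of_finite [Finite β] {f : β → α → σ} (h : ∀ b, Primrec (f b)) {g : γ → β}
    {k : γ → α} (hg : Primrec g) (hk : Primrec k) : Primrec fun c => f (g c) (k c) :=
  (primrec₂_of_finite (f := fun a b => f b a) h).comp hk hg

section Atoms

variable {V : Type*} [Finite V] [Primcodable V]

theorem primrec_diffAtom_map {W : Type*} [Primcodable W] (f : V → W) :
    Primrec (DiffAtom.map f) :=
  (((Primrec.dom_finite f).comp (Primrec.fst.comp Primrec.fst)).pair
    (Primrec.snd.comp Primrec.fst)).pair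
    ((((Primrec.dom_finite f).comp (Primrec.fst.comp (Primrec.fst.comp Primrec.snd))).pair
      (Primrec.snd.comp (Primrec.fst.comp Primrec.snd))).pair (Primrec.snd.comp Primrec.snd))

omit [Finite V] in
theorem primrec_diffAtom_compl : Primrec (DiffAtom.compl (V := V)) :=
  (Primrec.fst.comp Primrec.snd).pair
    (Primrec.fst.pair (Primrec.not.comp (Primrec.snd.comp Primrec.snd)))

omit [Finite V] in
theorem primrec_diffAtom_trans : Primrec₂ (DiffAtom.trans (V := V)) := by
  have l1 : Primrec fun p : DiffAtom V × DiffAtom V => p.1.1 := Primrec.fst.comp Primrec.fst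
  have l2 : Primrec fun p : DiffAtom V × DiffAtom V => p.1.2.1 :=
    Primrec.fst.comp (Primrec.snd.comp Primrec.fst)
  have l3 : Primrec fun p : DiffAtom V × DiffAtom V => p.1.2.2 :=
    Primrec.snd.comp (Primrec.snd.comp Primrec.fst)
  have r1 : Primrec fun p : DiffAtom V × DiffAtom V => p.2.1 := Primrec.fst.comp Primrec.snd
  have r2 : Primrec fun p : DiffAtom V × DiffAtom V => p.2.2.1 :=
    Primrec.fst.comp (Primrec.snd.comp Primrec.snd)
  have r3 : Primrec fun p : DiffAtom V × DiffAtom V => p.2.2.2 :=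
    Primrec.snd.comp (Primrec.snd.comp Primrec.snd)
  exact ((Primrec.fst.comp l1).pair
    (Primrec.nat_add.comp (Primrec.snd.comp l1) (Primrec.snd.comp r1))).pair
    (((Primrec.fst.comp r2).pair
      (Primrec.nat_add.comp (Primrec.snd.comp l2) (Primrec.snd.comp r2))).pair
      (Primrec.or.comp l3 r3))

theorem primrecPred_diffAtom_vars (p : V → V → Prop) :
    PrimrecPred fun a : DiffAtom V => p a.1.1 a.2.1.1 := by
  classical
  exact ((Primrec.dom_finite fun x : V × V => decide (p x.1 x.2)).comp
    ((Primrec.fst.comp Primrec.fst).pair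
      (Primrec.fst.comp (Primrec.fst.comp Primrec.snd)))).primrecPred

theorem primrec_elimVar [DecidableEq V] (o z : V) : Primrec (elimVar o z) := by
  have hfil : ∀ (p : V → V → Prop) [DecidablePred fun a : DiffAtom V => p a.1.1 a.2.1.1],
      Primrec fun Z : List (DiffAtom V) => Z.filter fun a => p a.1.1 a.2.1.1 :=
    fun p _ => Primrec.listFilter (primrecPred_diffAtom_vars p)
  refine Primrec.list_append.comp (hfil fun x y => x ≠ z ∧ y ≠ z)
    (Primrec.list_append.comp (Primrec.list_map (hfil fun x y => x = z ∧ y = z)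
      ((primrec_diffAtom_map _).comp Primrec.snd)) ?_)
  refine Primrec.list_flatMap (hfil fun x y => x ≠ z ∧ y = z) ?_
  exact Primrec.list_map ((hfil fun x y => x = z ∧ y ≠ z).comp Primrec.fst)
    (primrec_diffAtom_trans.comp (Primrec.snd.comp Primrec.fst) Primrec.snd)

theorem primrec_elimVars [DecidableEq V] (o : V) (zs : List V) : Primrec (elimVars o zs) := by
  induction zs with
  | nil => exact Primrec.id
  | cons z zs ih => exact (primrec_elimVar o z).comp ih

omit [Finite V] in
theorem primrec_cmpAtoms (x y : V) (c : Cmp) : Primrec (cmpAtoms x y c) := by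
  have h0 : ∀ (z : V), Primrec fun n : ℕ => ((z, n) : V × ℕ) := fun z =>
    (Primrec.const z).pair Primrec.id
  have h1 : ∀ s : Bool, Primrec fun n : ℕ => (((x, 0), (y, n), s) : DiffAtom V) := fun s =>
    (Primrec.const (x, 0)).pair ((h0 y).pair (Primrec.const s))
  have h2 : ∀ s : Bool, Primrec fun n : ℕ => (((y, n), (x, 0), s) : DiffAtom V) := fun s =>
    (h0 y).pair (Primrec.const ((x, 0), s))
  have hs : ∀ {f g : ℕ → DiffAtom V}, Primrec f → Primrec g → Primrec fun n => [f n, g n] :=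
    fun hf hg => Primrec.list_cons.comp hf (Primrec.list_cons.comp hg (Primrec.const []))
  have hs1 : ∀ {f : ℕ → DiffAtom V}, Primrec f → Primrec fun n => [f n] :=
    fun hf => Primrec.list_cons.comp hf (Primrec.const [])
  cases c
  · exact hs1 (h1 true)
  · exact hs1 (h1 false)
  · exact hs (h1 false) (h2 false)
  · exact hs1 (h2 false)
  · exact hs1 (h2 true)

end Atoms

variable {K : Type*} [Finite K] [Primcodable K]

instance : Finite Cmp := Finite.of_equiv _ Cmp.equivFin.symm

theorem primrec_scale {f : α → ℕ} {g : α → RatCode} (hf : Primrec f) (hg : Primrec g) :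
    Primrec fun a => (g a).scale (f a) :=
  Primrec.nat_mul.comp (Primrec.fst.comp hg)
    (Primrec.nat_div.comp hf (Primrec.succ.comp (Primrec.snd.comp hg)))

theorem primrec_zone_toDiff {f : α → ℕ} {g : α → Zone K} (hf : Primrec f) (hg : Primrec g) :
    Primrec fun a => (g a).toDiff (f a) := by
  refine Primrec.list_flatMap hg ?_
  have hs : Primrec fun p : α × ZoneAtom K => p.2.2.2.scale (f p.1) :=
    primrec_scale (hf.comp Primrec.fst) (Primrec.snd.comp (Primrec.snd.comp Primrec.snd))
  exact primrec_of_finite (β := (K ⊕ K × K) × Cmp)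
    (f := fun b n => cmpAtoms (zoneVars b.1).1 (zoneVars b.1).2 b.2 n)
    (fun b => primrec_cmpAtoms _ _ _)
    ((Primrec.fst.comp Primrec.snd).pair (Primrec.fst.comp (Primrec.snd.comp Primrec.snd))) hs

omit [Finite K] in
theorem primrec_guard_toDiff {C : Type*} [Finite C] [Primcodable C] (k : C → K) {f : α → ℕ}
    {g : α → Guard C} (hf : Primrec f) (hg : Primrec g) :
    Primrec fun a => (g a).toDiff k (f a) := by
  refine Primrec.list_flatMap hg ?_
  have hs : Primrec fun p : α × C × Cmp × ℕ => f p.1 * p.2.2.2 :=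
    Primrec.nat_mul.comp (hf.comp Primrec.fst) (Primrec.snd.comp (Primrec.snd.comp Primrec.snd))
  exact primrec_of_finite (β := C × Cmp)
    (f := fun b n => cmpAtoms (cvar (k b.1)) none b.2 n)
    (fun b => primrec_cmpAtoms _ _ _)
    ((Primrec.fst.comp Primrec.snd).pair (Primrec.fst.comp (Primrec.snd.comp Primrec.snd))) hs

omit [Finite K] in
/-- The translation of a fixed guard needs no code of the guard. -/
theorem primrec_const_guard_toDiff {C : Type*} (k : C → K) (g : Guard C) {f : α → ℕ}
    (hf : Primrec f) : Primrec fun a => g.toDiff k (f a) := by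
  induction g with
  | nil => exact Primrec.const []
  | cons b g ih =>
    exact Primrec.list_append.comp ((primrec_cmpAtoms (cvar (k b.1)) none b.2.1).comp
      (Primrec.nat_mul.comp hf (Primrec.const b.2.2))) ih

omit [Finite K] in
theorem primrec_ivlDiff (τ : K) {f : α → ℕ} {g : α → IvlCode} (hf : Primrec f) (hg : Primrec g) :
    Primrec fun a => ivlDiff τ (f a) (g a) := by
  have hlo : Primrec fun a => ((none : ZVar K), (g a).1.1.scale (f a)) :=
    (Primrec.const none).pair (primrec_scale hf (Primrec.fst.comp (Primrec.fst.comp hg)))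
  have hhi : Primrec fun a => ((none : ZVar K), (g a).2.1.scale (f a)) :=
    (Primrec.const none).pair (primrec_scale hf (Primrec.fst.comp (Primrec.snd.comp hg)))
  have hl : Primrec fun a => !(g a).1.2 :=
    Primrec.not.comp (Primrec.snd.comp (Primrec.fst.comp hg))
  have hh : Primrec fun a => !(g a).2.2 :=
    Primrec.not.comp (Primrec.snd.comp (Primrec.snd.comp hg))
  exact Primrec.list_cons.comp (hlo.pair ((Primrec.const (cvar τ, 0)).pair hl))
    (Primrec.list_cons.comp ((Primrec.const (cvar τ, 0)).pair (hhi.pair hh)) (Primrec.const []))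

theorem primrec_elapseDiff [Fintype K] [DecidableEq K] : Primrec (elapseDiff (K := K)) :=
  (primrec_elimVar _ _).comp (Primrec.list_append.comp
    (Primrec.list_map Primrec.id ((primrec_diffAtom_map _).comp Primrec.snd)) (Primrec.const _))

theorem primrec_forgetDiff [DecidableEq K] (R : List K) : Primrec (forgetDiff R) :=
  (primrec_elimVars _ _).comp (Primrec.list_append.comp Primrec.id (Primrec.const _))

theorem primrec_resetDiff [DecidableEq K] (R : List K) : Primrec (resetDiff R) :=
  Primrec.list_append.comp (primrec_forgetDiff R) (Primrec.const _)

theorem primrec_transDiff {Q S : Type*} [Fintype K] [DecidableEq K] (e : Transition Q S K)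
    {f : α → ℕ} {g : α → List (DiffAtom (ZVar K))} (hf : Primrec f) (hg : Primrec g) :
    Primrec fun a => transDiff e (f a) (g a) :=
  (primrec_resetDiff _).comp (Primrec.list_append.comp (primrec_elapseDiff.comp hg)
    (primrec_const_guard_toDiff _ _ hf))

theorem primrec_inf {V : Type*} [Primcodable V] {f g : α → Dnf V} (hf : Primrec f)
    (hg : Primrec g) : Primrec fun a => (f a).inf (g a) :=
  Primrec.list_flatMap hf (Primrec.list_map (hg.comp Primrec.fst)
    (Primrec.list_append.comp (Primrec.snd.comp Primrec.fst) Primrec.snd))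

theorem primrec_complZone {V : Type*} [Primcodable V] : Primrec (complZone (V := V)) :=
  Primrec.list_map Primrec.id (Primrec.list_cons.comp (primrec_diffAtom_compl.comp Primrec.snd)
    (Primrec.const []))

theorem primrec_connStep {V : Type*} [Primcodable V] (i : Fin 3) :
    Primrec (connStep (V := V) i) := by
  have h : Primrec fun st : List (Dnf V × Dnf V) => st.headI := Primrec.list_headI
  have t : Primrec fun st : List (Dnf V × Dnf V) => st.tail := Primrec.list_tail
  have h' := h.comp t
  have t' := t.comp t
  unfold connStep
  split_ifs
  · exact Primrec.list_cons.comp ((Primrec.snd.comp h).pair (Primrec.fst.comp h)) t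
  · exact Primrec.list_cons.comp ((primrec_inf (Primrec.fst.comp h) (Primrec.fst.comp h')).pair
      (Primrec.list_append.comp (Primrec.snd.comp h) (Primrec.snd.comp h'))) t'
  · exact Primrec.list_cons.comp ((Primrec.list_append.comp (Primrec.fst.comp h)
      (Primrec.fst.comp h')).pair (primrec_inf (Primrec.snd.comp h) (Primrec.snd.comp h'))) t'

variable {Q S C : Type*} [Finite Q] [Finite S] [Finite C] [Primcodable Q] [Primcodable S]
  [Primcodable C] [DecidableEq Q] [DecidableEq S]

omit [Finite K] in
theorem primrec_formDnf (a : S) (q : Q) (k : C → K) {f : α → ℕ} {g : α → List (Token Q S C)}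
    (hf : Primrec f) (hg : Primrec g) : Primrec fun x => formDnf a q k (f x) (g x) := by
  refine Primrec.fst.comp (Primrec.list_headI.comp (Primrec.list_foldr hg (Primrec.const [])
    (h := fun x p => tokenStep a q k (f x) p.1 p.2) ?_))
  have hst : Primrec fun p : α × Token Q S C × List (Dnf (ZVar K) × Dnf (ZVar K)) => p.2.2 :=
    Primrec.snd.comp Primrec.snd
  have hbool : ∀ {τ : Type _} [Primcodable τ] {b : τ → Bool}, Primrec b →
      Primrec fun t => boolDnf (ZVar K) (b t) := fun hb => (Primrec.dom_bool _).comp hb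
  refine (Primrec.sumCasesOn (Primrec.fst.comp Primrec.snd)
    (g := fun p b => boolDnf _ (decide (b = a)) :: p.2.2)
    (h := fun p s => Sum.casesOn s (fun r => boolDnf _ (decide (r = q)) :: p.2.2)
      (fun s => Sum.casesOn s (fun g : Guard C =>
        ([g.toDiff k (f p.1)], complZone (g.toDiff k (f p.1))) :: p.2.2)
        (fun i => connStep i p.2.2))) ?_ ?_).of_eq ?_
  · exact Primrec.list_cons.comp (hbool ((Primrec.dom_finite fun b => decide (b = a)).comp Primrec.snd))
      (hst.comp Primrec.fst)
  · refine Primrec.sumCasesOn Primrec.snd ?_ ?_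
    · exact Primrec.list_cons.comp (hbool ((Primrec.dom_finite fun b => decide (b = q)).comp Primrec.snd))
        (hst.comp (Primrec.fst.comp Primrec.fst))
    · refine Primrec.sumCasesOn Primrec.snd ?_ ?_
      · have hD : Primrec fun p : (((α × Token Q S C × List (Dnf (ZVar K) × Dnf (ZVar K))) ×
            (Q ⊕ Guard C ⊕ Fin 3)) × (Guard C ⊕ Fin 3)) × Guard C => f p.1.1.1.1 :=
          hf.comp (Primrec.fst.comp (Primrec.fst.comp (Primrec.fst.comp Primrec.fst)))
        have hG := primrec_guard_toDiff k hD Primrec.snd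
        exact Primrec.list_cons.comp ((Primrec.list_cons.comp hG (Primrec.const [])).pair
          (primrec_complZone.comp hG))
          (hst.comp (Primrec.fst.comp (Primrec.fst.comp Primrec.fst)))
      · exact primrec_of_finite (f := fun i st => connStep i st) primrec_connStep Primrec.snd
          (hst.comp (Primrec.fst.comp (Primrec.fst.comp Primrec.fst)))
  · rintro ⟨x, (b | r | g | i), st⟩ <;> rfl

variable {P : Type*} [Primcodable P] [DecidableEq P] [Fintype K] [DecidableEq K]

theorem primrec_transSucc (loc : P → Q) (k : C → K) (τ : K) (e : Transition P S K) {f : α → ℕ}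
    {g : α → List (Token Q S C)} {h : α → IvlCode} {X : α → DiffStates P K} (hf : Primrec f)
    (hg : Primrec g) (hh : Primrec h) (hX : Primrec X) :
    Primrec fun a => transSucc loc k τ e (f a) (g a) (h a) (X a) := by
  refine Primrec.list_flatMap hX (Primrec.ite ?_ ?_ (Primrec.const []))
  · exact Primrec.eq.comp (Primrec.fst.comp Primrec.snd) (Primrec.const _)
  · refine Primrec.list_map ((primrec_formDnf _ _ _ hf hg).comp Primrec.fst) ?_
    have h1 : Primrec fun p : (α × (P × List (DiffAtom (ZVar K)))) × List (DiffAtom (ZVar K)) =>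
      p.1.1 := Primrec.fst.comp Primrec.fst
    exact (Primrec.const _).pair (Primrec.list_append.comp
      (primrec_transDiff e (hf.comp h1) (Primrec.snd.comp (Primrec.snd.comp Primrec.fst)))
      (Primrec.list_append.comp (primrec_ivlDiff τ (hf.comp h1) (hh.comp h1)) Primrec.snd))

/-- The transitions are a fixed list, so finitely many primitive recursive functions are combined
and the automaton itself needs no code. -/
theorem primrec_succDiff (E : List (Transition P S K)) (loc : P → Q) (k : C → K) (τ : K)
    {f : α → ℕ} {g : α → List (Token Q S C)} {h : α → IvlCode} {X : α → DiffStates P K}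
    (hf : Primrec f) (hg : Primrec g) (hh : Primrec h) (hX : Primrec X) :
    Primrec fun a => succDiff E loc k τ (f a) (g a) (h a) (X a) := by
  induction E with
  | nil => exact Primrec.const []
  | cons e E ih => exact Primrec.list_append.comp (primrec_transSucc loc k τ e hf hg hh hX) ih

end Computability

/-! ### Translation of integer difference constraints into rational zones -/

section ToZones

variable {V L K : Type*}

/-- Constraints without clocks, which no zone can express, are checked separately. -/
def DiffAtom.constHolds (f : V → Option K) (a : DiffAtom V) : Bool :=
  match f a.1.1, f a.2.1.1 with
  | none, none => if a.2.2 then decide (a.1.2 < a.2.1.2) else decide (a.1.2 ≤ a.2.1.2)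
  | _, _ => true

/-- Zone constants are non-negative. A negative upper bound of a single clock is unsatisfiable and
written as `c - c > 0`, a negative lower bound is void, and a difference with a negative bound is
written with the clocks interchanged. The code `(n, D - 1)` stands for `n / D`. -/
def DiffAtom.toZone (f : V → Option K) (D : ℕ) (a : DiffAtom V) : Zone K :=
  match f a.1.1, f a.2.1.1 with
  | none, none => []
  | some c, none => if a.1.2 ≤ a.2.1.2 then
      [(Sum.inl c, if a.2.2 then .lt else .le, (a.2.1.2 - a.1.2, D - 1))]
    else [(Sum.inr (c, c), .gt, (0, 0))]
  | none, some c => if a.2.1.2 ≤ a.1.2 then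
      [(Sum.inl c, if a.2.2 then .gt else .ge, (a.1.2 - a.2.1.2, D - 1))] else []
  | some c, some c' => if a.1.2 ≤ a.2.1.2 then
      [(Sum.inr (c, c'), if a.2.2 then .lt else .le, (a.2.1.2 - a.1.2, D - 1))]
    else [(Sum.inr (c', c), if a.2.2 then .gt else .ge, (a.1.2 - a.2.1.2, D - 1))]

theorem RatCode.mul_val_pred {D : ℕ} (hD : 0 < D) (n : ℕ) :
    (D : ℝ) * (RatCode.val (n, D - 1) : ℝ) = n := by
  obtain ⟨D, rfl⟩ := Nat.exists_eq_succ_of_ne_zero hD.ne'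
  have : (D : ℝ) + 1 ≠ 0 := by positivity
  simp only [val, Nat.succ_eq_add_one, Nat.add_sub_cancel]
  push_cast
  field_simp

theorem DiffAtom.sat_iff_toZone (f : V → Option K) {D : ℕ} (hD : 0 < D) (a : DiffAtom V)
    (v : Val K) : a.Sat (scaledVal f D v) ↔
      a.constHolds f = true ∧ ∀ b ∈ a.toZone f D, ZoneAtom.Sat v b := by
  have hD' : (0 : ℝ) < D := by exact_mod_cast hD
  have hc : ∀ (c : Cmp) (x : ℝ) (n : ℕ),
      c.Holds x (RatCode.val (n, D - 1) : ℝ) ↔ c.Holds (D * x) n := fun c x n => by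
    rw [← Cmp.holds_mul_iff hD', RatCode.mul_val_pred hD]
  obtain ⟨⟨x, p⟩, ⟨y, q⟩, s⟩ := a
  simp only [Sat, constHolds, toZone, scaledVal]
  rcases f x with _ | c <;> rcases f y with _ | c' <;>
    simp only [Option.elim_none, Option.elim_some]
  · cases s <;> simp
  · have h0 : 0 ≤ (D : ℝ) * v c' := by positivity
    split_ifs with hs h h
    · simp only [List.mem_singleton, forall_eq, ZoneAtom.Sat, hc, true_and]
      simp only [Cmp.Holds, Nat.cast_sub h]
      constructor <;> intro h <;> linarith
    · have : (p : ℝ) < q := by exact_mod_cast not_le.1 h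
      simp only [List.not_mem_nil, false_imp_iff, implies_true, and_self, iff_true]
      linarith
    · simp only [List.mem_singleton, forall_eq, ZoneAtom.Sat, hc, true_and]
      simp only [Cmp.Holds, Nat.cast_sub h]
      constructor <;> intro h <;> linarith
    · have : (p : ℝ) < q := by exact_mod_cast not_le.1 h
      simp only [List.not_mem_nil, false_imp_iff, implies_true, and_self, iff_true]
      linarith
  · have h0 : 0 ≤ (D : ℝ) * v c := by positivity
    have hz : ¬ ZoneAtom.Sat v (Sum.inr (c, c), Cmp.gt, (0, 0)) := by
      simp [ZoneAtom.Sat, Cmp.Holds, RatCode.val]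
    split_ifs with hs h h
    · simp only [List.mem_singleton, forall_eq, ZoneAtom.Sat, hc, true_and]
      simp only [Cmp.Holds, Nat.cast_sub h]
      constructor <;> intro h <;> linarith
    · have : (q : ℝ) < p := by exact_mod_cast not_le.1 h
      simp only [List.mem_singleton, forall_eq, hz, and_false, iff_false]
      linarith
    · simp only [List.mem_singleton, forall_eq, ZoneAtom.Sat, hc, true_and]
      simp only [Cmp.Holds, Nat.cast_sub h]
      constructor <;> intro h <;> linarith
    · have : (q : ℝ) < p := by exact_mod_cast not_le.1 h
      simp only [List.mem_singleton, forall_eq, hz, and_false, iff_false]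
      linarith
  · split_ifs with hs h h
    · simp only [List.mem_singleton, forall_eq, ZoneAtom.Sat, hc, true_and]
      simp only [Cmp.Holds, Nat.cast_sub h, mul_sub]
      constructor <;> intro h <;> linarith
    · simp only [List.mem_singleton, forall_eq, ZoneAtom.Sat, hc, true_and]
      simp only [Cmp.Holds, Nat.cast_sub (not_le.1 h).le, mul_sub]
      constructor <;> intro h <;> linarith
    · simp only [List.mem_singleton, forall_eq, ZoneAtom.Sat, hc, true_and]
      simp only [Cmp.Holds, Nat.cast_sub h, mul_sub]
      constructor <;> intro h <;> linarith
    · simp only [List.mem_singleton, forall_eq, ZoneAtom.Sat, hc, true_and]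
      simp only [Cmp.Holds, Nat.cast_sub (not_le.1 h).le, mul_sub]
      constructor <;> intro h <;> linarith

/-- Symbolic states whose variables are interpreted through `f`, as symbolic states with rational
zones. -/
def toSymStates (f : V → Option K) (D : ℕ) (X : List (L × List (DiffAtom V))) : SymStates L K :=
  X.flatMap fun s => if ∀ a ∈ s.2, a.constHolds f = true then
    [(s.1, s.2.flatMap (DiffAtom.toZone f D))] else []

theorem toSet_toSymStates (f : V → Option K) {D : ℕ} (hD : 0 < D)
    (X : List (L × List (DiffAtom V))) :
    (toSymStates f D X).toSet =
      {x | ∃ s ∈ X, s.1 = x.1 ∧ ∀ a ∈ s.2, a.Sat (scaledVal f D x.2)} := by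
  ext x
  simp only [SymStates.toSet, toSymStates, List.mem_flatMap, Set.mem_ofPred_eq,
    DiffAtom.sat_iff_toZone f hD]
  constructor
  · rintro ⟨z, ⟨s, hs, hz⟩, h1, h2⟩
    split_ifs at hz with hc
    · rw [List.mem_singleton] at hz
      subst hz
      exact ⟨s, hs, h1, fun a ha => ⟨hc a ha, fun b hb => h2 b (List.mem_flatMap.2 ⟨a, ha, hb⟩)⟩⟩
    · simp at hz
  · rintro ⟨s, hs, h1, h2⟩
    refine ⟨(s.1, s.2.flatMap (DiffAtom.toZone f D)), ⟨s, hs, ?_⟩, ?_⟩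
    · rw [if_pos fun a ha => (h2 a ha).1]
      exact List.mem_singleton_self _
    · refine ⟨h1, fun b hb => ?_⟩
      obtain ⟨a, ha, hb⟩ := List.mem_flatMap.1 hb
      exact (h2 a ha).2 b hb

/-- A common denominator of all constants. -/
def commonDenom (X : SymStates L K) : ℕ :=
  (X.flatMap fun s => s.2.map fun a => a.2.2.2 + 1).prod

theorem commonDenom_pos (X : SymStates L K) : 0 < commonDenom X := by
  refine List.prod_pos fun n hn => ?_
  obtain ⟨s, -, hn⟩ := List.mem_flatMap.1 hn
  obtain ⟨a, -, rfl⟩ := List.mem_map.1 hn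
  exact Nat.succ_pos _

theorem dvd_commonDenom (X : SymStates L K) {s : L × Zone K} (hs : s ∈ X) {a : ZoneAtom K}
    (ha : a ∈ s.2) : a.2.2.2 + 1 ∣ commonDenom X :=
  List.dvd_prod (List.mem_flatMap.2 ⟨s, hs, List.mem_map.2 ⟨a, ha, rfl⟩⟩)

section Computability

variable [Primcodable V] [Primcodable L] [Primcodable K] [Finite V] {α : Type*} [Primcodable α]

omit [Finite V] [Primcodable V] in
theorem primrec_commonDenom : Primrec (commonDenom (L := L) (K := K)) := by
  have h : Primrec fun X : SymStates L K => X.flatMap fun s => s.2.map fun a => a.2.2.2 + 1 :=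
    Primrec.list_flatMap Primrec.id (Primrec.list_map (Primrec.snd.comp Primrec.snd)
      (Primrec.succ.comp (Primrec.snd.comp (Primrec.snd.comp (Primrec.snd.comp Primrec.snd)))))
  refine (Primrec.list_foldr h (Primrec.const 1) (h := fun _ p => p.1 * p.2)
    (Primrec.nat_mul.comp (Primrec.fst.comp Primrec.snd)
      (Primrec.snd.comp Primrec.snd)).to₂).of_eq fun X => ?_
  rw [commonDenom, List.prod_eq_foldr]

/-- A function of a constraint is primitive recursive if it is so for all choices of the variables
and of the strictness. -/
theorem primrec_of_diffAtom {σ : Type*} [Primcodable σ] {f : (V × V × Bool) → α × ℕ × ℕ → σ}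
    (h : ∀ b, Primrec (f b)) {g : α → DiffAtom V} (hg : Primrec g) :
    Primrec fun a => f ((g a).1.1, (g a).2.1.1, (g a).2.2) (a, (g a).1.2, (g a).2.1.2) :=
  have h1 := Primrec.fst.comp hg
  have h2 := Primrec.fst.comp (Primrec.snd.comp hg)
  primrec_of_finite h ((Primrec.fst.comp h1).pair ((Primrec.fst.comp h2).pair
    (Primrec.snd.comp (Primrec.snd.comp hg))))
    (Primrec.id.pair ((Primrec.snd.comp h1).pair (Primrec.snd.comp h2)))

omit [Primcodable K] in
theorem primrec_constHolds (f : V → Option K) : Primrec (DiffAtom.constHolds f) := by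
  refine (primrec_of_diffAtom (α := DiffAtom V) (f := fun b a =>
    DiffAtom.constHolds f ((b.1, a.2.1), (b.2.1, a.2.2), b.2.2)) ?_ Primrec.id).of_eq fun _ => rfl
  rintro ⟨x, y, s⟩
  have hp : Primrec fun a : DiffAtom V × ℕ × ℕ => a.2.1 := Primrec.fst.comp Primrec.snd
  have hq : Primrec fun a : DiffAtom V × ℕ × ℕ => a.2.2 := Primrec.snd.comp Primrec.snd
  simp only [DiffAtom.constHolds]
  rcases f x with _ | c <;> rcases f y with _ | c'
  · cases s
    · exact (Primrec.nat_le.comp hp hq).decide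
    · exact (Primrec.nat_lt.comp hp hq).decide
  all_goals exact Primrec.const _

theorem primrec_toZone (f : V → Option K) {k : α → ℕ} {g : α → DiffAtom V} (hk : Primrec k)
    (hg : Primrec g) : Primrec fun a => (g a).toZone f (k a) := by
  refine (primrec_of_diffAtom (α := α) (f := fun b a =>
    DiffAtom.toZone f (k a.1) ((b.1, a.2.1), (b.2.1, a.2.2), b.2.2)) ?_ hg).of_eq fun _ => rfl
  rintro ⟨x, y, s⟩
  have hp : Primrec fun a : α × ℕ × ℕ => a.2.1 := Primrec.fst.comp Primrec.snd
  have hq : Primrec fun a : α × ℕ × ℕ => a.2.2 := Primrec.snd.comp Primrec.snd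
  have hD : Primrec fun a : α × ℕ × ℕ => k a.1 - 1 := Primrec.pred.comp (hk.comp Primrec.fst)
  have hone : ∀ (b : K ⊕ K × K) (c : Cmp) {u v : α × ℕ × ℕ → ℕ}, Primrec u → Primrec v →
      Primrec fun a => ([(b, c, (u a - v a, k a.1 - 1))] : Zone K) := fun b c u v hu hv =>
    Primrec.list_cons.comp ((Primrec.const b).pair ((Primrec.const c).pair
      ((Primrec.nat_sub.comp hu hv).pair hD))) (Primrec.const [])
  simp only [DiffAtom.toZone]
  rcases f x with _ | c <;> rcases f y with _ | c'
  · exact Primrec.const _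
  · exact Primrec.ite (Primrec.nat_le.comp hq hp)
      (hone (Sum.inl c') (if s then .gt else .ge) hp hq) (Primrec.const _)
  · exact Primrec.ite (Primrec.nat_le.comp hp hq)
      (hone (Sum.inl c) (if s then .lt else .le) hq hp) (Primrec.const _)
  · exact Primrec.ite (Primrec.nat_le.comp hp hq)
      (hone (Sum.inr (c, c')) (if s then .lt else .le) hq hp)
      (hone (Sum.inr (c', c)) (if s then .gt else .ge) hp hq)

theorem primrec_toSymStates (f : V → Option K) {k : α → ℕ} {g : α → List (L × List (DiffAtom V))}
    (hk : Primrec k) (hg : Primrec g) : Primrec fun a => toSymStates f (k a) (g a) := by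
  refine Primrec.list_flatMap hg (Primrec.ite ?_ ?_ (Primrec.const []))
  · exact (PrimrecPred.forall_mem_list (p := fun a : DiffAtom V => a.constHolds f = true)
      (Primrec.eq.comp (primrec_constHolds f) (Primrec.const true))).comp
      (Primrec.snd.comp Primrec.snd)
  · refine Primrec.list_cons.comp ((Primrec.fst.comp Primrec.snd).pair ?_) (Primrec.const [])
    exact Primrec.list_flatMap (Primrec.snd.comp Primrec.snd)
      (primrec_toZone f (hk.comp (Primrec.fst.comp Primrec.fst)) Primrec.snd)

end Computability

end ToZones

/-! ### The update of the memory -/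

section Update

variable {Q S C Q' C' : Type*} [Fintype C] [DecidableEq C] [DecidableEq Q] [DecidableEq S]
  [DecidableEq Q']

/-- The successor operation for a coded observation element. -/
noncomputable def codeSucc (M : TBA Q S C) (loc : Q → Q') (clk : C' → C) (D : ℕ)
    (c : ObsCode Q' S C') (X : DiffStates Q (Option C)) : DiffStates Q (Option C) :=
  succDiff M.withTime.trans_finite.toFinset.toList loc (fun c => some (clk c)) none D c.1 c.2.1 X

/-- The effect of an observation element, by iterated successor operations. -/
noncomputable def updateDiff (M : TBA Q S C) (loc : Q → Q') (clk : C' → C) (D : ℕ)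
    (c : ObsCode Q' S C') (X : DiffStates Q (Option C)) : DiffStates Q (Option C) :=
  if c.2.2.1 = 0 then (fun Y => X ++ codeSucc M loc clk D c Y)^[c.2.2.2] X
  else if c.2.2.1 = 1 then (codeSucc M loc clk D c)^[c.2.2.2] X
  else (fun Y => (codeSucc M loc clk D c)^[c.2.2.2] X ++
    codeSucc M loc clk D c Y)^[iterBound Q (Option C) (D * c.2.1.2.1.1)] []

/-- A common denominator of the memory and of an interval. -/
def updateDenom {L K : Type*} (X : SymStates L K) (I : IvlCode) : ℕ :=
  commonDenom X * ((I.1.1.2 + 1) * (I.2.1.2 + 1))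

noncomputable def updateSym (M : TBA Q S C) (loc : Q → Q') (clk : C' → C)
    (X : SymStates Q (Option C)) (c : ObsCode Q' S C') : SymStates Q (Option C) :=
  toSymStates Option.join (updateDenom X c.2.1)
    (updateDiff M loc clk (updateDenom X c.2.1) c (X.toDiff (updateDenom X c.2.1)))

section Correctness

variable {A : TBA Q' S C'} {M : TBA Q S C} {loc : Q → Q'} {clk : C' → C}

theorem toSet_codeSucc (φ : PForm Q' S C') (I : RatInterval) (m : Mult) {D : ℕ} (hD : 0 < D)
    (hlo : I.lo.2 + 1 ∣ D) (hhi : I.hi.2 + 1 ∣ D) (X : DiffStates Q (Option C)) :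
    DiffStates.toSet D (codeSucc M loc clk D (ObsElem.code ⟨φ, I, m⟩) X) =
      obsSucc M loc clk φ I (DiffStates.toSet D X) :=
  toSet_succDiff M loc clk hD φ I hlo hhi X

theorem toSet_codeSucc_iterate (φ : PForm Q' S C') (I : RatInterval) (m : Mult) {D : ℕ}
    (hD : 0 < D) (hlo : I.lo.2 + 1 ∣ D) (hhi : I.hi.2 + 1 ∣ D) (X : DiffStates Q (Option C))
    (n : ℕ) :
    DiffStates.toSet D ((codeSucc M loc clk D (ObsElem.code ⟨φ, I, m⟩))^[n] X) =
      (obsSucc M loc clk φ I)^[n] (DiffStates.toSet D X) :=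
  (Function.Semiconj.iterate_right (f := DiffStates.toSet D)
    (fun X => toSet_codeSucc φ I m hD hlo hhi X) n) X

theorem toSet_append_codeSucc_iterate (φ : PForm Q' S C') (I : RatInterval) (m : Mult) {D : ℕ}
    (hD : 0 < D) (hlo : I.lo.2 + 1 ∣ D) (hhi : I.hi.2 + 1 ∣ D) (X Y : DiffStates Q (Option C))
    (n : ℕ) :
    DiffStates.toSet D
      ((fun Z => X ++ codeSucc M loc clk D (ObsElem.code ⟨φ, I, m⟩) Z)^[n] Y) =
      (fun Z => DiffStates.toSet D X ∪ obsSucc M loc clk φ I Z)^[n] (DiffStates.toSet D Y) := by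
  refine (Function.Semiconj.iterate_right (f := DiffStates.toSet D) (fun Z => ?_) n) Y
  rw [DiffStates.toSet_append, toSet_codeSucc φ I m hD hlo hhi]

/-- The least fixed point is reached after a number of iterations that depends only on the
denominator and on the interval. -/
theorem iterate_iterBound_eq [Finite Q] (hP : Projects A M loc clk) (o : Obs Q' S C')
    (φ : PForm Q' S C') (I : RatInterval) (e : ℕ) {D : ℕ} (hD : 0 < D) (hlo : I.lo.2 + 1 ∣ D)
    (hhi : I.hi.2 + 1 ∣ D) (X : DiffStates Q (Option C))
    (hX : DiffStates.toSet D X = trackSet A M loc clk o) :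
    (fun Y => (obsSucc M loc clk φ I)^[e] (trackSet A M loc clk o) ∪
      obsSucc M loc clk φ I Y)^[iterBound Q (Option C) (D * I.hi.1)] ∅ =
      trackSet A M loc clk (o ++ [⟨φ, I, .ge e⟩]) := by
  have hF := isRelImage_obsSucc (M := M) (loc := loc) (clk := clk) φ I
  rw [trackSet_concat_ge hP]
  refine iterate_eq_fixedPoint hF _ (zoneSignature D (D * I.hi.1)) e _
    (card_signature_le _) ?_
  set G := fun Y => (obsSucc M loc clk φ I)^[e] (trackSet A M loc clk o) ∪
      obsSucc M loc clk φ I Y with hG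
  have hGm : Monotone G := fun Y Z h => Set.union_subset_union_right _ (hF.mono h)
  have hfix := (isLeast_fixedPoint hF (trackSet A M loc clk o) e).1
  rw [← trackSet_concat_ge hP] at hfix
  -- Every iterate lies inside the fixed point, which is a tracked set, so clocks do not exceed the
  -- time there; after one more successor step the time lies in `I`.
  have hbd : ∀ k x, x ∈ obsSucc M loc clk φ I (G^[k] ∅) →
      ∀ c, (D : ℝ) * (x.2 c : ℝ) ≤ (D * I.hi.1 : ℕ) := by
    intro k x hx
    obtain ⟨-, -, -, -, -, -, hI, -⟩ := mem_obsSucc_iff.1 hx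
    exact mul_le_of_mem_clocksLeTime (obsSucc_subset_clocksLeTime
      ((iterate_subset_lfp hGm (show _ = _ from hfix).symm k).trans
        (trackSet_subset_clocksLeTime hP _)) hx) hI D
  intro k x x' hs hx hx'
  obtain ⟨k', hx'⟩ := hx'
  -- The symbolic computation represents each member of the chain over the one denominator `D`; this
  -- is why signatures decide membership in all of them.
  have hrep : obsSucc M loc clk φ I (G^[k] ∅) = DiffStates.toSet D
      (codeSucc M loc clk D (ObsElem.code ⟨φ, I, .ge e⟩)
        ((fun Z => (codeSucc M loc clk D (ObsElem.code ⟨φ, I, .ge e⟩))^[e] X ++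
          codeSucc M loc clk D (ObsElem.code ⟨φ, I, .ge e⟩) Z)^[k] [])) := by
    rw [toSet_codeSucc φ I _ hD hlo hhi, toSet_append_codeSucc_iterate φ I _ hD hlo hhi,
      toSet_codeSucc_iterate φ I _ hD hlo hhi, hX]
    congr 2
    ext x
    simp [DiffStates.toSet]
  have h1 := hbd k x hx
  have h2 := hbd k' x' hx'
  rw [hrep] at hx ⊢
  exact mem_toSet_of_zoneSignature_eq hs h1 h2 _ hx

theorem toSet_updateDiff [Finite Q] (hP : Projects A M loc clk) (o : Obs Q' S C')
    (e : ObsElem Q' S C') {D : ℕ} (hD : 0 < D) (hlo : e.ivl.lo.2 + 1 ∣ D)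
    (hhi : e.ivl.hi.2 + 1 ∣ D) (X : DiffStates Q (Option C))
    (hX : DiffStates.toSet D X = trackSet A M loc clk o) :
    DiffStates.toSet D (updateDiff M loc clk D e.code X) = trackSet A M loc clk (o ++ [e]) := by
  obtain ⟨φ, I, m⟩ := e
  have hnil : DiffStates.toSet D ([] : DiffStates Q (Option C)) = ∅ := by
    ext x
    simp [DiffStates.toSet]
  cases m with
  | le e =>
    rw [trackSet_concat_le hP, ← hX, ← toSet_append_codeSucc_iterate φ I (.le e) hD hlo hhi]
    rfl
  | eq e =>
    rw [trackSet_concat_eq hP, ← hX, ← toSet_codeSucc_iterate φ I (.eq e) hD hlo hhi]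
    rfl
  | ge e =>
    rw [← iterate_iterBound_eq hP o φ I e hD hlo hhi X hX, ← hX,
      ← toSet_codeSucc_iterate φ I (.ge e) hD hlo hhi, ← hnil,
      ← toSet_append_codeSucc_iterate φ I (.ge e) hD hlo hhi]
    rfl

theorem updateDenom_spec {L K : Type*} (X : SymStates L K) (I : IvlCode) :
    0 < updateDenom X I ∧ (∀ s ∈ X, ∀ a ∈ s.2, a.2.2.2 + 1 ∣ updateDenom X I) ∧
      I.1.1.2 + 1 ∣ updateDenom X I ∧ I.2.1.2 + 1 ∣ updateDenom X I :=
  ⟨Nat.mul_pos (commonDenom_pos X) (Nat.mul_pos (Nat.succ_pos _) (Nat.succ_pos _)),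
    fun _ hs _ ha => (dvd_commonDenom X hs ha).mul_right _,
    (dvd_mul_right _ _).mul_left _, (dvd_mul_left _ _).mul_left _⟩

theorem toSet_updateSym [Finite Q] (hP : Projects A M loc clk) (o : Obs Q' S C')
    (e : ObsElem Q' S C') (X : SymStates Q (Option C))
    (hX : X.toSet = trackSet A M loc clk o) :
    (updateSym M loc clk X e.code).toSet = trackSet A M loc clk (o ++ [e]) := by
  obtain ⟨hD, hs, hlo, hhi⟩ := updateDenom_spec X e.code.2.1
  rw [updateSym, toSet_toSymStates _ hD]
  exact toSet_updateDiff hP o e hD hlo hhi _ (by rw [SymStates.toSet_toDiff hD X hs, hX])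

end Correctness

/-- The initial states, with all clocks zero. -/
noncomputable def initSym [Finite Q] (M : TBA Q S C) : SymStates Q (Option C) :=
  M.init.toFinite.toFinset.toList.map fun q =>
    (q, Finset.univ.toList.map fun c => (Sum.inl c, .le, (0, 0)))

omit [DecidableEq C] [DecidableEq Q] [DecidableEq S] [DecidableEq Q'] in
theorem toSet_initSym [Finite Q] {A : TBA Q' S C'} {M : TBA Q S C} {loc : Q → Q'} {clk : C' → C}
    (hP : Projects A M loc clk) : (initSym M).toSet = trackSet A M loc clk [] := by
  rw [trackSet_nil hP]
  ext x
  simp only [initSym, SymStates.toSet, List.mem_map, Finset.mem_toList, Set.Finite.mem_toFinset,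
    Set.mem_ofPred_eq, exists_exists_and_eq_and, Zone.toSet, forall_exists_index,
    Finset.mem_univ, true_and, forall_apply_eq_imp_iff, ZoneAtom.Sat, Cmp.Holds, RatCode.val]
  constructor
  · rintro ⟨q, hq, rfl, h⟩
    refine ⟨hq, funext fun c => le_antisymm ?_ zero_le⟩
    have h0 : (x.2 c : ℝ) ≤ ((0 : ℝ≥0) : ℝ) := by simpa using h c
    exact NNReal.coe_le_coe.1 h0
  · rintro ⟨hq, h⟩
    exact ⟨x.1, hq, rfl, fun c => by simp [h]⟩

/-- Every set of tracked states is represented by a finite set of symbolic states. -/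
theorem exists_sym_toSet_eq_trackSet [Finite Q] {A : TBA Q' S C'} {M : TBA Q S C} {loc : Q → Q'}
    {clk : C' → C} (hP : Projects A M loc clk) (o : Obs Q' S C') :
    ∃ X : SymStates Q (Option C), X.toSet = trackSet A M loc clk o := by
  induction o using List.reverseRecOn with
  | nil => exact ⟨_, toSet_initSym hP⟩
  | append_singleton o e ih =>
    obtain ⟨X, hX⟩ := ih
    exact ⟨_, toSet_updateSym hP o e X hX⟩

section Computability

variable [Finite S] [Finite Q'] [Finite C'] [Primcodable Q] [Primcodable S]
  [Primcodable C] [Primcodable Q'] [Primcodable C'] {α : Type*} [Primcodable α]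

theorem primrec_codeSucc (M : TBA Q S C) (loc : Q → Q') (clk : C' → C) {f : α → ℕ}
    {g : α → ObsCode Q' S C'} {X : α → DiffStates Q (Option C)} (hf : Primrec f) (hg : Primrec g)
    (hX : Primrec X) : Primrec fun a => codeSucc M loc clk (f a) (g a) (X a) :=
  primrec_succDiff _ _ _ _ hf (Primrec.fst.comp hg) (Primrec.fst.comp (Primrec.snd.comp hg)) hX

theorem primrec_pow : Primrec fun n : ℕ => 2 ^ n :=
  ((Primrec.nat_iterate (f := id) (g := fun _ => 1) (h := fun _ n => 2 * n) Primrec.id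
    (Primrec.const 1) (Primrec.nat_double.comp Primrec.snd).to₂)).of_eq fun n => by
      induction n with
      | zero => rfl
      | succ n ih =>
        simp only [id] at ih ⊢
        rw [Function.iterate_succ_apply', ih, pow_succ, mul_comm]

theorem primrec_iterBound (Q K : Type*) : Primrec (iterBound Q K) :=
  Primrec.succ.comp (Primrec.nat_mul.comp (Primrec.const _) (primrec_pow.comp
    (Primrec.nat_mul.comp (Primrec.const _)
      (Primrec.nat_mul.comp (Primrec.const 2) Primrec.succ))))

theorem primrec_updateDiff (M : TBA Q S C) (loc : Q → Q') (clk : C' → C) {f : α → ℕ}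
    {g : α → ObsCode Q' S C'} {X : α → DiffStates Q (Option C)} (hf : Primrec f) (hg : Primrec g)
    (hX : Primrec X) : Primrec fun a => updateDiff M loc clk (f a) (g a) (X a) := by
  have hm : Primrec fun a => (g a).2.2.1 :=
    Primrec.fst.comp (Primrec.snd.comp (Primrec.snd.comp hg))
  have he : Primrec fun a => (g a).2.2.2 :=
    Primrec.snd.comp (Primrec.snd.comp (Primrec.snd.comp hg))
  have hs : Primrec fun p : α × DiffStates Q (Option C) => codeSucc M loc clk (f p.1) (g p.1) p.2 :=
    primrec_codeSucc M loc clk (hf.comp Primrec.fst) (hg.comp Primrec.fst) Primrec.snd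
  have heq : Primrec fun a => (codeSucc M loc clk (f a) (g a))^[(g a).2.2.2] (X a) :=
    Primrec.nat_iterate he hX hs.to₂
  refine Primrec.ite (Primrec.eq.comp hm (Primrec.const 0)) ?_
    (Primrec.ite (Primrec.eq.comp hm (Primrec.const 1)) heq ?_)
  · exact Primrec.nat_iterate he hX
      (Primrec.list_append.comp (hX.comp Primrec.fst) hs).to₂
  · refine Primrec.nat_iterate ((primrec_iterBound _ _).comp (Primrec.nat_mul.comp hf ?_))
      (Primrec.const []) (Primrec.list_append.comp (heq.comp Primrec.fst) hs).to₂
    exact Primrec.fst.comp (Primrec.fst.comp (Primrec.snd.comp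
      (Primrec.fst.comp (Primrec.snd.comp hg))))

theorem primrec_sym_toDiff {L K : Type*} [Finite K] [Primcodable L] [Primcodable K] {f : α → ℕ}
    {X : α → SymStates L K} (hf : Primrec f) (hX : Primrec X) :
    Primrec fun a => (X a).toDiff (f a) :=
  Primrec.list_map hX ((Primrec.fst.comp Primrec.snd).pair
    (primrec_zone_toDiff (hf.comp Primrec.fst) (Primrec.snd.comp Primrec.snd)))

theorem primrec_updateSym (M : TBA Q S C) (loc : Q → Q') (clk : C' → C) {g : α → ObsCode Q' S C'}
    {X : α → SymStates Q (Option C)} (hX : Primrec X) (hg : Primrec g) :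
    Primrec fun a => updateSym M loc clk (X a) (g a) := by
  have hI : Primrec fun a => (g a).2.1 := Primrec.fst.comp (Primrec.snd.comp hg)
  have hD : Primrec fun a => updateDenom (X a) (g a).2.1 :=
    Primrec.nat_mul.comp (primrec_commonDenom.comp hX) (Primrec.nat_mul.comp
      (Primrec.succ.comp (Primrec.snd.comp (Primrec.fst.comp (Primrec.fst.comp hI))))
      (Primrec.succ.comp (Primrec.snd.comp (Primrec.fst.comp (Primrec.snd.comp hI)))))
  exact primrec_toSymStates _ hD (primrec_updateDiff M loc clk hD hg (primrec_sym_toDiff hD hX))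

end Computability

end Update

/-- The sets of tracked states evolve by iterated successors and least fixed points. -/
theorem evolvesBySucc_trackSet {Q S C Q' C' : Type*} [Finite Q] [Finite C]
    {A : TBA Q' S C'} {M : TBA Q S C} {loc : Q → Q'} {clk : C' → C}
    (hP : Projects A M loc clk) :
    EvolvesBySucc (trackSet A M loc clk) (obsSucc M loc clk) := by
  classical
  have := Fintype.ofFinite C
  intro o φ I e
  refine ⟨trackSet_concat_eq hP o φ I e, trackSet_concat_le hP o φ I e, ?_, ?_⟩
  · rw [trackSet_concat_ge hP]
    exact isLeast_fixedPoint (isRelImage_obsSucc φ I) _ e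
  -- Any symbolic representation of the tracked set supplies a denominator, and with it a number of
  -- iterations that suffices.
  · obtain ⟨X, hX⟩ := exists_sym_toSet_eq_trackSet hP o
    obtain ⟨hD, hs, hlo, hhi⟩ := updateDenom_spec X I.code
    exact ⟨_, iterate_iterBound_eq hP o φ I e hD hlo hhi (X.toDiff _)
      (by rw [SymStates.toSet_toDiff hD X hs, hX])⟩

/-! ### Runs of products -/

namespace TBA

variable {Q S C Q' C' : Type*} (N : TBA Q S C) (A : TBA Q' S C')

theorem resetVal_sum_iff (R : Set C) (R' : Set C') (u w : Val (C ⊕ C')) :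
    w = resetVal (Sum.inl '' R ∪ Sum.inr '' R') u ↔
      ((fun c => w (Sum.inl c)) = resetVal R fun c => u (Sum.inl c)) ∧
      (fun c => w (Sum.inr c)) = resetVal R' fun c => u (Sum.inr c) := by
  have hl : ∀ c, resetVal (Sum.inl '' R ∪ Sum.inr '' R') u (Sum.inl c) =
      resetVal R (fun c => u (Sum.inl c)) c := by
    intro c
    by_cases hc : c ∈ R
    · exact (if_pos (Or.inl ⟨c, hc, rfl⟩)).trans (if_pos hc).symm
    · exact (if_neg (by simpa using hc)).trans (if_neg hc).symm
  have hr : ∀ c, resetVal (Sum.inl '' R ∪ Sum.inr '' R') u (Sum.inr c) =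
      resetVal R' (fun c => u (Sum.inr c)) c := by
    intro c
    by_cases hc : c ∈ R'
    · exact (if_pos (Or.inr ⟨c, hc, rfl⟩)).trans (if_pos hc).symm
    · exact (if_neg (by simpa using hc)).trans (if_neg hc).symm
  constructor
  · rintro rfl
    exact ⟨funext hl, funext hr⟩
  · rintro ⟨h1, h2⟩
    funext c
    rcases c with c | c
    · exact (congrFun h1 c).trans (hl c).symm
    · exact (congrFun h2 c).trans (hr c).symm

theorem prod_move_iff {x y : (Q × Q' × Bool) × Val (C ⊕ C')} {d : ℝ≥0} {a : S} :
    (N.prod A).Move x d a y ↔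
      N.Move (x.1.1, fun c => x.2 (Sum.inl c)) d a (y.1.1, fun c => y.2 (Sum.inl c)) ∧
      A.Move (x.1.2.1, fun c => x.2 (Sum.inr c)) d a (y.1.2.1, fun c => y.2 (Sum.inr c)) ∧
      y.1.2.2 = N.nextBit A x.1 := by
  have hguard : ∀ (g : Guard C) (g' : Guard C') (v : Val (C ⊕ C')),
      Guard.Sat (g.map Sum.inl ++ g'.map Sum.inr) v ↔
        (g.Sat fun c => v (Sum.inl c)) ∧ g'.Sat fun c => v (Sum.inr c) := by
    intro g g' v
    simp only [Guard.Sat, Guard.map, List.mem_append, List.mem_map, or_imp, forall_and,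
      forall_exists_index, and_imp, forall_apply_eq_imp_iff₂]
  obtain ⟨⟨q, q', k⟩, v⟩ := x
  obtain ⟨⟨p, p', l⟩, w⟩ := y
  constructor
  · rintro ⟨_, ⟨⟨e, e'⟩, k', he, he', hl, rfl⟩, h1, h2, h3, h4, h5⟩
    simp only [prodTransition, Prod.mk.injEq] at h1 h2 h3 h4 h5
    obtain ⟨rfl, rfl, rfl⟩ := h1
    obtain ⟨h21, h22, h23⟩ := h2
    rw [hguard] at h4
    rw [resetVal_sum_iff] at h5
    exact ⟨⟨e, he, rfl, h21, h3, h4.1, h5.1⟩, ⟨e', he', rfl, h22, hl ▸ h3, h4.2, h5.2⟩, h23.symm⟩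
  · rintro ⟨⟨e, he, h1, h2, h3, h4, h5⟩, ⟨e', he', h1', h2', h3', h4', h5'⟩, hb⟩
    dsimp only at h1 h2 h5 h1' h2' h5' hb
    subst h1 h1' h2 h2'
    exact ⟨_, ⟨(e, e'), k, he, he', h3.trans h3'.symm, rfl⟩, rfl,
      by rw [hb]; rfl, h3, (hguard _ _ _).2 ⟨h4, h4'⟩,
      (resetVal_sum_iff _ _ _ _).2 ⟨h5, h5'⟩⟩

theorem isRun_fst_of_prod {ρ : FinTimedWord S}
    {r : Fin (ρ.len + 1) → (Q × Q' × Bool) × Val (C ⊕ C')} (h : (N.prod A).IsRun ρ r) :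
    N.IsRun ρ fun i => ((r i).1.1, fun c => (r i).2 (Sum.inl c)) := by
  refine ⟨h.1.1, ?_, fun i => ((prod_move_iff N A).1 (h.2.2 i)).1⟩
  funext c
  change (r 0).2 (Sum.inl c) = 0
  rw [h.2.1]; rfl

/-- Two runs over the same word form a run of the product. -/
theorem exists_prod_isRun {ρ : FinTimedWord S} {r : Fin (ρ.len + 1) → Q × Val C}
    {r' : Fin (ρ.len + 1) → Q' × Val C'} (h : N.IsRun ρ r) (h' : A.IsRun ρ r') :
    ∃ b : Fin (ρ.len + 1) → Bool,
      (N.prod A).IsRun ρ fun i => (((r i).1, (r' i).1, b i), Sum.elim (r i).2 (r' i).2) := by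
  -- The control bits are forced: they start at `false` and follow `nextBit` along the two runs.
  refine ⟨fun i => Fin.induction (motive := fun _ => Bool) false
    (fun i b => N.nextBit A ((r i.castSucc).1, (r' i.castSucc).1, b)) i,
    ⟨h.1, h'.1, rfl⟩, ?_, fun i => ?_⟩
  · funext c
    rcases c with c | c
    · exact congrFun h.2.1 c
    · exact congrFun h'.2.1 c
  · rw [prod_move_iff]
    exact ⟨h.2.2 i, h'.2.2 i, by dsimp only; rw [Fin.induction_succ]⟩

theorem projects_prod : Projects A (N.prod A) (fun q => q.2.1) Sum.inr where
  init _ h := h.2.1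
  move _ _ _ _ h := ((prod_move_iff N A).1 h).2.1

theorem projects_id : Projects A A id id where
  init _ h := h
  move _ _ _ _ h := h

/-! ### The reach-set from the tracked states -/

/-- The extra clock of a tracked state shows the duration of its word. The tracked set of `A` alone
is needed here, since the product misses the consistent words on which the first factor has no run.
-/
theorem langDuration_consistentWords_le_iff (o : Obs Q' S C') (t : ℝ≥0) :
    langDuration (A.consistentWords o) ≤ t ↔ ∀ x ∈ selfTrack A o, x.2 none ≤ t := by
  simp only [langDuration, iSup_le_iff, ENNReal.coe_le_coe]
  constructor
  · rintro h _ ⟨ρ, r, -, hw, rfl⟩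
    exact h ρ ⟨_, hw⟩
  · rintro h ρ ⟨r, hw⟩
    exact h _ ⟨ρ, r, hw.1, hw, rfl⟩

/-- Consistency asks for some witnessing run of `A`, while the reach-set ranges over all runs of
`N`. A run of each over the same word combines to a product run, and a product run splits again; `d`
is the time from the last event to `t`. -/
theorem reach_eq (o : Obs Q' S C') (t : ℝ≥0)
    (ht : ∀ x ∈ selfTrack A o, x.2 none ≤ t) :
    N.reach (A.consistentWords o) t =
      {x | ∃ y ∈ trackSet A (N.prod A) (fun q => q.2.1) Sum.inr o, y.1.1 = x.1 ∧
        ∃ d, y.2 none + d = t ∧ ∀ c, y.2 (some (Sum.inl c)) + d = x.2 c} := by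
  have hl := (langDuration_consistentWords_le_iff A o t).2 ht
  ext x
  constructor
  · rintro ⟨-, ρ, ⟨r', hw⟩, r, hr, rfl⟩
    obtain ⟨b, hb⟩ := exists_prod_isRun N A hr hw.1
    have hd : ρ.duration ≤ t := ht _ ⟨ρ, r', hw.1, hw, rfl⟩
    exact ⟨_, ⟨ρ, _, hb, hw, rfl⟩, rfl, t - ρ.duration, add_tsub_cancel_of_le hd, fun c => rfl⟩
  · rintro ⟨_, ⟨ρ, r, hr, hw, rfl⟩, h1, d, hd, h2⟩
    refine ⟨hl, ρ, ⟨_, hw⟩, _, isRun_fst_of_prod N A hr, Prod.ext h1.symm (funext fun c => ?_)⟩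
    have hd' : t - ρ.duration = d := by
      rw [← hd]
      exact add_tsub_cancel_left _ _
    dsimp only
    rw [hd', ← h2 c]
    rfl

end TBA

/-! ### The query -/

section Query

variable {K : Type*}

theorem constHolds_none_iff {V : Type*} (a : DiffAtom V) :
    a.constHolds (fun _ => (none : Option K)) = true ↔ a.Sat fun _ => 0 := by
  obtain ⟨⟨x, p⟩, ⟨y, q⟩, s⟩ := a
  cases s <;> simp [DiffAtom.constHolds, DiffAtom.Sat]

/-- Some represented state has a value of the clock `τ` greater than `n / D`. -/
def Exceeds {L : Type*} [Fintype K] [DecidableEq K] (τ : K) (n : ℕ) (Y : DiffStates L K) : Prop :=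
  ∃ s ∈ Y, ∀ a ∈ forgetDiff Finset.univ.toList (s.2 ++ cmpAtoms (cvar τ) none .gt n),
    a.constHolds (fun _ => (none : Option K)) = true

/-- Once all clocks are projected away, the remaining constraints compare constants, and their truth
decides whether the zone has a point with `τ` above the bound. -/
theorem exceeds_iff {L : Type*} [Fintype K] [DecidableEq K] (τ : K) {D : ℕ} (hD : 0 < D)
    (t : RatCode) (ht : t.2 + 1 ∣ D) (Y : DiffStates L K) :
    Exceeds τ (t.scale D) Y ↔ ∃ x ∈ DiffStates.toSet D Y, t.val < x.2 τ := by
  have hD' : (0 : ℝ) < D := by exact_mod_cast hD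
  have key : ∀ v : Val K, SatZone D (cmpAtoms (cvar τ) none .gt (t.scale D)) v ↔ t.val < v τ := by
    intro v
    unfold SatZone
    rw [forall_cmpAtoms_sat_iff, scaledVal_cvar, scaledVal_none, sub_zero, RatCode.scale_eq ht,
      Cmp.holds_mul_iff hD']
    exact NNReal.coe_lt_coe
  simp only [Exceeds, constHolds_none_iff, DiffStates.toSet, Set.mem_ofPred_eq]
  constructor
  · rintro ⟨s, hs, h⟩
    obtain ⟨v, hv, -⟩ := (forall_forgetDiff_sat_iff hD _ _ _ rfl rfl
      (fun c hc => absurd (Finset.mem_toList.2 (Finset.mem_univ c)) hc)).1 h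
    rw [satZone_append, key] at hv
    exact ⟨(s.1, v), ⟨s, hs, rfl, hv.1⟩, hv.2⟩
  · rintro ⟨x, ⟨s, hs, h1, h2⟩, h3⟩
    exact ⟨s, hs, (forall_forgetDiff_sat_iff hD _ _ _ rfl rfl
      (fun c hc => absurd (Finset.mem_toList.2 (Finset.mem_univ c)) hc)).2
      ⟨x.2, satZone_append.2 ⟨h2, (key _).2 h3⟩,
        fun c hc => absurd (Finset.mem_toList.2 (Finset.mem_univ c)) hc⟩⟩

variable {L R C C' : Type*} [Fintype C] [Fintype C'] [DecidableEq C] [DecidableEq C']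

/-- The clock of the first component for which a variable stands. -/
def leftClock : ZVar (Option (C ⊕ C')) → Option C
  | some (some (some (Sum.inl c))) => some c
  | _ => none

/-- The clocks other than those of the first component. -/
noncomputable def otherClocks (C C' : Type*) [Fintype C'] : List (Option (C ⊕ C')) :=
  none :: Finset.univ.toList.map fun c : C' => some (Sum.inr c)

omit [Fintype C] [DecidableEq C] [DecidableEq C'] in
theorem notMem_otherClocks_iff {c : Option (C ⊕ C')} :
    c ∉ otherClocks C C' ↔ ∃ k, c = some (Sum.inl k) := by
  rcases c with _ | c | c <;> simp [otherClocks]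

/-- The first components of the represented states at time `n / D`. -/
noncomputable def atTime (n : ℕ) (X : DiffStates (L × R) (Option (C ⊕ C'))) :
    List (L × List (DiffAtom (ZVar (Option (C ⊕ C'))))) :=
  X.map fun s => (s.1.1, forgetDiff (otherClocks C C')
    (elapseDiff s.2 ++ cmpAtoms (cvar none) none .eq n))

/-- The equation for the extra clock selects, among all delays, the one that leads exactly to the
queried time. Projection then removes the extra clock and the clocks of the witnessing component. -/
theorem toSet_toSymStates_atTime {D : ℕ} (hD : 0 < D) (t : RatCode) (ht : t.2 + 1 ∣ D)
    (X : DiffStates (L × R) (Option (C ⊕ C'))) :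
    (toSymStates leftClock D (atTime (t.scale D) X)).toSet =
      {x | ∃ y ∈ DiffStates.toSet D X, y.1.1 = x.1 ∧
        ∃ d, y.2 none + d = t.val ∧ ∀ c, y.2 (some (Sum.inl c)) + d = x.2 c} := by
  have hD' : (0 : ℝ) < D := by exact_mod_cast hD
  have key : ∀ v : Val (Option (C ⊕ C')),
      SatZone D (cmpAtoms (cvar none) none .eq (t.scale D)) v ↔ v none = t.val := by
    intro v
    unfold SatZone
    rw [forall_cmpAtoms_sat_iff, scaledVal_cvar, scaledVal_none, sub_zero, RatCode.scale_eq ht,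
      Cmp.holds_mul_iff hD']
    exact NNReal.coe_inj
  have hval : ∀ (w : Val C) (k : C),
      scaledVal (leftClock (C' := C')) D w (cvar (some (Sum.inl k))) = D * w k := fun _ _ => rfl
  rw [toSet_toSymStates _ hD]
  ext x
  have hforget : ∀ Z, (∀ a ∈ forgetDiff (otherClocks C C') Z,
      a.Sat (scaledVal leftClock D x.2)) ↔ ∃ v, SatZone D Z v ∧ ∀ k, x.2 k = v (some (Sum.inl k)) := by
    intro Z
    rw [forall_forgetDiff_sat_iff hD _ _ _ rfl rfl fun c hc => by
      obtain ⟨k, rfl⟩ := notMem_otherClocks_iff.1 hc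
      rw [hval]
      positivity]
    simp only [notMem_otherClocks_iff, forall_exists_index, forall_eq_apply_imp_iff, hval,
      mul_eq_mul_left_iff, hD'.ne', or_false, NNReal.coe_inj]
  simp only [atTime, List.mem_map, exists_exists_and_eq_and, hforget, satZone_append, key,
    satZone_elapseDiff hD, DiffStates.toSet, Set.mem_ofPred_eq]
  constructor
  · rintro ⟨s, hs, h1, w, ⟨⟨v, hv, d, rfl⟩, ht'⟩, hw⟩
    exact ⟨(s.1, v), ⟨s, hs, rfl, hv⟩, h1, d, ht', fun c => (hw c).symm⟩
  · rintro ⟨y, ⟨s, hs, h1, h2⟩, h3, d, hd, hx⟩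
    exact ⟨s, hs, by rw [h1, h3], _, ⟨⟨y.2, h2, d, rfl⟩, hd⟩, fun k => (hx k).symm⟩

/-- A common denominator of both parts of the memory and of the time. -/
def queryDenom {L' K' : Type*} (m : SymStates L K × SymStates L' K') (t : RatCode) : ℕ :=
  commonDenom m.1 * (commonDenom m.2 * (t.2 + 1))

open scoped Classical in
/-- The answer to a query. -/
noncomputable def querySym {L' : Type*}
    (m : SymStates (L × R) (Option (C ⊕ C')) × SymStates L' (Option C')) (t : RatCode) :
    SymStates L C :=
  if Exceeds none (t.scale (queryDenom m t)) (m.2.toDiff (queryDenom m t)) then []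
  else toSymStates leftClock (queryDenom m t)
    (atTime (t.scale (queryDenom m t)) (m.1.toDiff (queryDenom m t)))

theorem toSet_querySym {Q S Q' : Type*} (N : TBA Q S C) (A : TBA Q' S C')
    (o : Obs Q' S C') (m : SymStates (Q × Q' × Bool) (Option (C ⊕ C')) × SymStates Q' (Option C'))
    (h1 : m.1.toSet = trackSet A (N.prod A) (fun q => q.2.1) Sum.inr o)
    (h2 : m.2.toSet = selfTrack A o) (t : RatCode) :
    (querySym m t).toSet = N.reach (A.consistentWords o) t.val := by
  have hD : 0 < queryDenom m t := Nat.mul_pos (commonDenom_pos _)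
    (Nat.mul_pos (commonDenom_pos _) (Nat.succ_pos _))
  have ht : t.2 + 1 ∣ queryDenom m t := (dvd_mul_left _ _).mul_left _
  have hX : DiffStates.toSet (queryDenom m t) (m.1.toDiff (queryDenom m t)) = m.1.toSet :=
    SymStates.toSet_toDiff hD _ fun s hs a ha => (dvd_commonDenom _ hs ha).mul_right _
  have hY : DiffStates.toSet (queryDenom m t) (m.2.toDiff (queryDenom m t)) = m.2.toSet :=
    SymStates.toSet_toDiff hD _ fun s hs a ha =>
      ((dvd_commonDenom _ hs ha).mul_right _).mul_left _
  have hex := exceeds_iff none hD t ht (m.2.toDiff (queryDenom m t))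
  rw [hY, h2] at hex
  rw [querySym]
  split_ifs with hlate
  -- Some consistent word ends after `t`, so `t` is below the duration of the language and the
  -- reach-set is empty by convention.
  · obtain ⟨x, hx, hxt⟩ := hex.1 hlate
    have : ¬ langDuration (A.consistentWords o) ≤ (t.val : ENNReal) := fun hle =>
      absurd ((TBA.langDuration_consistentWords_le_iff A o _).1 hle x hx) (not_le.2 hxt)
    ext y
    simp [SymStates.toSet, TBA.reach, this]
  · rw [toSet_toSymStates_atTime hD t ht, hX, h1, TBA.reach_eq N A o _ fun x hx =>
      not_lt.1 fun hlt => hlate (hex.2 ⟨x, hx, hlt⟩)]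

theorem primrec₂_querySym {L' : Type*} [Primcodable L] [Primcodable R] [Primcodable L']
    [Primcodable C] [Primcodable C'] :
    Primrec₂ (querySym (L := L) (R := R) (L' := L') (C := C) (C' := C')) := by
  classical
  let α := (SymStates (L × R) (Option (C ⊕ C')) × SymStates L' (Option C')) × RatCode
  have hm1 : Primrec fun p : α => p.1.1 := Primrec.fst.comp Primrec.fst
  have hm2 : Primrec fun p : α => p.1.2 := Primrec.snd.comp Primrec.fst
  have hD : Primrec fun p : α => queryDenom p.1 p.2 :=
    Primrec.nat_mul.comp (primrec_commonDenom.comp hm1) (Primrec.nat_mul.comp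
      (primrec_commonDenom.comp hm2) (Primrec.succ.comp (Primrec.snd.comp Primrec.snd)))
  have hn : Primrec fun p : α => p.2.scale (queryDenom p.1 p.2) := primrec_scale hD Primrec.snd
  refine Primrec.ite ?_ (Primrec.const []) (primrec_toSymStates _ hD ?_)
  -- The late test is a quantifier over the list of symbolic states around a quantifier over a list
  -- of atoms, both bounded.
  · have hrel : PrimrecRel fun (s : L' × List (DiffAtom (ZVar (Option C')))) (n : ℕ) =>
        ∀ a ∈ forgetDiff Finset.univ.toList (s.2 ++ cmpAtoms (cvar none) none .gt n),
          a.constHolds (fun _ => (none : Option (Option C'))) = true := by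
      have hall := PrimrecPred.forall_mem_list
        (p := fun a : DiffAtom (ZVar (Option C')) =>
          a.constHolds (fun _ => (none : Option (Option C'))) = true)
        (Primrec.eq.comp (primrec_constHolds _) (Primrec.const true))
      exact hall.comp ((primrec_forgetDiff _).comp (Primrec.list_append.comp
        (Primrec.snd.comp Primrec.fst) ((primrec_cmpAtoms _ _ _).comp Primrec.snd)))
    exact hrel.exists_mem_list.comp (primrec_sym_toDiff hD hm2) hn
  · refine Primrec.list_map (primrec_sym_toDiff hD hm1) ?_
    exact (Primrec.fst.comp (Primrec.fst.comp Primrec.snd)).pair ((primrec_forgetDiff _).comp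
      (Primrec.list_append.comp (primrec_elapseDiff.comp (Primrec.snd.comp Primrec.snd))
        ((primrec_cmpAtoms _ _ _).comp (hn.comp Primrec.fst))))

end Query

end TimedMonitoring

/-! ### The online algorithm -/

theorem mainTheorem5 {QA QB S CA CB : Type*}
    [Finite QA] [Finite QB] [Finite S] [Finite CA] [Finite CB]
    [Primcodable QA] [Primcodable QB] [Primcodable S] [Primcodable CA] [Primcodable CB]
    (A : TBA QA S CA) (B : TBA QB S CB) :
    (∃ P : OnlineAlgorithm (Memory QA QB CA CB) (ObsCode QA S CA) RatCode
        (SymStates (QB × QA × Bool) (CB ⊕ CA)),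
      -- the algorithm computes the reach-set
      (∀ (o : Obs QA S CA) (t : RatCode), lastSup o ≤ t.val →
        ∃ M ∈ P.run (o.map ObsElem.code), ∃ R ∈ P.out M t,
          R.toSet = (B.prod A).reach (A.consistentWords o) t.val) ∧
      -- it works online on the symbolic states that capture the observation so far
      Captures A B P.init [] ∧
      (∀ (o : Obs QA S CA) (e : ObsElem QA S CA) (M : Memory QA QB CA CB), Captures A B M o →
        ∃ M' ∈ P.step M e.code, Captures A B M' (o ++ [e])) ∧
      (∀ (o : Obs QA S CA) (t : RatCode) (M : Memory QA QB CA CB), Captures A B M o →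
        lastSup o ≤ t.val →
        ∃ R ∈ P.out M t, R.toSet = (B.prod A).reach (A.consistentWords o) t.val)) ∧
    -- the captured sets evolve by iterated successors and least fixed points
    EvolvesBySucc (productTrack A B)
      (obsSucc ((B.prod A).prod A) (fun q => q.2.1) Sum.inr) ∧
    EvolvesBySucc (selfTrack A) (obsSucc A id id) := by
  classical
  have := Fintype.ofFinite CA
  have := Fintype.ofFinite CB
  have hP := TBA.projects_prod (B.prod A) A
  have hA := TBA.projects_id A
  refine ⟨?_, evolvesBySucc_trackSet hP, evolvesBySucc_trackSet hA⟩
  -- Update and query are total, indeed primitive recursive; the two parts of the memory are updated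
  -- independently.
  let P : OnlineAlgorithm (Memory QA QB CA CB) (ObsCode QA S CA) RatCode
      (SymStates (QB × QA × Bool) (CB ⊕ CA)) :=
    { init := (initSym ((B.prod A).prod A), initSym A)
      step := fun m c => Part.some
        (updateSym ((B.prod A).prod A) (fun q => q.2.1) Sum.inr m.1 c, updateSym A id id m.2 c)
      out := fun m t => Part.some (querySym m t)
      step_partrec := Computable.partrec (Primrec.to_comp
        ((primrec_updateSym ((B.prod A).prod A) _ _ (Primrec.fst.comp Primrec.fst)
          Primrec.snd).pair
          (primrec_updateSym A _ _ (Primrec.snd.comp Primrec.fst) Primrec.snd)))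
      out_partrec := Computable.partrec (Primrec.to_comp primrec₂_querySym) }
  have hinit : Captures A B P.init [] := ⟨toSet_initSym hP, toSet_initSym hA⟩
  have hstep : ∀ (o : Obs QA S CA) (e : ObsElem QA S CA) (M : Memory QA QB CA CB),
      Captures A B M o → ∃ M' ∈ P.step M e.code, Captures A B M' (o ++ [e]) := fun o e M hM =>
    ⟨_, Part.mem_some _, toSet_updateSym hP o e _ hM.1, toSet_updateSym hA o e _ hM.2⟩
  have hout : ∀ (o : Obs QA S CA) (t : RatCode) (M : Memory QA QB CA CB), Captures A B M o →
      ∃ R ∈ P.out M t, R.toSet = (B.prod A).reach (A.consistentWords o) t.val := fun o t M hM =>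
    ⟨_, Part.mem_some _, toSet_querySym (B.prod A) A o M hM.1 hM.2 t⟩
  have hrun : ∀ o : Obs QA S CA, ∃ M ∈ P.run (o.map ObsElem.code), Captures A B M o := by
    intro o
    induction o using List.reverseRecOn with
    | nil => exact ⟨_, Part.mem_some _, hinit⟩
    | append_singleton o e ih =>
      obtain ⟨M, hM, hc⟩ := ih
      obtain ⟨M', hM', hc'⟩ := hstep o e M hc
      refine ⟨M', ?_, hc'⟩
      rw [OnlineAlgorithm.run, List.map_append, List.foldlM_append]
      refine Part.mem_bind hM ?_
      exact Part.mem_bind hM' (Part.mem_some _)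
  refine ⟨P, fun o t _ => ?_, hinit, hstep, fun o t M hM _ => hout o t M hM⟩
  obtain ⟨M, hM, hc⟩ := hrun o
  exact ⟨M, hM, hout o t M hc⟩
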